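/- **Model.** Fix $\lambda>0$ (base-station intensity), path-loss exponent $\eta>2$, base-station power $P_{\rm d}>0$, maximal user power $P_{\rm u}^{(\rm M)}>0$, power-control target $\rho>0$, noise level $N_o>0$, mean self-interference attenuations $\beta_{\rm d},\beta_{\rm u}\ge 0$, overlap $\alpha\in[0,1]$, guard parameter $\epsilon\ge0$, half-duplex bandwidths $B^{\rm HD}_{\rm d},B^{\rm HD}_{\rm u}>0$, pulse types $b_{\rm d},b_{\rm u}\in\{R,T\}$ and a probability law $\nu$ on $[0,\infty)$ of mean $1$ (the law of the self-interference gain $h_{\rm s}$). For $v\in\{{\rm d},{\rm u}\}$ let $\bar v$ be the other direction, $B=\min(B^{\rm HD}_{\rm d},B^{\rm HD}_{\rm u})$, $B_v=B^{\rm HD}_v+\alpha(\epsilon+1)B$, $\Delta f=\tfrac12\big(B^{\rm HD}_{\rm d}+B^{\rm HD}_{\rm u}+2\epsilon B-2\alpha B(\epsilon+1)\big)$. With $\operatorname{sinc}x=\frac{\sin\pi x}{\pi x}$ and $k=1$ if $b=R$, $k=2$ if $b=T$, let $S(f,W,b)=\operatorname{sinc}^k(2f/W)\big/\big(\int_{\mathbb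 R}\operatorname{sinc}^{2k}(2x/W)\,dx\big)^{1/2}$ and $$\mathcal I_v=\int_{-B_v/2}^{B_v/2}S(f,B_v,b_v)^2df,\qquad \mathcal C_v=\int_{-B_v/2}^{B_v/2}S(f,B_v,b_v)\,S(f-\Delta f,B_{\bar v},b_{\bar v})\,df .$$ The test receiver is at the origin of $\mathbb R^2$. Let $(x_j)_j$ and $(y_j)_j$ be independent homogeneous Poisson point processes of intensity $\lambda$ (base stations; uplink users of other cells). In the downlink the receiver is a user served by the nearest base station $x_o$, at distance $r_o=|x_o|$. A user at distance $r$ from its serving station transmits with power $\rho r^\eta$ if $\rho r^\eta\le P_{\rm u}^{(\rm M)}$; otherwise it is silent (truncation outage). All channel power gains $h_\cdot,g_\cdot$ are exponential with mean $1$. Each active user other than the downlink test user (the users $y_j$, the intra-cell user below, and the desired user in the uplink) has a distance to its serving station distributed as $r_o$ conditionally on $\rho r_o^\eta\le P_{\rm u}^{(\rm M)}$. These gains and distances, $h_{\rm s}\sim\nu$ and a uniform angle $\varphi$ are mutually independent and independent of the positions. User $y_j$, with power $P_j$, interferes only if $P_j|y_j|^{-\eta}<\rho$; below, $\sum_{y_j}$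 is over these users. The interferences are $$I_{\rm d}=\sum_{x_j\ne x_o}P_{\rm d}h_j|x_j|^{-\eta}\mathcal I_{\rm d}^2+\sum_{y_j}P_jg_j|y_j|^{-\eta}\mathcal C_{\rm d}^2+J,\qquad I_{\rm u}=\sum_{y_j}P_jg_j|y_j|^{-\eta}\mathcal I_{\rm u}^2+\sum_{j}P_{\rm d}h_j|x_j|^{-\eta}\mathcal C_{\rm u}^2+\beta_{\rm u}h_{\rm s}P_{\rm d}\mathcal C_{\rm u}^2 .$$ In the 2-node topology (2NT) $J=\beta_{\rm d}h_{\rm s}\,\rho r_o^\eta\,\mathcal C_{\rm d}^2$; in the 3-node topology (3NT) $J=\rho\ell^\eta\, g\,|z|^{-\eta}\mathcal C_{\rm d}^2$ for an intra-cell uplink user at $z=x_o+\ell(\cos\varphi,\sin\varphi)$ with link distance $\ell$ and gain $g$. In the uplink the receiver is a base station, $(x_j)$ are the other base stations, and $P_{{\rm u}_o}=\rho r_{\rm u}^{\eta}$ is the power of the desired user at link distance $r_{\rm u}$. Then $${\rm SINR}_{\rm d}=\frac{P_{\rm d}r_o^{-\eta}h_o\,\mathcal I_{\rm d}^2}{I_{\rm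 d}+N_o\mathcal I_{\rm d}^2},\qquad {\rm SINR}_{\rm u}=\frac{P_{{\rm u}_o}r_{\rm u}^{-\eta}h_{\rm u}\,\mathcal I_{\rm u}^2}{I_{\rm u}+N_o\mathcal I_{\rm u}^2},$$ where $h_o,h_{\rm u}$ are the gains of the desired links. The outage probabilities are, for $R_d\ge0$, $\mathcal O_{\rm d}(R_d)=\mathbb P\{B_{\rm d}\log_2(1+{\rm SINR}_{\rm d})<R_d\mid \rho r_o^\eta\le P_{\rm u}^{(\rm M)}\}$ and $\mathcal O_{\rm u}(R_d)=\mathbb P\{B_{\rm u}\log_2(1+{\rm SINR}_{\rm u})<R_d\}$. **Theorem 1.** Put $R_{\rm M}=(P_{\rm u}^{(\rm M)}/\rho)^{1/\eta}$ and $f_R(r)=\dfrac{2\pi\lambda r e^{-\pi\lambda r^2}}{1-e^{-\pi\lambda R_{\rm M}^2}}$. For both topologies and every $R_d\ge 0$, the integrand below is integrable and $$\mathcal O_{\rm d}(R_d)=1-\int_0^{R_{\rm M}}f_R(r_o)\,\exp\!\Big(\frac{N_o(1-2^{R_d/B_{\rm d}})}{P_{\rm d}r_o^{-\eta}}\Big)\,\mathcal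 L_{I_{\rm d}}\!\Big(r_o,\frac{2^{R_d/B_{\rm d}}-1}{P_{\rm d}r_o^{-\eta}|\mathcal I_{\rm d}|^2}\Big)dr_o ,$$ $$\mathcal O_{\rm u}(R_d)=1-\exp\!\Big(\frac{N_o(1-2^{R_d/B_{\rm u}})}{\rho}\Big)\,\mathcal L_{I_{\rm u}}\!\Big(\frac{2^{R_d/B_{\rm u}}-1}{\rho|\mathcal I_{\rm u}|^2}\Big),$$ where, with $F(z)={}_2F_1[1,1-\tfrac2\eta;2-\tfrac2\eta;z]$ (analytically continued to $z<1$) and $M=\dfrac{\rho^{2/\eta}\gamma(2,\pi\lambda R_{\rm M}^2)}{\pi\lambda(1-e^{-\pi\lambda R_{\rm M}^2})}$ ($\gamma$ the lower incomplete gamma function), $$\mathcal L_{I_{\rm d}}(r_o,s)=e^{-\frac{2\pi\lambda}{\eta-2}r_o^{2-\eta}|\mathcal I_{\rm d}|^2sP_{\rm d}F(-r_o^{-\eta}P_{\rm d}|\mathcal I_{\rm d}|^2s)}\;e^{-\frac{2\pi\lambda\rho^{1-2/\eta}}{\eta-2}M|\mathcal C_{\rm d}|^2sF(-\rho|\mathcal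 C_{\rm d}|^2s)}\;U_1(r_o,s)\,U_2(r_o,s),$$ $$\mathcal L_{I_{\rm u}}(s)=e^{-\frac{2\pi\lambda\rho^{1-2/\eta}}{\eta-2}M|\mathcal I_{\rm u}|^2sF(-\rho|\mathcal I_{\rm u}|^2s)}\;e^{-\frac{2\pi^2\lambda}{\eta}(s|\mathcal C_{\rm u}|^2P_{\rm d})^{2/\eta}\csc(2\pi/\eta)}\;U_3(s),$$ $U_1=1$ for 2NT and $$U_1(r_o,s)=\int_0^{R_{\rm M}}\!\!\int_0^\pi\frac{f_R(r)\,d\theta\,dr}{\pi+\pi s|\mathcal C_{\rm d}|^2\rho\big(1+(\tfrac{r_o}{r})^2-2\tfrac{r_o}{r}\cos\theta\big)^{-\eta/2}}$$ for 3NT; $U_2=1$ for 3NT and $U_2(r_o,s)=\int e^{-\beta_{\rm d}sh\rho r_o^\eta|\mathcal C_{\rm d}|^2}d\nu(h)$ for 2NT; $U_3(s)=\int e^{-\beta_{\rm u}shP_{\rm d}|\mathcal C_{\rm u}|^2}d\nu(h)$. -/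

import Mathlib

open MeasureTheory ProbabilityTheory

namespace CellularOutage

noncomputable section

/-! ## Special functions -/

/-- Gauss' hypergeometric function `₂F₁[a, b; c; z]` for `0 < b < c` and real `z < 1`, through
Euler's integral: the analytic continuation of the hypergeometric series to `(-∞, 1)`
(the series itself converges only for `|z| < 1`). -/
def hypergeom (a b c z : ℝ) : ℝ :=
  Real.Gamma c / (Real.Gamma b * Real.Gamma (c - b)) *
    ∫ t in (0 : ℝ)..1, t ^ (b - 1) * (1 - t) ^ (c - b - 1) * (1 - z * t) ^ (-a)

/-- The lower incomplete gamma function `γ(s, x)`. -/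
def lowerGamma (s x : ℝ) : ℝ := ∫ t in (0 : ℝ)..x, t ^ (s - 1) * Real.exp (-t)

/-! ## System parameters, pulse shapes and filtering factors -/

/-- Rectangular or triangular pulse. -/
inductive Pulse
  | rect
  | tri

/-- Downlink or uplink. -/
inductive Link
  | dl
  | ul

/-- The opposite transmission direction. -/
def Link.opp : Link → Link
  | .dl => .ul
  | .ul => .dl

/-- 2-node topology (full-duplex users) or 3-node topology (half-duplex users). -/
inductive Mode
  | twoNode
  | threeNode

/-- Normalized sinc, `sin (π x) / (π x)`. -/
def nsinc (x : ℝ) : ℝ := Real.sinc (Real.pi * x)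

/-- The (real-valued) unit-energy pulse spectrum `S(f, W, b)` with null-to-null bandwidth `W`. -/
def pulseSpectrum (f W : ℝ) : Pulse → ℝ
  | .rect => nsinc (2 * f / W) / Real.sqrt (∫ x : ℝ, nsinc (2 * x / W) ^ 2)
  | .tri => nsinc (2 * f / W) ^ 2 / Real.sqrt (∫ x : ℝ, nsinc (2 * x / W) ^ 4)

/-- The parameters of the cellular system. -/
structure Params where
  /-- intensity of the base stations -/
  lam : ℝ
  /-- path-loss exponent -/
  eta : ℝ
  /-- base station transmit power -/
  Pd : ℝ
  /-- maximum user transmit power -/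
  PuMax : ℝ
  /-- target average received power of the uplink power control -/
  rho : ℝ
  /-- noise level -/
  No : ℝ
  /-- mean self-interference attenuation, at the receiver of the given direction -/
  beta : Link → ℝ
  /-- overlap parameter -/
  alpha : ℝ
  /-- guard band parameter -/
  eps : ℝ
  /-- half-duplex bandwidths -/
  bandHD : Link → ℝ
  /-- pulse shapes used in each direction -/
  pulse : Link → Pulse
  lam_pos : 0 < lam
  two_lt_eta : 2 < eta
  Pd_pos : 0 < Pd
  PuMax_pos : 0 < PuMax
  rho_pos : 0 < rho
  No_pos : 0 < No
  beta_nonneg : ∀ v, 0 ≤ beta v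
  alpha_nonneg : 0 ≤ alpha
  alpha_le_one : alpha ≤ 1
  eps_nonneg : 0 ≤ eps
  bandHD_pos : ∀ v, 0 < bandHD v

namespace Params

variable (p : Params)

/-- `B = min (B_d^HD, B_u^HD)`. -/
def bandMin : ℝ := min (p.bandHD .dl) (p.bandHD .ul)

/-- The bandwidth `B_v^{αD}` of direction `v`. -/
def band (v : Link) : ℝ := p.bandHD v + p.alpha * (p.eps + 1) * p.bandMin

/-- Difference of the downlink and uplink centre frequencies. -/
def freqGap : ℝ :=
  (p.bandHD .dl + p.bandHD .ul + 2 * p.eps * p.bandMin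
    - 2 * p.alpha * p.bandMin * (p.eps + 1)) / 2

/-- Intra-mode effective received energy factor `𝓘_v(α)`. -/
def intra (v : Link) : ℝ :=
  ∫ f in (-(p.band v / 2))..(p.band v / 2),
    pulseSpectrum f (p.band v) (p.pulse v) * pulseSpectrum f (p.band v) (p.pulse v)

/-- Cross-mode effective received energy factor `𝓒_v(α)`. -/
def cross (v : Link) : ℝ :=
  ∫ f in (-(p.band v / 2))..(p.band v / 2),
    pulseSpectrum f (p.band v) (p.pulse v) *
      pulseSpectrum (f - p.freqGap) (p.band v.opp) (p.pulse v.opp)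

/-- Effective noise power after filtering. -/
def noise (v : Link) : ℝ := p.No * |p.intra v| ^ 2

/-- Truncated channel inversion: the transmit power of a user at distance `r` from its serving
base station is `ρ r^η` if this does not exceed the maximum; otherwise the user is silent. -/
def txPower (r : ℝ) : ℝ :=
  if p.rho * r ^ p.eta ≤ p.PuMax then p.rho * r ^ p.eta else 0

/-! ## The closed-form expressions -/

/-- `R_M = (P_u^(M) / ρ)^{1/η}`. -/
def RM : ℝ := (p.PuMax / p.rho) ^ (1 / p.eta)

/-- The truncated serving-distance density `f_R`. -/
def fR (r : ℝ) : ℝ :=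
  2 * Real.pi * p.lam * r * Real.exp (-(Real.pi * p.lam * r ^ 2)) /
    (1 - Real.exp (-(Real.pi * p.lam * p.RM ^ 2)))

/-- The closed form of `𝔼[P_u^{2/η}]`. -/
def powerMoment : ℝ :=
  p.rho ^ (2 / p.eta) * lowerGamma 2 (Real.pi * p.lam * p.RM ^ 2) /
    (Real.pi * p.lam * (1 - Real.exp (-(Real.pi * p.lam * p.RM ^ 2))))

/-- The factor `U₁(r_o, s)` (intra-cell uplink user). -/
def U1 (r₀ s : ℝ) : Mode → ℝ
  | .twoNode => 1
  | .threeNode =>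
      ∫ r in (0 : ℝ)..p.RM, ∫ θ in (0 : ℝ)..Real.pi,
        p.fR r / (Real.pi + Real.pi * s * |p.cross .dl| ^ 2 * p.rho *
          (1 + (r₀ / r) ^ 2 - 2 * (r₀ / r) * Real.cos θ) ^ (-p.eta / 2))

/-- The factor `U₂(r_o, s)` (downlink self-interference), `ν` being the law of `h_s`. -/
def U2 (ν : Measure ℝ) (r₀ s : ℝ) : Mode → ℝ
  | .threeNode => 1
  | .twoNode =>
      ∫ h, Real.exp (-(p.beta .dl * s * h * p.rho * r₀ ^ p.eta * |p.cross .dl| ^ 2)) ∂ν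

/-- The factor `U₃(s)` (uplink self-interference), `ν` being the law of `h_s`. -/
def U3 (ν : Measure ℝ) (s : ℝ) : ℝ :=
  ∫ h, Real.exp (-(p.beta .ul * s * h * p.Pd * |p.cross .ul| ^ 2)) ∂ν

/-- The expression `𝓛_{I_d}(s)`, for serving distance `r_o`. -/
def LId (m : Mode) (ν : Measure ℝ) (r₀ s : ℝ) : ℝ :=
  Real.exp (-2 * Real.pi * p.lam / (p.eta - 2) * r₀ ^ (2 - p.eta) * |p.intra .dl| ^ 2 * s * p.Pd *
      hypergeom 1 (1 - 2 / p.eta) (2 - 2 / p.eta)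
        (-(r₀ ^ (-p.eta) * p.Pd * |p.intra .dl| ^ 2 * s))) *
  Real.exp (-2 * Real.pi * p.lam * p.rho ^ (1 - 2 / p.eta) / (p.eta - 2) * p.powerMoment *
      |p.cross .dl| ^ 2 * s *
      hypergeom 1 (1 - 2 / p.eta) (2 - 2 / p.eta) (-(p.rho * |p.cross .dl| ^ 2 * s))) *
  p.U1 r₀ s m * p.U2 ν r₀ s m

/-- The expression `𝓛_{I_u}(s)`. -/
def LIu (ν : Measure ℝ) (s : ℝ) : ℝ :=
  Real.exp (-2 * Real.pi * p.lam * p.rho ^ (1 - 2 / p.eta) / (p.eta - 2) * p.powerMoment *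
      |p.intra .ul| ^ 2 * s *
      hypergeom 1 (1 - 2 / p.eta) (2 - 2 / p.eta) (-(p.rho * |p.intra .ul| ^ 2 * s))) *
  Real.exp (-(2 * Real.pi ^ 2 * p.lam / p.eta) * (s * |p.cross .ul| ^ 2 * p.Pd) ^ (2 / p.eta) *
      (1 / Real.sin (2 * Real.pi / p.eta))) *
  p.U3 ν s

end Params

/-! ## The random network -/

/-- The Euclidean plane. -/
abbrev Plane : Type := EuclideanSpace ℝ (Fin 2)

/-- Number of points of the family `X` in the set `A`. -/
def pointCount {Ω : Type*} (X : ℕ → Ω → Plane) (A : Set Plane) (ω : Ω) : ℕ∞ :=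
  {j | X j ω ∈ A}.encard

/-- `X₀, X₁, …` enumerates a Poisson point process of intensity measure `Λ` (with infinitely
many points): the counts of sets of finite intensity are Poisson, and the counts of disjoint
sets are independent. -/
structure IsPoissonProcess {Ω : Type*} [MeasurableSpace Ω] (X : ℕ → Ω → Plane)
    (Λ : Measure Plane) (μ : Measure Ω) : Prop where
  measurable : ∀ j, Measurable (X j)
  count_law : ∀ A : Set Plane, MeasurableSet A → Λ A ≠ ⊤ →
    HasLaw (pointCount X A) ((poissonMeasure (Λ A).toNNReal).map (fun n : ℕ => (n : ℕ∞))) μ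
  count_indep : ∀ (n : ℕ) (A : Fin n → Set Plane), (∀ i, MeasurableSet (A i)) →
    (∀ i, Λ (A i) ≠ ⊤) → Pairwise (Function.onFun Disjoint A) →
    iIndepFun (fun i => pointCount X (A i)) μ

/-- Labels of the real random variables of the model. -/
inductive Mark
  /-- channel gain from base station `j` to the test receiver -/
  | bsGain (j : ℕ)
  /-- channel gain from interfering user `j` to the test receiver -/
  | ueGain (j : ℕ)
  /-- distance of interfering user `j` from its own serving base station -/
  | ueDist (j : ℕ)
  /-- self-interference channel gain `h_s` -/
  | selfGain
  /-- distance of the intra-cell uplink user (3-node topology) from the test user's station -/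
  | cellDist
  /-- direction in which that user is seen from that station -/
  | cellAngle
  /-- channel gain from that user to the test user -/
  | cellGain
  /-- distance between the uplink test station and the uplink user that it serves -/
  | ulDist
  /-- channel gain of the desired uplink transmission -/
  | ulGain

/-- The random objects of the model. The test receiver is at the origin: in the downlink it is
a user, in the uplink a base station. -/
structure Network (Ω : Type*) where
  /-- In the downlink: all base stations. In the uplink: all base stations but the test one. -/
  bs : ℕ → Ω → Plane
  /-- The users of other cells which transmit on the uplink channel. -/
  ue : ℕ → Ω → Plane
  /-- Channel gains, distances and angle. -/
  mark : Mark → Ω → ℝ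

namespace Network

variable {Ω : Type*} (N : Network Ω) (p : Params)

/-- Index of the base station nearest to the origin. -/
def serving (ω : Ω) : ℕ := sInf {j : ℕ | ∀ k, ‖N.bs j ω‖ ≤ ‖N.bs k ω‖}

/-- Distance from the origin to the nearest base station. -/
def servingDist (ω : Ω) : ℝ := ‖N.bs (N.serving ω) ω‖

/-- The event that a user at the origin, served by the nearest base station, can maintain the
received power `ρ` there, i.e. is not in truncation outage. -/
def active : Set Ω := {ω | p.rho * N.servingDist ω ^ p.eta ≤ p.PuMax}

/-- Law of the distance between a user not in truncation outage and its serving station. -/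
def linkDistLaw [MeasurableSpace Ω] (μ : Measure Ω) : Measure ℝ :=
  (μ[|N.active p]).map N.servingDist

/-- Laws of the real random variables; `ν` is the law of the self-interference gain. -/
def markLaw [MeasurableSpace Ω] (ν : Measure ℝ) (μ : Measure Ω) : Mark → Measure ℝ
  | .bsGain _ => expMeasure 1
  | .ueGain _ => expMeasure 1
  | .ueDist _ => N.linkDistLaw p μ
  | .selfGain => ν
  | .cellDist => N.linkDistLaw p μ
  | .cellAngle => volume[|Set.Ioc (-Real.pi) Real.pi]
  | .cellGain => expMeasure 1
  | .ulDist => N.linkDistLaw p μ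
  | .ulGain => expMeasure 1

/-- The stochastic model: base stations and interfering users form independent homogeneous
Poisson point processes of intensity `λ`, and all gains, link distances and the angle are
mutually independent, independent of the positions, and distributed as prescribed. -/
structure IsModel [MeasurableSpace Ω] (ν : Measure ℝ) (μ : Measure Ω) : Prop where
  bs_poisson : IsPoissonProcess N.bs (ENNReal.ofReal p.lam • volume) μ
  ue_poisson : IsPoissonProcess N.ue (ENNReal.ofReal p.lam • volume) μ
  mark_measurable : ∀ i, Measurable (N.mark i)
  mark_law : ∀ i, HasLaw (N.mark i) (N.markLaw p ν μ i) μ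
  mark_indep : iIndepFun N.mark μ
  bs_indep_ue : IndepFun (fun ω j => N.bs j ω) (fun ω j => N.ue j ω) μ
  pos_indep_mark :
    IndepFun (fun ω => ((fun j => N.bs j ω), (fun j => N.ue j ω))) (fun ω i => N.mark i ω) μ

/-- Transmit power of interfering user `j`. -/
def uePower (j : ℕ) (ω : Ω) : ℝ := p.txPower (N.mark (.ueDist j) ω)

/-- Interference of the users of other cells, with filtering factor `c`. By the association and
the uplink power control, a user whose mean received power at the test receiver would be `ρ` or
more is not among the interferers. -/
def ueInterference (c : ℝ) (ω : Ω) : ENNReal :=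
  open Classical in
  ∑' j, if N.uePower p j ω * ‖N.ue j ω‖ ^ (-p.eta) < p.rho then
      ENNReal.ofReal
        (N.uePower p j ω * N.mark (.ueGain j) ω * ‖N.ue j ω‖ ^ (-p.eta) * |c| ^ 2)
    else 0

/-- Position of the intra-cell uplink user of the 3-node topology. -/
def cellUser (ω : Ω) : Plane :=
  N.bs (N.serving ω) ω +
    N.mark .cellDist ω • !₂[Real.cos (N.mark .cellAngle ω), Real.sin (N.mark .cellAngle ω)]

/-- Aggregate downlink interference: all base stations but the serving one, the uplink users of
other cells, and the self-interference (2-node topology) or the uplink user of the same cell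
(3-node topology). -/
def dlInterference (m : Mode) (ω : Ω) : ENNReal :=
  (∑' j, if j = N.serving ω then 0 else
      ENNReal.ofReal
        (p.Pd * N.mark (.bsGain j) ω * ‖N.bs j ω‖ ^ (-p.eta) * |p.intra .dl| ^ 2)) +
  N.ueInterference p (p.cross .dl) ω +
  match m with
  | .twoNode => ENNReal.ofReal
      (p.beta .dl * N.mark .selfGain ω * p.txPower (N.servingDist ω) * |p.cross .dl| ^ 2)
  | .threeNode => ENNReal.ofReal
      (p.txPower (N.mark .cellDist ω) * N.mark .cellGain ω * ‖N.cellUser ω‖ ^ (-p.eta) *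
        |p.cross .dl| ^ 2)

/-- Aggregate uplink interference: the uplink users and the base stations of other cells, and
the self-interference of the test base station. -/
def ulInterference (ω : Ω) : ENNReal :=
  N.ueInterference p (p.intra .ul) ω +
  (∑' j, ENNReal.ofReal
      (p.Pd * N.mark (.bsGain j) ω * ‖N.bs j ω‖ ^ (-p.eta) * |p.cross .ul| ^ 2)) +
  ENNReal.ofReal (p.beta .ul * N.mark .selfGain ω * p.Pd * |p.cross .ul| ^ 2)

/-- Downlink SINR of the test user. -/
def dlSINR (m : Mode) (ω : Ω) : ℝ :=
  (ENNReal.ofReal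
      (p.Pd * N.servingDist ω ^ (-p.eta) * N.mark (.bsGain (N.serving ω)) ω * |p.intra .dl| ^ 2) /
    (N.dlInterference p m ω + ENNReal.ofReal (p.noise .dl))).toReal

/-- Uplink SINR of the test base station. -/
def ulSINR (ω : Ω) : ℝ :=
  (ENNReal.ofReal
      (p.txPower (N.mark .ulDist ω) * N.mark .ulDist ω ^ (-p.eta) * N.mark .ulGain ω *
        |p.intra .ul| ^ 2) /
    (N.ulInterference p ω + ENNReal.ofReal (p.noise .ul))).toReal

/-- Downlink outage probability of a test user which is not in truncation outage. -/
def dlOutage [MeasurableSpace Ω] (m : Mode) (μ : Measure Ω) (Rd : ℝ) : ℝ :=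
  (μ[|N.active p]).real {ω | p.band .dl * Real.logb 2 (1 + N.dlSINR p m ω) < Rd}

/-- Uplink outage probability of a test base station and the active user that it serves. -/
def ulOutage [MeasurableSpace Ω] (μ : Measure Ω) (Rd : ℝ) : ℝ :=
  μ.real {ω | p.band .ul * Real.logb 2 (1 + N.ulSINR p ω) < Rd}

end Network

end

end CellularOutage

-- The gain of the desired link is exponential, so P(h ≥ t) = e^{-t}. Given everything else, the
-- link meets the SINR threshold T with probability exp(-s(I + noise)), where s is T divided by the
-- mean received power. A success probability is therefore a noise factor times the Laplace
-- transform of the interference at s (`expMeasure_le_ofReal`, `measure_success`), and the outage is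
-- its complement.
--
-- The transform is computed in two stages. Given the positions, the marks are independent and the
-- transform is a product: a base station at distance u contributes 1/(1 + K u^{-η}), a user of
-- another cell contributes the average of such a factor over its link distance, and the
-- self-interference or the intra-cell user gives U₁, U₂, U₃. The positions are then averaged by the
-- Poisson functional E ∏ φ(x_j) = exp(-∫ (1 - φ) dΛ) of `IsPoissonProcess.lintegral_expNeg_tsum`,
-- which comes from the independent Poisson counts on the level sets of simple functions.
--
-- In the downlink the product omits the nearest station and depends on its distance r_o. For a
-- fixed φ, the Poisson functional with φ replaced by 0 on the disc of radius t computes E[∏ φ; r_o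
-- > t]. These tails have hazard rate 2πλuφ(u), which identifies the law of r_o weighted by the full
-- product; dividing by φ(r_o) removes the nearest station (`lintegral_servingDist_mul_expNeg`). In
-- the application φ itself depends on r_o through K = T r_o^η; this is reached by freezing r_o at
-- dyadic values and passing to the limit (`lintegral_servingDist_mul_expNeg_rpow`).
--
-- For the closed forms, when K = a R^η the substitution u = R t^{-1/η} turns the integral over u >
-- R into R² times Euler's integral for F(-a). Stations use R = r_o and a = T. For users, power
-- control makes K = sρd^η and the condition P|y|^{-η} < ρ becomes d < |y|: the same integral with R
-- = d, so that only the second moment of the link distance enters, through M. In the uplink the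
-- stations fill the whole plane and a beta integral gives the cosecant.
--
-- Costs live in [0, ∞] with `expNeg ⊤ = 0`, so products over points are exponentials of sums that
-- always exist, and no finiteness of the interference has to be proved.

open scoped ENNReal NNReal Topology

namespace CellularOutage

-- The exponential of an extended nonnegative cost

/-- `exp (-x)` for an extended nonnegative real `x`. -/
noncomputable def expNeg (x : ℝ≥0∞) : ℝ≥0∞ := EReal.exp (-(x : EReal))

/-- The inverse `-log u` of `expNeg` on `[0, 1]`. -/
noncomputable def negLog (u : ℝ≥0∞) : ℝ≥0∞ := (-(ENNReal.log u)).toENNReal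

@[simp] lemma expNeg_zero : expNeg 0 = 1 := by simp [expNeg]

@[simp] lemma expNeg_top : expNeg ⊤ = 0 := by simp [expNeg]

lemma expNeg_add (x y : ℝ≥0∞) : expNeg (x + y) = expNeg x * expNeg y := by
  rw [expNeg, expNeg, expNeg, ← EReal.exp_add, EReal.coe_ennreal_add, EReal.neg_add, sub_eq_add_neg]
  · exact Or.inl (by simp)
  · exact Or.inr (by simp)

lemma expNeg_antitone : Antitone expNeg := fun x y h => by
  unfold expNeg
  gcongr
  simpa using h

lemma expNeg_le_one (x : ℝ≥0∞) : expNeg x ≤ 1 := by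
  simpa using expNeg_antitone (zero_le : 0 ≤ x)

lemma expNeg_ne_top (x : ℝ≥0∞) : expNeg x ≠ ⊤ :=
  ne_top_of_le_ne_top ENNReal.one_ne_top (expNeg_le_one x)

lemma continuous_expNeg : Continuous expNeg :=
  ENNReal.continuous_exp.comp (continuous_neg.comp continuous_coe_ennreal_ereal)

@[fun_prop] lemma measurable_expNeg : Measurable expNeg := continuous_expNeg.measurable

lemma expNeg_ofReal {t : ℝ} (ht : 0 ≤ t) :
    expNeg (ENNReal.ofReal t) = ENNReal.ofReal (Real.exp (-t)) := by
  rw [expNeg, EReal.coe_ennreal_ofReal, max_eq_left ht, ← EReal.coe_neg, EReal.exp_coe]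

lemma expNeg_nat_mul (n : ℕ) (x : ℝ≥0∞) : expNeg (n * x) = expNeg x ^ n := by
  induction n with
  | zero => simp
  | succ n ih => rw [Nat.cast_succ, add_mul, one_mul, expNeg_add, ih, pow_succ]

lemma expNeg_sum {ι : Type*} (s : Finset ι) (f : ι → ℝ≥0∞) :
    expNeg (∑ i ∈ s, f i) = ∏ i ∈ s, expNeg (f i) := by
  classical
  induction s using Finset.induction_on with
  | empty => simp
  | insert a s ha ih => rw [Finset.sum_insert ha, Finset.prod_insert ha, expNeg_add, ih]

/-- Costs add where factors multiply; this replaces any convergence theory of infinite products. -/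
lemma tendsto_prod_expNeg {ι : Type*} (f : ι → ℝ≥0∞) :
    Filter.Tendsto (fun s : Finset ι => ∏ i ∈ s, expNeg (f i)) Filter.atTop
      (𝓝 (expNeg (∑' i, f i))) := by
  have h := (continuous_expNeg.tendsto _).comp (ENNReal.summable (f := f)).hasSum
  exact h.congr fun s => expNeg_sum s f

lemma expNeg_negLog {u : ℝ≥0∞} (hu : u ≤ 1) : expNeg (negLog u) = u := by
  rw [expNeg, negLog, EReal.coe_toENNReal, neg_neg, ENNReal.exp_log]
  simpa using (ENNReal.log_le_zero_iff.2 hu)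

@[fun_prop] lemma measurable_negLog : Measurable negLog :=
  measurable_ereal_toENNReal.comp (measurable_neg.comp ENNReal.measurable_log)

/-- Summing the exponential series gives the Poisson generating function at u = exp (-c). At c = ∞
it is the void probability, because `0 * ⊤ = 0`. -/
lemma lintegral_expNeg_mul_poissonMeasure (r : ℝ≥0) (c : ℝ≥0∞) :
    ∫⁻ n : ℕ, expNeg (n * c) ∂poissonMeasure r = expNeg (r * (1 - expNeg c)) := by
  set u : ℝ := (expNeg c).toReal with hu
  have hu0 : 0 ≤ u := ENNReal.toReal_nonneg
  have hu1 : u ≤ 1 := by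
    simpa using ENNReal.toReal_mono ENNReal.one_ne_top (expNeg_le_one c)
  have hc : expNeg c = ENNReal.ofReal u := (ENNReal.ofReal_toReal (expNeg_ne_top c)).symm
  have hR : (r : ℝ≥0∞) * (1 - expNeg c) = ENNReal.ofReal (r * (1 - u)) := by
    rw [hc, ← ENNReal.ofReal_one, ← ENNReal.ofReal_sub _ hu0,
      ENNReal.ofReal_mul r.coe_nonneg, ENNReal.ofReal_coe_nnreal]
  rw [hR, expNeg_ofReal (mul_nonneg r.coe_nonneg (by linarith)), lintegral_countable']
  have h1 : ∀ n : ℕ, expNeg (n * c) * poissonMeasure r {n} =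
      ENNReal.ofReal (Real.exp (-r) * ((r * u) ^ n / n.factorial)) := fun n => by
    rw [poissonMeasure_singleton, expNeg_nat_mul, hc, ← ENNReal.ofReal_pow hu0,
      ← ENNReal.ofReal_mul (by positivity)]
    congr 1
    ring
  simp_rw [h1]
  have hs : HasSum (fun n : ℕ => Real.exp (-r) * ((r * u : ℝ) ^ n / n.factorial))
      (Real.exp (-r) * Real.exp (r * u)) := by
    have := NormedSpace.expSeries_div_hasSum_exp (𝔸 := ℝ) (r * u)
    rw [← Real.exp_eq_exp_ℝ] at this
    exact this.mul_left _
  rw [← ENNReal.ofReal_tsum_of_nonneg (fun n => by positivity) hs.summable, hs.tsum_eq,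
    ← Real.exp_add]
  congr 2
  ring

-- The probability generating functional of a Poisson process

section

variable {Ω : Type*}

lemma pointCount_eq_tsum (X : ℕ → Ω → Plane) (A : Set Plane) (ω : Ω) :
    ((pointCount X A ω : ℕ∞) : ℝ≥0∞) = ∑' j, A.indicator 1 (X j ω) := by
  rw [pointCount, ← ENNReal.tsum_set_one, tsum_subtype {j | X j ω ∈ A} (fun _ => (1 : ℝ≥0∞))]
  rfl

/-- Grouping the points by the value of g leaves finitely many weighted counts, the form in which
independence of counts applies. -/
lemma tsum_simpleFunc_indicator (X : ℕ → Ω → Plane) (g : SimpleFunc Plane ℝ≥0∞) (B : Set Plane)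
    (ω : Ω) :
    ∑' j, B.indicator g (X j ω) =
      ∑ c ∈ g.range, ((pointCount X (g ⁻¹' {c} ∩ B) ω : ℕ∞) : ℝ≥0∞) * c := by
  classical
  simp_rw [pointCount_eq_tsum, ← ENNReal.tsum_mul_right]
  rw [← Summable.tsum_finsetSum (fun _ _ => ENNReal.summable)]
  congr 1
  funext j
  by_cases hB : X j ω ∈ B
  · rw [Finset.sum_eq_single (g (X j ω))]
    · simp [hB]
    · intro c _ hc
      simp [Set.indicator, hB, hc.symm]
    · intro h
      exact absurd (g.mem_range_self _) h
  · simp [hB]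

namespace IsPoissonProcess

variable [MeasurableSpace Ω] {μ : Measure Ω} {X : ℕ → Ω → Plane} {Λ : Measure Plane}

lemma lintegral_expNeg_pointCount (hX : IsPoissonProcess X Λ μ) {A : Set Plane}
    (hA : MeasurableSet A) (hΛ : Λ A ≠ ⊤) (c : ℝ≥0∞) :
    ∫⁻ ω, expNeg ((pointCount X A ω : ℕ∞) * c) ∂μ = expNeg (Λ A * (1 - expNeg c)) := by
  rw [(hX.count_law A hA hΛ).lintegral_comp (f := fun n : ℕ∞ => expNeg (n * c))
    (measurable_of_countable _).aemeasurable,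
    lintegral_map (measurable_of_countable _) (measurable_of_countable _)]
  simpa [ENNReal.coe_toNNReal hΛ] using
    lintegral_expNeg_mul_poissonMeasure (Λ A).toNNReal c

lemma measurable_tsum (hX : IsPoissonProcess X Λ μ) {g : Plane → ℝ≥0∞} (hg : Measurable g) :
    Measurable fun ω => ∑' j, g (X j ω) :=
  Measurable.tsum fun j => hg.comp (hX.measurable j)

/-- The level sets of g inside B are disjoint and of finite intensity, so their counts are
independent Poisson variables and the generating functions multiply. -/
lemma lintegral_expNeg_tsum_indicator (hX : IsPoissonProcess X Λ μ) (g : SimpleFunc Plane ℝ≥0∞)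
    {B : Set Plane} (hB : MeasurableSet B) (hΛ : Λ B ≠ ⊤) :
    ∫⁻ ω, expNeg (∑' j, B.indicator g (X j ω)) ∂μ =
      expNeg (∫⁻ x in B, (1 - expNeg (g x)) ∂Λ) := by
  classical
  let e := g.range.equivFin
  let A : Fin g.range.card → Set Plane := fun i => g ⁻¹' {((e.symm i : g.range) : ℝ≥0∞)} ∩ B
  have hA : ∀ i, MeasurableSet (A i) := fun i => (g.measurableSet_fiber _).inter hB
  have hAΛ : ∀ i, Λ (A i) ≠ ⊤ := fun i =>
    ne_top_of_le_ne_top hΛ (measure_mono Set.inter_subset_right)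
  have hd : Pairwise (Function.onFun Disjoint A) := by
    intro i j hij
    refine Set.disjoint_left.2 fun x hx hx' => hij ?_
    have h : ((e.symm i : g.range) : ℝ≥0∞) = (e.symm j : g.range) := by
      rw [← hx.1, ← hx'.1]
    exact e.symm.injective (Subtype.ext h)
  have hind := (hX.count_indep _ A hA hAΛ hd).comp
    (fun i (n : ℕ∞) => expNeg (n * ((e.symm i : g.range) : ℝ≥0∞)))
    (fun i => measurable_of_countable _)
  have key := lintegral_prod_eq_prod_lintegral_of_indepFun Finset.univ _ hind (fun i => by
    have : Measurable fun ω => ((pointCount X (A i) ω : ℕ∞) : ℝ≥0∞) := by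
      simp_rw [pointCount_eq_tsum]
      exact hX.measurable_tsum (measurable_one.indicator (hA i))
    exact measurable_expNeg.comp (this.mul_const _))
  have hsum : ∀ F : ℝ≥0∞ → ℝ≥0∞, ∑ c ∈ g.range, F c =
      ∑ i, F ((e.symm i : g.range) : ℝ≥0∞) := fun F => by
    rw [← Finset.sum_coe_sort, ← e.symm.sum_comp]
  simp_rw [tsum_simpleFunc_indicator, hsum, expNeg_sum]
  refine key.trans ?_
  simp only [Function.comp_apply, hX.lintegral_expNeg_pointCount (hA _) (hAΛ _)]
  rw [← expNeg_sum, ← hsum fun c => Λ (g ⁻¹' {c} ∩ B) * (1 - expNeg c)]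
  congr 1
  have : ∀ x, 1 - expNeg (g x) = (g.map fun c => 1 - expNeg c) x := fun x => rfl
  simp_rw [this]
  rw [SimpleFunc.lintegral_eq_lintegral, SimpleFunc.map_lintegral]
  refine Finset.sum_congr rfl fun c _ => ?_
  rw [Measure.restrict_apply (g.measurableSet_fiber c), mul_comm]

/-- The probability generating functional of a Poisson point process. -/
theorem lintegral_expNeg_tsum [IsFiniteMeasure μ] [IsFiniteMeasureOnCompacts Λ]
    (hX : IsPoissonProcess X Λ μ) {g : Plane → ℝ≥0∞} (hg : Measurable g) :
    ∫⁻ ω, expNeg (∑' j, g (X j ω)) ∂μ = expNeg (∫⁻ x, (1 - expNeg (g x)) ∂Λ) := by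
  -- Cutting the n-th simple approximation to the ball of radius n keeps the intensity finite, while
  -- the functions still increase to g.
  let B : ℕ → Set Plane := fun n => Metric.closedBall 0 n
  let f : ℕ → Plane → ℝ≥0∞ := fun n => (B n).indicator (SimpleFunc.eapprox g n)
  have hB : ∀ n, MeasurableSet (B n) := fun n => measurableSet_closedBall
  have hBmono : Monotone B := fun a b h => Metric.closedBall_subset_closedBall (by exact_mod_cast h)
  have hfm : ∀ n, Measurable (f n) := fun n => (SimpleFunc.measurable _).indicator (hB n)
  have hmono : Monotone f := by
    intro a b h x
    refine (Set.indicator_le_indicator_of_subset (hBmono h) (fun _ => zero_le) x).trans ?_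
    exact Set.indicator_le_indicator (SimpleFunc.monotone_eapprox g h x)
  have hsup : ∀ x, ⨆ n, f n x = g x := fun x => by
    refine le_antisymm (iSup_le fun n => ?_) ?_
    · refine (Set.indicator_le_self _ _ x).trans ?_
      rw [← SimpleFunc.iSup_eapprox_apply hg x]
      exact le_iSup (fun n => SimpleFunc.eapprox g n x) n
    · rw [← SimpleFunc.iSup_eapprox_apply hg x]
      refine iSup_le fun n => ?_
      obtain ⟨k, hk⟩ := exists_nat_ge ‖x‖
      have hx : x ∈ B (max n k) := by
        simp only [B, mem_closedBall_zero_iff]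
        exact hk.trans (by exact_mod_cast le_max_right n k)
      refine le_trans ?_ (le_iSup _ (max n k))
      simp only [f, Set.indicator_of_mem hx]
      exact SimpleFunc.monotone_eapprox g (le_max_left n k) x
  have htend : ∀ x, Filter.Tendsto (fun n => f n x) Filter.atTop (𝓝 (g x)) := fun x => by
    rw [← hsup x]
    exact tendsto_atTop_iSup fun a b h => hmono h x
  have hn : ∀ n, ∫⁻ ω, expNeg (∑' j, f n (X j ω)) ∂μ =
      expNeg (∫⁻ x, (1 - expNeg (f n x)) ∂Λ) := fun n => by
    rw [hX.lintegral_expNeg_tsum_indicator _ (hB n)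
      (isCompact_closedBall _ _).measure_lt_top.ne, ← lintegral_indicator (hB n)]
    congr 2
    funext x
    by_cases hx : x ∈ B n <;> simp [f, hx]
  have hL : Filter.Tendsto (fun n => ∫⁻ ω, expNeg (∑' j, f n (X j ω)) ∂μ) Filter.atTop
      (𝓝 (∫⁻ ω, expNeg (∑' j, g (X j ω)) ∂μ)) := by
    refine tendsto_lintegral_of_dominated_convergence (fun _ => 1)
      (fun n => measurable_expNeg.comp (hX.measurable_tsum (hfm n)))
      (fun n => Filter.Eventually.of_forall fun ω => expNeg_le_one _) (by simp) ?_
    refine Filter.Eventually.of_forall fun ω => (continuous_expNeg.tendsto _).comp ?_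
    have : ∑' j, g (X j ω) = ⨆ n, ∑' j, f n (X j ω) := by
      simp_rw [← hsup]
      rw [ENNReal.tsum_eq_iSup_sum]
      simp_rw [ENNReal.tsum_eq_iSup_sum]
      rw [iSup_comm]
      congr 1
      funext s
      exact ENNReal.finsetSum_iSup_of_monotone fun j a b h => hmono h _
    rw [this]
    exact tendsto_atTop_iSup fun a b h => ENNReal.tsum_le_tsum fun j => hmono h _
  have hR : Filter.Tendsto (fun n => expNeg (∫⁻ x, (1 - expNeg (f n x)) ∂Λ)) Filter.atTop
      (𝓝 (expNeg (∫⁻ x, (1 - expNeg (g x)) ∂Λ))) := by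
    -- The integrands 1 - exp (-f n) increase with n, so monotone convergence applies even if the
    -- limiting integral is infinite.
    refine (continuous_expNeg.tendsto _).comp ?_
    refine lintegral_tendsto_of_tendsto_of_monotone
      (fun n => (measurable_const.sub (measurable_expNeg.comp (hfm n))).aemeasurable)
      (Filter.Eventually.of_forall fun x a b h =>
        tsub_le_tsub_left (expNeg_antitone (hmono h x)) _)
      (Filter.Eventually.of_forall fun x => ?_)
    exact ENNReal.Tendsto.sub tendsto_const_nhds
      ((continuous_expNeg.tendsto _).comp (htend x)) (Or.inl ENNReal.one_ne_top)
  exact tendsto_nhds_unique hL (by simpa only [hn] using hR)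

end IsPoissonProcess

end

-- Polar integration and measures with a hazard rate

open Set in
-- The unit circle has measure 2π, twice the area of the unit disc, in the polar decomposition of
-- Lebesgue measure.
lemma lintegral_comp_norm_plane {f : ℝ → ℝ≥0∞} (hf : Measurable f) :
    ∫⁻ x : Plane, f ‖x‖ = ∫⁻ u in Ioi (0 : ℝ), ENNReal.ofReal (2 * Real.pi * u) * f u := by
  have hd : Module.finrank ℝ Plane = 2 := by simp
  have hmp := (volume : Measure Plane).measurePreserving_homeomorphUnitSphereProd
  have hg : Measurable fun y : Ioi (0 : ℝ) => f y := hf.comp measurable_subtype_coe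
  calc ∫⁻ x : Plane, f ‖x‖
      = ∫⁻ x : ({(0)}ᶜ : Set Plane), f ‖x.1‖ ∂((volume : Measure Plane).comap (↑)) := by
        rw [lintegral_subtype_comap (measurableSet_singleton _).compl fun x : Plane => f ‖x‖,
          restrict_compl_singleton]
    _ = ∫⁻ x, f x.2 ∂(volume : Measure Plane).toSphere.prod (.volumeIoiPow (2 - 1)) := by
        rw [hd] at hmp
        simpa using hmp.lintegral_comp_emb (Homeomorph.measurableEmbedding _)
          (fun x => f x.2)
    _ = (volume : Measure Plane).toSphere univ *
          ∫⁻ y : Ioi (0 : ℝ), f y ∂.volumeIoiPow (2 - 1) := by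
        rw [lintegral_prod _ (by exact (hg.comp measurable_snd).aemeasurable)]
        simp [mul_comm]
    _ = _ := by
        rw [Measure.volumeIoiPow, lintegral_withDensity_eq_lintegral_mul _ (by fun_prop) hg,
          Measure.toSphere_apply_univ, hd]
        have h2 := lintegral_subtype_comap (μ := volume) (measurableSet_Ioi (a := (0 : ℝ)))
          (fun y : ℝ => ENNReal.ofReal (y ^ (2 - 1)) * f y)
        simp only [Pi.mul_apply]
        rw [h2, ← lintegral_const_mul _ (by fun_prop)]
        refine setLIntegral_congr_fun measurableSet_Ioi fun u hu => ?_
        simp only [EuclideanSpace.volume_ball_fin_two]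
        rw [← mul_assoc]
        congr 1
        rw [ENNReal.ofReal_mul (by positivity), ENNReal.ofReal_mul (by norm_num)]
        simp

open Set in
/-- A finite measure on the half-line with tails `c exp (-∫₀ᵗ w)` has hazard rate `w`. -/
lemma eq_withDensity_of_hazard {m : Measure ℝ} [IsFiniteMeasure m] {w : ℝ → ℝ} {c : ℝ}
    (hc : 0 ≤ c) (hw0 : ∀ u, 0 < u → 0 ≤ w u) (hwc : ContinuousOn w (Ioi 0))
    (hwi : ∀ b, 0 ≤ b → IntervalIntegrable w volume 0 b)
    (hm : ∀ t, m (Ioi t) = ENNReal.ofReal (c * Real.exp (-∫ u in (0 : ℝ)..max t 0, w u))) :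
    m = (volume.restrict (Ioi 0)).withDensity
      (fun t => ENNReal.ofReal (w t * (c * Real.exp (-∫ u in (0 : ℝ)..t, w u)))) := by
  set Φ : ℝ → ℝ := fun t => c * Real.exp (-∫ u in (0 : ℝ)..t, w u) with hΦ
  refine Measure.ext_of_Ioc _ _ fun a b hab => ?_
  have h1 : m (Ioc a b) = m (Ioi a) - m (Ioi b) := by
    rw [← measure_sdiff (Ioi_subset_Ioi hab.le) measurableSet_Ioi.nullMeasurableSet
      (measure_ne_top _ _)]
    congr 1
    ext x
    simp
  have hinter : Ioc a b ∩ Ioi 0 = Ioc (max a 0) (max b 0) := by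
    ext x
    simp only [mem_inter_iff, mem_Ioc, mem_Ioi, max_lt_iff, le_max_iff]
    constructor
    · rintro ⟨⟨h1, h2⟩, h3⟩
      exact ⟨⟨h1, h3⟩, Or.inl h2⟩
    · rintro ⟨⟨h1, h3⟩, h2 | h2⟩
      · exact ⟨⟨h1, h2⟩, h3⟩
      · linarith
  rw [h1, hm, hm, withDensity_apply _ measurableSet_Ioc, Measure.restrict_restrict measurableSet_Ioc,
    hinter]
  -- Only the positive parts of the endpoints matter: the tails are constant on t ≤ 0, so no mass
  -- sits there.
  have ha0 : 0 ≤ max a 0 := le_max_right _ _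
  have hb0 : 0 ≤ max b 0 := le_max_right _ _
  have hle : max a 0 ≤ max b 0 := max_le_max hab.le le_rfl
  generalize max a 0 = a' at *
  generalize max b 0 = b' at *
  have hcont : ContinuousOn (fun t => ∫ u in (0 : ℝ)..t, w u) (Icc a' b') := by
    have := intervalIntegral.continuousOn_primitive_interval' (hwi b' hb0)
      (left_mem_uIcc (a := (0 : ℝ)) (b := b'))
    rw [uIcc_of_le hb0] at this
    exact this.mono (Icc_subset_Icc_left ha0)
  have hΦc : ContinuousOn Φ (Icc a' b') :=
    continuousOn_const.mul (Real.continuous_exp.comp_continuousOn hcont.neg)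
  have hwab : IntervalIntegrable w volume a' b' :=
    (hwi b' hb0).mono_set (by rw [uIcc_of_le hle, uIcc_of_le hb0]; exact Icc_subset_Icc_left ha0)
  have hint : IntervalIntegrable (fun t => w t * Φ t) volume a' b' :=
    hwab.mul_continuousOn (by rwa [uIcc_of_le hle])
  -- Here Φ' = -wΦ. The derivative is needed only inside the interval, since w need not be
  -- continuous at 0.
  have hFTC : ∫ t in a'..b', w t * Φ t = Φ a' - Φ b' := by
    have := intervalIntegral.integral_eq_sub_of_hasDerivAt_of_le (f := fun t => -Φ t)
      (f' := fun t => w t * Φ t) hle hΦc.neg (fun t ht => ?_) hint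
    · rw [this]
      ring
    · have ht0 : 0 < t := ha0.trans_lt ht.1
      have hd : HasDerivAt (fun t => ∫ u in (0 : ℝ)..t, w u) (w t) t :=
        intervalIntegral.integral_hasDerivAt_right (hwi t ht0.le)
          (hwc.stronglyMeasurableAtFilter isOpen_Ioi t ht0) (hwc.continuousAt (Ioi_mem_nhds ht0))
      have := ((hd.neg.exp).const_mul c).neg
      refine this.congr_deriv ?_
      simp only [hΦ, Pi.neg_apply]
      ring
  rw [← ENNReal.ofReal_sub _ (by positivity), ← hFTC, intervalIntegral.integral_of_le hle,
    ofReal_integral_eq_lintegral_ofReal ((intervalIntegrable_iff_integrableOn_Ioc_of_le hle).1 hint)]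
  refine (ae_restrict_iff' measurableSet_Ioc).2 (Filter.Eventually.of_forall fun t ht => ?_)
  exact mul_nonneg (hw0 t (ha0.trans_lt ht.1)) (by positivity)

-- The nearest station: measurability and existence

section Serving

variable {Ω : Type*} {N : Network Ω}

namespace Network

/-- The infimum of the empty set of indices is 0, so an index without any nearest station lies below
every n; this is the second alternative. -/
lemma serving_le_iff (ω : Ω) (n : ℕ) :
    N.serving ω ≤ n ↔ (∃ j ≤ n, ∀ k, ‖N.bs j ω‖ ≤ ‖N.bs k ω‖) ∨
      ∀ j, ¬ ∀ k, ‖N.bs j ω‖ ≤ ‖N.bs k ω‖ := by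
  constructor
  · intro h
    by_cases hne : {j : ℕ | ∀ k, ‖N.bs j ω‖ ≤ ‖N.bs k ω‖}.Nonempty
    · exact Or.inl ⟨_, h, Nat.sInf_mem hne⟩
    · exact Or.inr fun j hj => hne ⟨j, hj⟩
  · rintro (⟨j, hj, h⟩ | h)
    · exact (Nat.sInf_le (Set.mem_ofPred.2 h)).trans hj
    · have : {j : ℕ | ∀ k, ‖N.bs j ω‖ ≤ ‖N.bs k ω‖} = ∅ :=
        Set.eq_empty_iff_forall_notMem.2 h
      rw [serving, this, Nat.sInf_empty]
      exact Nat.zero_le n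

variable [MeasurableSpace Ω]

lemma measurable_serving (hbs : ∀ j, Measurable (N.bs j)) : Measurable N.serving := by
  have hP : ∀ j, MeasurableSet {ω | ∀ k, ‖N.bs j ω‖ ≤ ‖N.bs k ω‖} := fun j => by
    rw [Set.ofPred_forall]
    exact MeasurableSet.iInter fun k => measurableSet_le (hbs j).norm (hbs k).norm
  refine measurable_of_Iic fun n => ?_
  have : N.serving ⁻¹' Set.Iic n =
      (⋃ j ∈ Set.Iic n, {ω | ∀ k, ‖N.bs j ω‖ ≤ ‖N.bs k ω‖}) ∪
        ⋂ j, {ω | ∀ k, ‖N.bs j ω‖ ≤ ‖N.bs k ω‖}ᶜ := by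
    ext ω
    simp only [Set.mem_preimage, Set.mem_Iic, serving_le_iff, Set.mem_union, Set.mem_iUnion,
      Set.mem_iInter, Set.mem_compl_iff, Set.mem_ofPred_eq, exists_prop]
  rw [this]
  exact (MeasurableSet.biUnion (Set.to_countable _) fun j _ => hP j).union
    (MeasurableSet.iInter fun j => (hP j).compl)

/-- The random index takes countably many values, so joint measurability in the index and ω is
automatic. -/
lemma measurable_comp_serving {β : Type*} [MeasurableSpace β] {f : ℕ → Ω → β}
    (hbs : ∀ j, Measurable (N.bs j)) (hf : ∀ j, Measurable (f j)) :
    Measurable fun ω => f (N.serving ω) ω := by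
  have h : Measurable fun q : ℕ × Ω => f q.1 q.2 := measurable_from_prod_countable_right hf
  exact h.comp ((measurable_serving hbs).prodMk measurable_id)

lemma measurable_servingDist (hbs : ∀ j, Measurable (N.bs j)) : Measurable N.servingDist :=
  measurable_comp_serving hbs fun j => (hbs j).norm

end Network

variable [MeasurableSpace Ω] {μ : Measure Ω}

lemma IsPoissonProcess.ae_finite {X : ℕ → Ω → Plane} {Λ : Measure Plane}
    (hX : IsPoissonProcess X Λ μ) {A : Set Plane} (hA : MeasurableSet A) (hΛ : Λ A ≠ ⊤) :
    ∀ᵐ ω ∂μ, {j | X j ω ∈ A}.Finite := by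
  have h := hX.count_law A hA hΛ
  have h0 : μ {ω | pointCount X A ω = ⊤} = 0 := by
    rw [h.measure_eq (p := fun n => n = ⊤) (measurableSet_singleton _),
      Measure.map_apply (measurable_of_countable _) (MeasurableSet.of_discrete)]
    convert measure_empty (μ := poissonMeasure (Λ A).toNNReal)
    ext n
    simp
  have h1 : ∀ᵐ ω ∂μ, pointCount X A ω ≠ ⊤ := by
    rw [ae_iff]
    simpa using h0
  filter_upwards [h1] with ω hω
  exact Set.encard_ne_top_iff.1 hω

/-- The minimum is attained: almost surely every ball holds finitely many points, and only a ball
containing `N.bs 0 ω` has to be searched. -/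
lemma ae_norm_serving_le {Λ : Measure Plane} [IsFiniteMeasureOnCompacts Λ]
    (hX : IsPoissonProcess N.bs Λ μ) :
    ∀ᵐ ω ∂μ, ∀ k, N.servingDist ω ≤ ‖N.bs k ω‖ := by
  have h : ∀ᵐ ω ∂μ, ∀ n : ℕ, {j | N.bs j ω ∈ Metric.closedBall (0 : Plane) n}.Finite :=
    ae_all_iff.2 fun n => hX.ae_finite measurableSet_closedBall
      (isCompact_closedBall _ _).measure_lt_top.ne
  filter_upwards [h] with ω hω
  obtain ⟨n, hn⟩ := exists_nat_ge ‖N.bs 0 ω‖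
  obtain ⟨j, hj, hmin⟩ := Set.exists_min_image _ (fun j => ‖N.bs j ω‖) (hω n)
    ⟨0, by simpa using hn⟩
  have hj' : ‖N.bs j ω‖ ≤ n := by simpa using hj
  have hne : {j : ℕ | ∀ k, ‖N.bs j ω‖ ≤ ‖N.bs k ω‖}.Nonempty := by
    refine ⟨j, fun k => ?_⟩
    by_cases hk : ‖N.bs k ω‖ ≤ n
    · exact hmin k (by simpa using hk)
    · linarith
  exact Nat.sInf_mem hne

end Serving

-- Tails of the nearest distance under a multiplicative weight

section Tails

open Set

/-- Intensity measure of the cost `-log φ(|x|)` on `|x| > t`, together with the whole disc of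
radius `t`. -/
noncomputable def voidExponent (lam : ℝ) (φ : ℝ → ℝ) (t : ℝ) : ℝ≥0∞ :=
  ∫⁻ u in Ioi (0 : ℝ), ENNReal.ofReal (2 * Real.pi * lam * u) *
    (if u ≤ t then 1 else 1 - ENNReal.ofReal (φ u))

lemma voidExponent_mono (lam : ℝ) (φ : ℝ → ℝ) : Monotone (voidExponent lam φ) := by
  intro s t h
  refine lintegral_mono fun u => ?_
  gcongr
  split_ifs with h1 h2 h2
  · exact le_rfl
  · exact absurd (h1.trans h) h2
  · exact tsub_le_self
  · exact le_rfl

/-- Separates the empty disc, of intensity πλt², from the cost of the points beyond t. -/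
lemma voidExponent_eq_add {lam : ℝ} (hlam : 0 < lam) (φ : ℝ → ℝ) {t : ℝ} (ht : 0 < t) :
    voidExponent lam φ t = ENNReal.ofReal (Real.pi * lam * t ^ 2) +
      ∫⁻ u in Ioi t, ENNReal.ofReal (2 * Real.pi * lam * u) * (1 - ENNReal.ofReal (φ u)) := by
  rw [voidExponent, ← Ioc_union_Ioi_eq_Ioi ht.le, lintegral_union measurableSet_Ioi
    (Set.disjoint_left.2 fun x hx hx' => not_lt_of_ge hx.2 hx')]
  congr 1
  · have h1 : ∫⁻ u in Ioc 0 t, ENNReal.ofReal (2 * Real.pi * lam * u) *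
        (if u ≤ t then 1 else 1 - ENNReal.ofReal (φ u)) =
        ∫⁻ u in Ioc 0 t, ENNReal.ofReal (2 * Real.pi * lam * u) :=
      setLIntegral_congr_fun measurableSet_Ioc fun u hu => by simp [hu.2]
    rw [h1, ← ofReal_integral_eq_lintegral_ofReal
      ((by fun_prop : Continuous fun u : ℝ => 2 * Real.pi * lam * u).integrableOn_Ioc),
      ← intervalIntegral.integral_of_le ht.le, intervalIntegral.integral_const_mul, integral_id]
    · congr 1
      ring
    · refine (ae_restrict_iff' measurableSet_Ioc).2 (Filter.Eventually.of_forall fun u hu => ?_)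
      have := hu.1
      simp only [Pi.zero_apply]
      positivity
  · exact setLIntegral_congr_fun measurableSet_Ioi fun u hu => by
      simp [not_le.2 (show t < u from hu)]

/-- The bracket equals (1 - φ) + φ·1_{u ≤ t}. The first term gives a constant, the second a survival
function with hazard rate 2πλuφ(u). -/
lemma expNeg_voidExponent {lam : ℝ} (hlam : 0 < lam) {φ : ℝ → ℝ} (hφm : Measurable φ)
    (hφ0 : ∀ u, 0 < u → 0 ≤ φ u) (hφ1 : ∀ u, 0 < u → φ u ≤ 1)
    (hφi : IntegrableOn (fun u => u * (1 - φ u)) (Ioi 0)) (t : ℝ) :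
    expNeg (voidExponent lam φ t) =
      ENNReal.ofReal (Real.exp (-∫ u in Ioi (0 : ℝ), 2 * Real.pi * lam * (u * (1 - φ u))) *
        Real.exp (-∫ u in (0 : ℝ)..max t 0, 2 * Real.pi * lam * (u * φ u))) := by
  have hpos : 0 < 2 * Real.pi * lam := by positivity
  have hI : IntegrableOn (fun u => u * φ u) (Ioc 0 (max t 0)) := by
    refine Integrable.mono' (g := fun u : ℝ => u) (continuous_id.integrableOn_Ioc)
      (measurable_id.mul hφm).aestronglyMeasurable ?_
    refine (ae_restrict_iff' measurableSet_Ioc).2 (Filter.Eventually.of_forall fun u hu => ?_)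
    rw [Real.norm_of_nonneg (mul_nonneg hu.1.le (hφ0 u hu.1))]
    exact mul_le_of_le_one_right hu.1.le (hφ1 u hu.1)
  have hsplit : voidExponent lam φ t =
      (∫⁻ u in Ioi (0 : ℝ), ENNReal.ofReal (2 * Real.pi * lam * (u * (1 - φ u)))) +
      ∫⁻ u in Ioc 0 (max t 0), ENNReal.ofReal (2 * Real.pi * lam * (u * φ u)) := by
    have hsub : Ioc 0 (max t 0) = Iic t ∩ Ioi 0 := by
      ext u
      simp only [mem_Ioc, le_max_iff, mem_inter_iff, mem_Iic, mem_Ioi]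
      constructor
      · rintro ⟨h1, h2 | h2⟩
        · exact ⟨h2, h1⟩
        · linarith
      · rintro ⟨h1, h2⟩
        exact ⟨h2, Or.inl h1⟩
    rw [hsub, ← Measure.restrict_restrict measurableSet_Iic, ← lintegral_indicator measurableSet_Iic,
      ← lintegral_add_left (by fun_prop), voidExponent]
    refine setLIntegral_congr_fun measurableSet_Ioi fun u hu => ?_
    have hu : 0 < u := hu
    have h0 := hφ0 u hu
    have h1 := hφ1 u hu
    have e : 1 - ENNReal.ofReal (φ u) = ENNReal.ofReal (1 - φ u) := by
      rw [ENNReal.ofReal_sub _ h0, ENNReal.ofReal_one]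
    by_cases hut : u ≤ t
    · simp only [hut, if_true, indicator_of_mem (mem_Iic.2 hut), mul_one]
      rw [← ENNReal.ofReal_add (mul_nonneg hpos.le (mul_nonneg hu.le (by linarith)))
        (by positivity)]
      congr 1
      ring
    · simp only [hut, if_false, indicator_of_notMem (mt mem_Iic.1 hut), add_zero]
      rw [e, ← ENNReal.ofReal_mul (by positivity), mul_assoc (2 * Real.pi * lam)]
  have hn1 : 0 ≤ᵐ[volume.restrict (Ioi 0)] fun u => 2 * Real.pi * lam * (u * (1 - φ u)) := by
    refine (ae_restrict_iff' measurableSet_Ioi).2 (Filter.Eventually.of_forall fun u hu => ?_)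
    exact mul_nonneg hpos.le (mul_nonneg (le_of_lt hu) (by linarith [hφ1 u hu]))
  have hn2 : 0 ≤ᵐ[volume.restrict (Ioc 0 (max t 0))] fun u => 2 * Real.pi * lam * (u * φ u) := by
    refine (ae_restrict_iff' measurableSet_Ioc).2 (Filter.Eventually.of_forall fun u hu => ?_)
    exact mul_nonneg hpos.le (mul_nonneg hu.1.le (hφ0 u hu.1))
  rw [hsplit, expNeg_add, ← ofReal_integral_eq_lintegral_ofReal (hφi.const_mul _) hn1,
    ← ofReal_integral_eq_lintegral_ofReal (hI.const_mul _) hn2,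
    expNeg_ofReal (integral_nonneg_of_ae hn1), expNeg_ofReal (integral_nonneg_of_ae hn2),
    ← ENNReal.ofReal_mul (Real.exp_nonneg _), intervalIntegral.integral_of_le (le_max_right _ _)]

end Tails

-- Joint law of the nearest distance and the remaining points

section NearestPoint

open Set

variable {Ω : Type*} {N : Network Ω} [MeasurableSpace Ω] {μ : Measure Ω} [IsFiniteMeasure μ]
  {lam : ℝ}

lemma setLIntegral_servingDist_gt (hlam : 0 < lam)
    (hX : IsPoissonProcess N.bs (ENNReal.ofReal lam • volume) μ) {φ : ℝ → ℝ} (hφm : Measurable φ)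
    (hφ1 : ∀ u, 0 ≤ u → φ u ≤ 1) (t : ℝ) :
    ∫⁻ ω in {ω | t < N.servingDist ω}, expNeg (∑' j, negLog (ENNReal.ofReal (φ ‖N.bs j ω‖))) ∂μ =
      expNeg (voidExponent lam φ t) := by
  have hfin : IsFiniteMeasureOnCompacts (ENNReal.ofReal lam • (volume : Measure Plane)) :=
    IsFiniteMeasureOnCompacts.smul _ ENNReal.ofReal_ne_top
  have hms : MeasurableSet {ω | t < N.servingDist ω} :=
    measurableSet_lt measurable_const (N.measurable_servingDist hX.measurable)
  -- An infinite cost on the disc of radius t annihilates every configuration with a point there,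
  -- and so encodes the event that the nearest point is beyond t.
  let g : ℝ → ℝ≥0∞ := fun u => if u ≤ t then ⊤ else negLog (ENNReal.ofReal (φ u))
  have hg : Measurable g := Measurable.ite measurableSet_Iic measurable_const (by fun_prop)
  rw [← lintegral_indicator hms]
  calc _ = ∫⁻ ω, expNeg (∑' j, g ‖N.bs j ω‖) ∂μ := by
        refine lintegral_congr_ae ?_
        filter_upwards [ae_norm_serving_le hX] with ω hω
        by_cases h : t < N.servingDist ω
        · rw [indicator_of_mem (by exact h)]
          congr 2
          funext j
          simp [g, not_le.2 (h.trans_le (hω j))]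
        · rw [indicator_of_notMem (by exact h)]
          have : ∑' j, g ‖N.bs j ω‖ = ⊤ :=
            ENNReal.tsum_eq_top_of_eq_top ⟨N.serving ω, if_pos (not_lt.1 h)⟩
          rw [this, expNeg_top]
    _ = _ := by
        rw [hX.lintegral_expNeg_tsum (g := fun x => g ‖x‖) (hg.comp measurable_norm),
          lintegral_smul_measure,
          lintegral_comp_norm_plane (f := fun u => 1 - expNeg (g u)) (by fun_prop), voidExponent,
          smul_eq_mul, ← lintegral_const_mul _ (by fun_prop)]
        congr 1
        refine setLIntegral_congr_fun measurableSet_Ioi fun u hu => ?_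
        have hu : 0 < u := hu
        rw [← mul_assoc, ← ENNReal.ofReal_mul hlam.le]
        congr 1
        · congr 1
          ring
        · by_cases h : u ≤ t
          · simp [g, h]
          · simp only [g, h, if_false]
            rw [expNeg_negLog]
            simpa using hφ1 u hu.le

/-- Joint law of the distance to the nearest point of a planar Poisson process and of a
multiplicative functional of the other points. -/
theorem lintegral_servingDist_mul_expNeg (hlam : 0 < lam)
    (hX : IsPoissonProcess N.bs (ENNReal.ofReal lam • volume) μ) {φ : ℝ → ℝ} (hφm : Measurable φ)
    (hφ0 : ∀ u, 0 ≤ u → 0 < φ u) (hφ1 : ∀ u, 0 ≤ u → φ u ≤ 1) (hφc : ContinuousOn φ (Ioi 0))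
    (hφi : IntegrableOn (fun u => u * (1 - φ u)) (Ioi 0))
    {H : ℝ → ℝ≥0∞} (hH : Measurable H) :
    ∫⁻ ω, H (N.servingDist ω) * expNeg (∑' j, if j = N.serving ω then 0 else
        negLog (ENNReal.ofReal (φ ‖N.bs j ω‖))) ∂μ =
      ∫⁻ r in Ioi (0 : ℝ), H r * (ENNReal.ofReal
        (2 * Real.pi * lam * r * Real.exp (-(Real.pi * lam * r ^ 2))) *
        expNeg (∫⁻ u in Ioi r, ENNReal.ofReal (2 * Real.pi * lam * u) *
          (1 - ENNReal.ofReal (φ u)))) := by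
  have hpos : 0 < 2 * Real.pi * lam := by positivity
  have hmD := N.measurable_servingDist hX.measurable
  let G : ℝ → ℝ≥0∞ := fun u => negLog (ENNReal.ofReal (φ u))
  have hGm : Measurable G := by fun_prop
  have hG : ∀ u, 0 ≤ u → expNeg (G u) = ENNReal.ofReal (φ u) := fun u hu =>
    expNeg_negLog (by simpa using hφ1 u hu)
  have hS : Measurable fun ω => expNeg (∑' j, G ‖N.bs j ω‖) :=
    measurable_expNeg.comp (hX.measurable_tsum (hGm.comp measurable_norm))
  -- The law of the nearest distance when each configuration is weighted by the product of φ over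
  -- all its points.
  let m : Measure ℝ := (μ.withDensity fun ω => expNeg (∑' j, G ‖N.bs j ω‖)).map N.servingDist
  have : IsFiniteMeasure (μ.withDensity fun ω => expNeg (∑' j, G ‖N.bs j ω‖)) :=
    isFiniteMeasure_withDensity (ne_top_of_le_ne_top (measure_ne_top μ univ) (by
      rw [← lintegral_one]
      exact lintegral_mono fun ω => expNeg_le_one _))
  have hm : m = _ := eq_withDensity_of_hazard (m := m)
    (w := fun u => 2 * Real.pi * lam * (u * φ u))
    (c := Real.exp (-∫ u in Ioi (0 : ℝ), 2 * Real.pi * lam * (u * (1 - φ u))))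
    (Real.exp_nonneg _)
    (fun u hu => mul_nonneg hpos.le (mul_nonneg hu.le (hφ0 u hu.le).le))
    (continuousOn_const.mul (continuousOn_id.mul hφc))
    (fun b hb => by
      rw [intervalIntegrable_iff_integrableOn_Ioc_of_le hb]
      refine Integrable.const_mul ?_ _
      refine Integrable.mono' (g := fun u : ℝ => u) (continuous_id.integrableOn_Ioc)
        (measurable_id.mul hφm).aestronglyMeasurable ?_
      refine (ae_restrict_iff' measurableSet_Ioc).2 (Filter.Eventually.of_forall fun u hu => ?_)
      rw [Real.norm_of_nonneg (mul_nonneg hu.1.le (hφ0 u hu.1.le).le)]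
      exact mul_le_of_le_one_right hu.1.le (hφ1 u hu.1.le))
    (fun t => by
      rw [Measure.map_apply hmD measurableSet_Ioi,
        withDensity_apply _ (hmD measurableSet_Ioi),
        ← expNeg_voidExponent hlam hφm (fun u hu => (hφ0 u hu.le).le) (fun u hu => hφ1 u hu.le) hφi]
      exact setLIntegral_servingDist_gt hlam hX hφm hφ1 t)
  -- The factor of the nearest point is restored to the product and compensated by 1/φ; this is
  -- where φ > 0 is needed.
  calc _ = ∫⁻ ω, expNeg (∑' j, G ‖N.bs j ω‖) *
        (H (N.servingDist ω) * (ENNReal.ofReal (φ (N.servingDist ω)))⁻¹) ∂μ := by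
        refine lintegral_congr fun ω => ?_
        have hsum : ∑' j, G ‖N.bs j ω‖ = G (N.servingDist ω) +
            ∑' j, if j = N.serving ω then 0 else G ‖N.bs j ω‖ := by
          rw [ENNReal.tsum_eq_add_tsum_ite (f := fun j => G ‖N.bs j ω‖) (N.serving ω)]
          congr! 3 with j
          split_ifs <;> rfl
        have hp : 0 < φ (N.servingDist ω) := hφ0 _ (norm_nonneg _)
        rw [hsum, expNeg_add, hG _ (show 0 ≤ N.servingDist ω from norm_nonneg _)]
        rw [mul_comm (ENNReal.ofReal _) (expNeg _), mul_assoc, mul_left_comm (ENNReal.ofReal _),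
          ENNReal.mul_inv_cancel (by simpa using hp) ENNReal.ofReal_ne_top, mul_one, mul_comm]
    _ = ∫⁻ r, H r * (ENNReal.ofReal (φ r))⁻¹ ∂m := by
        rw [lintegral_map (by fun_prop) hmD]
        exact (lintegral_withDensity_eq_lintegral_mul _ hS
          (g := fun ω => H (N.servingDist ω) * (ENNReal.ofReal (φ (N.servingDist ω)))⁻¹)
          (by fun_prop)).symm
    _ = _ := by
        rw [hm, lintegral_withDensity_eq_lintegral_mul_non_measurable₀]
        -- The density of m is the hazard rate 2πλrφ(r) times the weighted tail; its φ(r) cancels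
        -- the compensating inverse.
        · refine setLIntegral_congr_fun measurableSet_Ioi fun r hr => ?_
          have hr : 0 < r := hr
          have hp : 0 < φ r := hφ0 r hr.le
          have he := expNeg_voidExponent hlam hφm (fun u hu => (hφ0 u hu.le).le)
            (fun u hu => hφ1 u hu.le) hφi r
          rw [max_eq_left hr.le] at he
          have hw : 0 ≤ 2 * Real.pi * lam * (r * φ r) := by positivity
          simp only [Pi.mul_apply]
          rw [ENNReal.ofReal_mul hw, ← he, voidExponent_eq_add hlam φ hr, expNeg_add,
            expNeg_ofReal (by positivity), ← mul_assoc (2 * Real.pi * lam) r,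
            ENNReal.ofReal_mul (p := 2 * Real.pi * lam * r) (by positivity),
            ENNReal.ofReal_mul (p := 2 * Real.pi * lam * r) (by positivity)]
          generalize expNeg _ = E
          rw [show ∀ a b c d e f : ℝ≥0∞, a * b * (c * d) * (e * f) = (b * f) * (e * (a * c * d)) from
            fun a b c d e f => by ring,
            ENNReal.mul_inv_cancel (by simpa using hp) ENNReal.ofReal_ne_top, one_mul]
        -- On the half-line the density agrees with an expression in `voidExponent`, which is
        -- measurable because it is monotone in t.
        · have hv : Measurable (voidExponent lam φ) := (voidExponent_mono lam φ).measurable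
          have hv' : Measurable fun t => ENNReal.ofReal (2 * Real.pi * lam * (t * φ t)) *
            expNeg (voidExponent lam φ t) := by fun_prop
          refine hv'.aemeasurable.congr ((ae_restrict_iff' measurableSet_Ioi).2
            (Filter.Eventually.of_forall fun t ht => ?_))
          have ht : 0 < t := ht
          have hp : 0 < φ t := hφ0 t ht.le
          dsimp only
          rw [expNeg_voidExponent hlam hφm (fun u hu => (hφ0 u hu.le).le)
            (fun u hu => hφ1 u hu.le) hφi, max_eq_left ht.le,
            ENNReal.ofReal_mul (p := 2 * Real.pi * lam * (t * φ t)) (by positivity)]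
        · exact Filter.Eventually.of_forall fun _ => ENNReal.ofReal_lt_top

end NearestPoint

-- Exponential gains over distance, with a multiplier that depends on the nearest distance

open Set Filter

/-- Laplace transform `1 / (1 + K u^{-η})` of an exponential gain attenuated over the
distance `u`. -/
noncomputable def bsLaplace (eta K u : ℝ) : ℝ := 1 / (1 + K * u ^ (-eta))

section bsLaplace

variable {eta K : ℝ}

@[fun_prop] lemma measurable_bsLaplace (eta K : ℝ) : Measurable (bsLaplace eta K) := by
  unfold bsLaplace
  fun_prop

lemma measurable_uncurry_bsLaplace (eta : ℝ) :
    Measurable fun q : ℝ × ℝ => bsLaplace eta q.1 q.2 := by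
  unfold bsLaplace
  fun_prop

lemma bsLaplace_pos (hK : 0 ≤ K) {u : ℝ} (hu : 0 ≤ u) : 0 < bsLaplace eta K u := by
  have := Real.rpow_nonneg hu (-eta)
  unfold bsLaplace
  positivity

lemma bsLaplace_le_one (hK : 0 ≤ K) {u : ℝ} (hu : 0 ≤ u) : bsLaplace eta K u ≤ 1 := by
  have := mul_nonneg hK (Real.rpow_nonneg hu (-eta))
  exact div_le_one_of_le₀ (by linarith) (by linarith)

lemma bsLaplace_anti {K' : ℝ} (hK : 0 ≤ K) (h : K ≤ K') {u : ℝ} (hu : 0 ≤ u) :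
    bsLaplace eta K' u ≤ bsLaplace eta K u := by
  have := Real.rpow_nonneg hu (-eta)
  unfold bsLaplace
  gcongr

lemma continuousOn_bsLaplace (hK : 0 ≤ K) : ContinuousOn (bsLaplace eta K) (Ioi 0) := by
  unfold bsLaplace
  refine continuousOn_const.div ?_ fun u hu => ?_
  · refine continuousOn_const.add (continuousOn_const.mul ?_)
    exact continuousOn_id.rpow_const fun u hu => Or.inl (ne_of_gt hu)
  · have := mul_nonneg hK (Real.rpow_nonneg (le_of_lt (mem_Ioi.1 hu)) (-eta))
    positivity

lemma one_sub_bsLaplace (hK : 0 ≤ K) {u : ℝ} (hu : 0 ≤ u) :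
    1 - bsLaplace eta K u = K * u ^ (-eta) / (1 + K * u ^ (-eta)) := by
  have := mul_nonneg hK (Real.rpow_nonneg hu (-eta))
  have h : 1 + K * u ^ (-eta) ≠ 0 := by positivity
  unfold bsLaplace
  field_simp
  ring

/-- The integrand is at most u near 0 and at most K u^(1-η) at infinity, which is integrable because
η > 2. -/
lemma integrableOn_mul_one_sub_bsLaplace (heta : 2 < eta) (hK : 0 ≤ K) :
    IntegrableOn (fun u => u * (1 - bsLaplace eta K u)) (Ioi 0) := by
  have hm : Measurable fun u => u * (1 - bsLaplace eta K u) := by fun_prop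
  rw [← Ioc_union_Ioi_eq_Ioi (zero_le_one' ℝ)]
  refine IntegrableOn.union ?_ ?_
  · refine Integrable.mono' (g := fun u : ℝ => u) (continuous_id.integrableOn_Ioc)
      hm.aestronglyMeasurable ?_
    refine (ae_restrict_iff' measurableSet_Ioc).2 (Eventually.of_forall fun u hu => ?_)
    have h0 := (bsLaplace_pos (eta := eta) hK hu.1.le).le
    have h1 := bsLaplace_le_one (eta := eta) hK hu.1.le
    rw [Real.norm_of_nonneg (mul_nonneg hu.1.le (by linarith))]
    exact mul_le_of_le_one_right hu.1.le (by linarith)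
  · refine Integrable.mono' (g := fun u : ℝ => K * u ^ (1 - eta))
      ((integrableOn_Ioi_rpow_of_lt (by linarith) one_pos).const_mul K) hm.aestronglyMeasurable ?_
    refine (ae_restrict_iff' measurableSet_Ioi).2 (Eventually.of_forall fun u hu => ?_)
    have hu0 : 0 < u := one_pos.trans hu
    have h1 := bsLaplace_le_one (eta := eta) hK hu0.le
    have hp := mul_nonneg hK (Real.rpow_nonneg hu0.le (-eta))
    rw [Real.norm_of_nonneg (mul_nonneg hu0.le (by linarith)), one_sub_bsLaplace hK hu0.le,
      sub_eq_add_neg, Real.rpow_add hu0, Real.rpow_one, mul_left_comm]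
    exact mul_le_mul_of_nonneg_left (div_le_self hp (by linarith)) hu0.le

lemma tendsto_bsLaplace {k : ℕ → ℝ} (hK : 0 ≤ K) (hk : Tendsto k atTop (𝓝 K)) {u : ℝ}
    (hu : 0 ≤ u) : Tendsto (fun n => bsLaplace eta (k n) u) atTop (𝓝 (bsLaplace eta K u)) := by
  have := mul_nonneg hK (Real.rpow_nonneg hu (-eta))
  exact tendsto_const_nhds.div (tendsto_const_nhds.add (hk.mul_const _)) (by positivity)

end bsLaplace

section dyadic

/-- The largest multiple of `2⁻ⁿ` which is at most `r`. -/
noncomputable def dyadicFloor (n : ℕ) (r : ℝ) : ℝ := (⌊r * 2 ^ n⌋₊ : ℝ) / 2 ^ n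

lemma dyadicFloor_nonneg (n : ℕ) (r : ℝ) : 0 ≤ dyadicFloor n r := by
  unfold dyadicFloor
  positivity

/-- Since 2⌊x⌋ ≤ ⌊2x⌋, refining the grid never lowers the approximation. Monotonicity in n later
gives monotone convergence of the costs. -/
lemma dyadicFloor_mono {r : ℝ} (hr : 0 ≤ r) : Monotone fun n => dyadicFloor n r := by
  refine monotone_nat_of_le_succ fun n => ?_
  unfold dyadicFloor
  rw [div_le_div_iff₀ (by positivity) (by positivity)]
  have h : 2 * ⌊r * 2 ^ n⌋₊ ≤ ⌊r * 2 ^ (n + 1)⌋₊ := by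
    refine Nat.le_floor ?_
    push_cast
    have := Nat.floor_le (show 0 ≤ r * 2 ^ n by positivity)
    rw [pow_succ]
    linarith
  have h' : (2 : ℝ) * ⌊r * 2 ^ n⌋₊ ≤ ⌊r * 2 ^ (n + 1)⌋₊ := by exact_mod_cast h
  have hp : (0 : ℝ) < 2 ^ n := by positivity
  calc (⌊r * 2 ^ n⌋₊ : ℝ) * 2 ^ (n + 1) = 2 * ⌊r * 2 ^ n⌋₊ * 2 ^ n := by ring
    _ ≤ _ := by gcongr

lemma tendsto_dyadicFloor {r : ℝ} (hr : 0 ≤ r) :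
    Tendsto (fun n => dyadicFloor n r) atTop (𝓝 r) :=
  (tendsto_nat_floor_mul_div_atTop hr).comp (tendsto_pow_atTop_atTop_of_one_lt one_lt_two)

end dyadic

lemma tendsto_tsum_of_monotone {f : ℕ → ℕ → ℝ≥0∞} {g : ℕ → ℝ≥0∞} (hf : ∀ j, Monotone fun n => f n j)
    (hg : ∀ j, Tendsto (fun n => f n j) atTop (𝓝 (g j))) :
    Tendsto (fun n => ∑' j, f n j) atTop (𝓝 (∑' j, g j)) := by
  simp_rw [← lintegral_count]
  exact lintegral_tendsto_of_tendsto_of_monotone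
    (fun n => (measurable_of_countable _).aemeasurable) (Eventually.of_forall hf)
    (Eventually.of_forall hg)

lemma negLog_antitone : Antitone negLog := fun x y h => by
  unfold negLog
  exact EReal.toENNReal_le_toENNReal (EReal.neg_le_neg_iff.2 (ENNReal.log_monotone h))

lemma continuous_negLog : Continuous negLog :=
  EReal.continuous_toENNReal.comp (continuous_neg.comp ENNReal.continuous_log)

section

variable {Ω : Type*} {N : Network Ω} [MeasurableSpace Ω] {μ : Measure Ω} [IsFiniteMeasure μ]
  {lam eta : ℝ}

lemma measurable_tsum_ite_serving (hbs : ∀ j, Measurable (N.bs j)) {f : ℕ → Ω → ℝ≥0∞}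
    (hf : ∀ j, Measurable (f j)) :
    Measurable fun ω => ∑' j, if j = N.serving ω then 0 else f j ω :=
  Measurable.tsum fun j => Measurable.ite
    (measurableSet_eq_fun measurable_const (N.measurable_serving hbs)) measurable_const (hf j)

/-- On each event where k has a given value the multiplier is constant and the theorem for a fixed φ
applies; the countably many events are then summed. -/
lemma lintegral_servingDist_mul_expNeg_of_countable (hlam : 0 < lam) (heta : 2 < eta)
    (hX : IsPoissonProcess N.bs (ENNReal.ofReal lam • volume) μ)
    {H : ℝ → ℝ≥0∞} (hH : Measurable H) {k : ℝ → ℕ} (hk : Measurable k) {K : ℕ → ℝ}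
    (hK : ∀ i, 0 ≤ K i) :
    ∫⁻ ω, H (N.servingDist ω) * expNeg (∑' j, if j = N.serving ω then 0 else
        negLog (ENNReal.ofReal (bsLaplace eta (K (k (N.servingDist ω))) ‖N.bs j ω‖))) ∂μ =
      ∫⁻ r in Ioi (0 : ℝ), H r * (ENNReal.ofReal
        (2 * Real.pi * lam * r * Real.exp (-(Real.pi * lam * r ^ 2))) *
        expNeg (∫⁻ u in Ioi r, ENNReal.ofReal (2 * Real.pi * lam * u) *
          (1 - ENNReal.ofReal (bsLaplace eta (K (k r)) u)))) := by
  have hmD := N.measurable_servingDist hX.measurable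
  let A : ℕ → Ω → ℝ≥0∞ := fun i ω => expNeg (∑' j, if j = N.serving ω then 0 else
        negLog (ENNReal.ofReal (bsLaplace eta (K i) ‖N.bs j ω‖)))
  let B : ℕ → ℝ → ℝ≥0∞ := fun i r => ENNReal.ofReal
        (2 * Real.pi * lam * r * Real.exp (-(Real.pi * lam * r ^ 2))) *
        expNeg (∫⁻ u in Ioi r, ENNReal.ofReal (2 * Real.pi * lam * u) *
          (1 - ENNReal.ofReal (bsLaplace eta (K i) u)))
  have hA : ∀ i, Measurable (A i) := fun i => measurable_expNeg.comp
    (measurable_tsum_ite_serving hX.measurable fun j =>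
      ((measurable_negLog.comp ENNReal.measurable_ofReal).comp (measurable_bsLaplace eta (K i))).comp
        (hX.measurable j).norm)
  have hB : ∀ i, Measurable (B i) := fun i => by
    have : Antitone fun r : ℝ => ∫⁻ u in Ioi r, ENNReal.ofReal (2 * Real.pi * lam * u) *
          (1 - ENNReal.ofReal (bsLaplace eta (K i) u)) := fun r s h =>
      lintegral_mono_set (Ioi_subset_Ioi h)
    have := this.measurable
    fun_prop
  let h : ℕ → ℝ → ℝ≥0∞ := fun i r => if k r = i then H r else 0
  have hh : ∀ i, Measurable (h i) := fun i =>
    Measurable.ite (hk (measurableSet_singleton i)) hH measurable_const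
  have hsplit : ∀ (F : ℕ → ℝ≥0∞) (r : ℝ), H r * F (k r) = ∑' i, h i r * F i := fun F r => by
    rw [tsum_eq_single (k r)]
    · simp [h]
    · intro i hi
      simp [h, hi.symm]
  calc _ = ∫⁻ ω, ∑' i, h i (N.servingDist ω) * A i ω ∂μ :=
        lintegral_congr fun ω => hsplit (fun i => A i ω) _
    _ = ∑' i, ∫⁻ ω, h i (N.servingDist ω) * A i ω ∂μ :=
        lintegral_tsum fun i => (((hh i).comp hmD).mul (hA i)).aemeasurable
    _ = ∑' i, ∫⁻ r in Ioi (0 : ℝ), h i r * B i r := by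
        congr 1
        funext i
        exact lintegral_servingDist_mul_expNeg hlam hX (measurable_bsLaplace eta (K i))
          (fun u hu => bsLaplace_pos (hK i) hu) (fun u hu => bsLaplace_le_one (hK i) hu)
          (continuousOn_bsLaplace (hK i)) (integrableOn_mul_one_sub_bsLaplace heta (hK i)) (hh i)
    _ = ∫⁻ r in Ioi (0 : ℝ), ∑' i, h i r * B i r :=
        (lintegral_tsum fun i => ((hh i).mul (hB i)).aemeasurable).symm
    _ = _ := lintegral_congr fun r => (hsplit (fun i => B i r) r).symm

lemma lintegral_servingDist (hlam : 0 < lam)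
    (hX : IsPoissonProcess N.bs (ENNReal.ofReal lam • volume) μ)
    {H : ℝ → ℝ≥0∞} (hH : Measurable H) :
    ∫⁻ ω, H (N.servingDist ω) ∂μ = ∫⁻ r in Ioi (0 : ℝ), H r * ENNReal.ofReal
        (2 * Real.pi * lam * r * Real.exp (-(Real.pi * lam * r ^ 2))) := by
  have h := lintegral_servingDist_mul_expNeg hlam hX (φ := fun _ => 1) measurable_const
    (fun _ _ => one_pos) (fun _ _ => le_rfl) continuousOn_const (by simp) hH
  have h1 : negLog 1 = 0 := by simp [negLog]
  simpa [h1] using h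

/-- Joint law of the distance `r` to the nearest base station and of the interference from the
other stations, normalized by the power received from the nearest one. -/
theorem lintegral_servingDist_mul_expNeg_rpow (hlam : 0 < lam) (heta : 2 < eta)
    (hX : IsPoissonProcess N.bs (ENNReal.ofReal lam • volume) μ)
    {H : ℝ → ℝ≥0∞} (hH : Measurable H) (hH1 : ∀ r, H r ≤ 1) {T : ℝ} (hT : 0 ≤ T) :
    ∫⁻ ω, H (N.servingDist ω) * expNeg (∑' j, if j = N.serving ω then 0 else
        negLog (ENNReal.ofReal (bsLaplace eta (T * N.servingDist ω ^ eta) ‖N.bs j ω‖))) ∂μ =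
      ∫⁻ r in Ioi (0 : ℝ), H r * (ENNReal.ofReal
        (2 * Real.pi * lam * r * Real.exp (-(Real.pi * lam * r ^ 2))) *
        expNeg (∫⁻ u in Ioi r, ENNReal.ofReal (2 * Real.pi * lam * u) *
          (1 - ENNReal.ofReal (bsLaplace eta (T * r ^ eta) u)))) := by
  have hmD := N.measurable_servingDist hX.measurable
  -- The multiplier T r^η is evaluated at the dyadic floor of r: countably many values for each n,
  -- increasing to T r^η.
  let k : ℕ → ℝ → ℕ := fun n r => ⌊r * 2 ^ n⌋₊
  have hkm : ∀ n, Measurable (k n) := fun n =>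
    Nat.measurable_floor.comp (measurable_id.mul_const _)
  let K : ℕ → ℕ → ℝ := fun n i => T * ((i : ℝ) / 2 ^ n) ^ eta
  have hK : ∀ n i, 0 ≤ K n i := fun n i => by positivity
  have hKmono : ∀ r : ℝ, 0 ≤ r → Monotone fun n => K n (k n r) := fun r hr a b hab =>
    mul_le_mul_of_nonneg_left (Real.rpow_le_rpow (dyadicFloor_nonneg a r)
      (dyadicFloor_mono hr hab) (by linarith)) hT
  have hKt : ∀ r : ℝ, 0 ≤ r → Tendsto (fun n => K n (k n r)) atTop (𝓝 (T * r ^ eta)) :=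
    fun r hr => ((tendsto_dyadicFloor hr).rpow_const (Or.inr (by linarith))).const_mul T
  have key := fun n => lintegral_servingDist_mul_expNeg_of_countable hlam heta hX hH (hkm n)
    (K := K n) (hK n)
  have hL : Tendsto (fun n => ∫⁻ ω, H (N.servingDist ω) * expNeg (∑' j, if j = N.serving ω then 0
        else negLog (ENNReal.ofReal (bsLaplace eta (K n (k n (N.servingDist ω))) ‖N.bs j ω‖))) ∂μ)
      atTop (𝓝 (∫⁻ ω, H (N.servingDist ω) * expNeg (∑' j, if j = N.serving ω then 0 else
        negLog (ENNReal.ofReal (bsLaplace eta (T * N.servingDist ω ^ eta) ‖N.bs j ω‖))) ∂μ)) := by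
    -- The multiplier increases with n, so every factor decreases and every cost increases: the sums
    -- converge monotonically, and the integrands are bounded by 1.
    refine tendsto_lintegral_of_dominated_convergence (fun _ => 1) (fun n => ?_)
      (fun n => Eventually.of_forall fun ω => mul_le_one' (hH1 _) (expNeg_le_one _)) (by simp)
      (Eventually.of_forall fun ω => ?_)
    · refine (hH.comp hmD).mul (measurable_expNeg.comp
        (measurable_tsum_ite_serving hX.measurable fun j => ?_))
      have h1 : Measurable fun ω => (K n (k n (N.servingDist ω)), ‖N.bs j ω‖) :=
        (((measurable_of_countable (K n)).comp (hkm n)).comp hmD).prodMk (hX.measurable j).norm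
      exact (measurable_negLog.comp ENNReal.measurable_ofReal).comp
        ((measurable_uncurry_bsLaplace eta).comp h1)
    · have hr : 0 ≤ N.servingDist ω := norm_nonneg _
      refine ENNReal.Tendsto.const_mul ((continuous_expNeg.tendsto _).comp
        (tendsto_tsum_of_monotone (fun j a b hab => ?_) fun j => ?_))
        (Or.inr (ne_top_of_le_ne_top ENNReal.one_ne_top (hH1 _)))
      · dsimp only
        split_ifs
        · exact le_rfl
        · exact negLog_antitone (ENNReal.ofReal_le_ofReal
            (bsLaplace_anti (hK _ _) (hKmono _ hr hab) (norm_nonneg _)))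
      · split_ifs
        · exact tendsto_const_nhds
        · exact ((continuous_negLog.comp ENNReal.continuous_ofReal).tendsto _).comp
            (tendsto_bsLaplace (by positivity) (hKt _ hr) (norm_nonneg _))
  refine tendsto_nhds_unique hL ?_
  simp_rw [key]
  refine tendsto_lintegral_of_dominated_convergence (fun r => H r * ENNReal.ofReal
        (2 * Real.pi * lam * r * Real.exp (-(Real.pi * lam * r ^ 2)))) (fun n => ?_) (fun n => ?_) ?_ ?_
  · have h1 : Measurable fun q : ℕ × ℝ => ∫⁻ u in Ioi q.2, ENNReal.ofReal (2 * Real.pi * lam * u) *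
          (1 - ENNReal.ofReal (bsLaplace eta (K n q.1) u)) :=
      measurable_from_prod_countable_right fun i => Antitone.measurable fun r s h =>
        lintegral_mono_set (Ioi_subset_Ioi h)
    have h2 := measurable_expNeg.comp (h1.comp ((hkm n).prodMk measurable_id))
    exact hH.mul ((by fun_prop : Measurable fun r : ℝ => ENNReal.ofReal
        (2 * Real.pi * lam * r * Real.exp (-(Real.pi * lam * r ^ 2)))).mul h2)
  · refine Eventually.of_forall fun r => ?_
    exact mul_le_mul' le_rfl (mul_le_of_le_one_right' (expNeg_le_one _))
  -- The dominating function integrates to the mean of H at the nearest distance, at most the total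
  -- mass.
  · rw [← lintegral_servingDist hlam hX hH]
    refine ne_top_of_le_ne_top (measure_ne_top μ univ) ?_
    rw [← lintegral_one]
    exact lintegral_mono fun ω => hH1 _
  · refine (ae_restrict_iff' measurableSet_Ioi).2 (Eventually.of_forall fun r hr => ?_)
    have hr : 0 < r := hr
    refine ENNReal.Tendsto.const_mul (ENNReal.Tendsto.const_mul
      ((continuous_expNeg.tendsto _).comp ?_) (Or.inr ENNReal.ofReal_ne_top))
        (Or.inr (ne_top_of_le_ne_top ENNReal.one_ne_top (hH1 _)))
    refine lintegral_tendsto_of_tendsto_of_monotone (fun n => by fun_prop) ?_ ?_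
    · refine (ae_restrict_iff' measurableSet_Ioi).2 (Eventually.of_forall fun u hu a b hab => ?_)
      have hu : 0 < u := hr.trans hu
      dsimp only
      gcongr
      exact bsLaplace_anti (hK _ _) (hKmono _ hr.le hab) hu.le
    · refine (ae_restrict_iff' measurableSet_Ioi).2 (Eventually.of_forall fun u hu => ?_)
      have hu : 0 < u := hr.trans hu
      refine ENNReal.Tendsto.const_mul (ENNReal.Tendsto.sub tendsto_const_nhds
        ((ENNReal.continuous_ofReal.tendsto _).comp
          (tendsto_bsLaplace (by positivity) (hKt r hr.le) hu.le)) (Or.inl ENNReal.one_ne_top))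
        (Or.inr ENNReal.ofReal_ne_top)

end

-- Factorisation over independent groups of marks

section Independence

variable {Ω ι : Type*} [mΩ : MeasurableSpace Ω] {μ : Measure Ω}

/-- The σ-algebra generated by the variables with labels in `S`. -/
abbrev markSigma (X : ι → Ω → ℝ) (S : Set ι) : MeasurableSpace Ω :=
  ⨆ i ∈ S, MeasurableSpace.comap (X i) inferInstance

omit mΩ in
lemma measurable_markSigma {X : ι → Ω → ℝ} {S : Set ι} {i : ι} (hi : i ∈ S) :
    Measurable[markSigma X S] (X i) :=
  Measurable.of_comap_le (le_biSup (fun i => MeasurableSpace.comap (X i) inferInstance) hi)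

omit mΩ in
lemma markSigma_mono (X : ι → Ω → ℝ) {S T : Set ι} (h : S ⊆ T) : markSigma X S ≤ markSigma X T :=
  biSup_mono h

lemma markSigma_le {X : ι → Ω → ℝ} (hX : ∀ i, Measurable (X i)) (S : Set ι) :
    markSigma X S ≤ mΩ :=
  iSup₂_le fun i _ => (hX i).comap_le

lemma indep_markSigma {X : ι → Ω → ℝ} (hX : ∀ i, Measurable (X i)) (h : iIndepFun X μ)
    {S T : Set ι} (hST : Disjoint S T) : Indep (markSigma X S) (markSigma X T) μ :=
  indep_iSup_of_disjoint (fun i => (hX i).comap_le) ((iIndepFun_iff_iIndep _ _ _).1 h) hST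

lemma lintegral_mul_markSigma {X : ι → Ω → ℝ} (hX : ∀ i, Measurable (X i)) (h : iIndepFun X μ)
    {S T : Set ι} (hST : Disjoint S T) {f g : Ω → ℝ≥0∞} (hf : Measurable[markSigma X S] f)
    (hg : Measurable[markSigma X T] g) :
    ∫⁻ ω, f ω * g ω ∂μ = (∫⁻ ω, f ω ∂μ) * ∫⁻ ω, g ω ∂μ :=
  lintegral_mul_eq_lintegral_mul_lintegral_of_independent_measurableSpace
    (markSigma_le hX S) (markSigma_le hX T) (indep_markSigma hX h hST) hf hg

/-- By induction: the new factor is independent of the σ-algebra generated by the union of the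
blocks already treated. -/
lemma lintegral_prod_markSigma [IsProbabilityMeasure μ] {X : ι → Ω → ℝ}
    (hX : ∀ i, Measurable (X i)) (h : iIndepFun X μ) {κ : Type*} {S : κ → Set ι}
    (hS : Pairwise (Function.onFun Disjoint S)) {f : κ → Ω → ℝ≥0∞}
    (hf : ∀ a, Measurable[markSigma X (S a)] (f a)) (s : Finset κ) :
    ∫⁻ ω, ∏ a ∈ s, f a ω ∂μ = ∏ a ∈ s, ∫⁻ ω, f a ω ∂μ := by
  classical
  induction s using Finset.induction_on with
  | empty => simp
  | insert a s ha ih =>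
    simp_rw [Finset.prod_insert ha]
    rw [← ih]
    refine lintegral_mul_markSigma hX h (T := ⋃ b ∈ s, S b) ?_ (hf a) ?_
    · refine Set.disjoint_iUnion₂_right.2 fun b hb => hS ?_
      rintro rfl
      exact ha hb
    · exact Finset.measurable_fun_prod s fun b hb =>
        (hf b).mono (markSigma_mono X (subset_biUnion_of_mem (u := S) hb)) le_rfl

/-- Finite products factor, and bounded convergence carries this to the infinite sum. `negLog`
rewrites the product of expectations as a single cost. -/
lemma lintegral_expNeg_tsum_markSigma [IsProbabilityMeasure μ] {X : ι → Ω → ℝ}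
    (hX : ∀ i, Measurable (X i)) (h : iIndepFun X μ) {S : ℕ → Set ι}
    (hS : Pairwise (Function.onFun Disjoint S)) {Z : ℕ → Ω → ℝ≥0∞}
    (hZ : ∀ j, Measurable[markSigma X (S j)] (Z j)) :
    ∫⁻ ω, expNeg (∑' j, Z j ω) ∂μ = expNeg (∑' j, negLog (∫⁻ ω, expNeg (Z j ω) ∂μ)) := by
  have hle : ∀ j, ∫⁻ ω, expNeg (Z j ω) ∂μ ≤ 1 := fun j =>
    (lintegral_mono fun ω => expNeg_le_one _).trans (by simp)
  have hm : ∀ j, Measurable fun ω => expNeg (Z j ω) := fun j =>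
    measurable_expNeg.comp ((hZ j).mono (markSigma_le hX _) le_rfl)
  have h1 : Tendsto (fun n => ∫⁻ ω, ∏ j ∈ Finset.range n, expNeg (Z j ω) ∂μ) atTop
      (𝓝 (∫⁻ ω, expNeg (∑' j, Z j ω) ∂μ)) := by
    refine tendsto_lintegral_of_dominated_convergence (fun _ => 1)
      (fun n => Finset.measurable_fun_prod _ fun j _ => hm j)
      (fun n => Eventually.of_forall fun ω =>
        Finset.prod_le_one' fun j _ => expNeg_le_one _) (by simp)
      (Eventually.of_forall fun ω => (tendsto_prod_expNeg _).comp tendsto_finset_range)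
  have h2 := (tendsto_prod_expNeg fun j => negLog (∫⁻ ω, expNeg (Z j ω) ∂μ)).comp
    tendsto_finset_range
  refine tendsto_nhds_unique h1 (h2.congr fun n => ?_)
  rw [lintegral_prod_markSigma hX h hS (f := fun j ω => expNeg (Z j ω))
    (fun j => measurable_expNeg.comp (hZ j))]
  exact Finset.prod_congr rfl fun j _ => expNeg_negLog (hle j)

/-- Fubini for the product law, with V evaluated at an independent sample ω'. In this form one group
of variables can be frozen while the other is averaged. -/
lemma lintegral_of_indepFun [IsFiniteMeasure μ] {α β : Type*} [MeasurableSpace α]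
    [MeasurableSpace β] {U : Ω → α} {V : Ω → β} (hU : Measurable U) (hV : Measurable V)
    (h : IndepFun U V μ) {F : α → β → ℝ≥0∞} (hF : Measurable fun q : α × β => F q.1 q.2) :
    ∫⁻ ω, F (U ω) (V ω) ∂μ = ∫⁻ ω, ∫⁻ ω', F (U ω) (V ω') ∂μ ∂μ := by
  have hmap := (indepFun_iff_map_prod_eq_prod_map_map hU.aemeasurable hV.aemeasurable).1 h
  rw [← lintegral_map (f := fun q : α × β => F q.1 q.2) hF (hU.prodMk hV), hmap,
    lintegral_prod _ hF.aemeasurable, lintegral_map hF.lintegral_prod_right' hU]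
  refine lintegral_congr fun ω => ?_
  exact lintegral_map (hF.comp measurable_prodMk_left) hV

end Independence

-- The exponential law

section Exponential

variable {Ω : Type*} [mΩ : MeasurableSpace Ω] {μ : Measure Ω}

lemma lintegral_expMeasure {f : ℝ → ℝ≥0∞} (hf : Measurable f) :
    ∫⁻ x, f x ∂expMeasure 1 = ∫⁻ x, exponentialPDF 1 x * f x := by
  rw [expMeasure, gammaMeasure, lintegral_withDensity_eq_lintegral_mul _ (by
    exact (measurable_exponentialPDFReal 1).ennreal_ofReal) hf]
  rfl

/-- The function e^{-x} e^{-ax} is 1/(1 + a) times the exponential density of rate 1 + a. -/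
lemma lintegral_expNeg_mul_expMeasure {a : ℝ} (ha : 0 ≤ a) :
    ∫⁻ x, expNeg (ENNReal.ofReal (a * x)) ∂expMeasure 1 = ENNReal.ofReal (1 / (1 + a)) := by
  rw [lintegral_expMeasure (by fun_prop)]
  have h : ∀ x, exponentialPDF 1 x * expNeg (ENNReal.ofReal (a * x)) =
      ENNReal.ofReal (1 / (1 + a)) * exponentialPDF (1 + a) x := fun x => by
    rcases lt_or_ge x 0 with hx | hx
    · rw [exponentialPDF_of_neg hx, exponentialPDF_of_neg hx]
      simp
    · rw [exponentialPDF_of_nonneg hx, exponentialPDF_of_nonneg hx, expNeg_ofReal (by positivity),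
        ← ENNReal.ofReal_mul (by positivity), ← ENNReal.ofReal_mul (by positivity)]
      congr 1
      rw [one_mul, ← Real.exp_add]
      field_simp
      congr 1
      ring
  simp_rw [h]
  rw [lintegral_const_mul' _ _ ENNReal.ofReal_ne_top, lintegral_exponentialPDF_eq_one (by positivity),
    mul_one]

/-- The exponential tail at an extended threshold; t = ∞ is allowed, so an infinite interference
needs no separate treatment. -/
lemma expMeasure_le_ofReal {c : ℝ} (hc : 0 < c) (t : ℝ≥0∞) :
    expMeasure 1 {x | t ≤ ENNReal.ofReal (c * x)} = expNeg (t / ENNReal.ofReal c) := by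
  have := isProbabilityMeasure_expMeasure one_pos
  induction t with
  | top =>
    have : {x : ℝ | (⊤ : ℝ≥0∞) ≤ ENNReal.ofReal (c * x)} = ∅ := by
      ext x
      simp
    rw [this, measure_empty, ENNReal.top_div_of_ne_top ENNReal.ofReal_ne_top, expNeg_top]
  | coe t =>
    have h1 : expNeg ((t : ℝ≥0∞) / ENNReal.ofReal c) = ENNReal.ofReal (Real.exp (-(t / c))) := by
      rw [← ENNReal.ofReal_coe_nnreal, ← ENNReal.ofReal_div_of_pos hc, expNeg_ofReal (by positivity)]
    have hatom : expMeasure 1 {(t / c : ℝ)} = 0 := by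
      rw [expMeasure, gammaMeasure, withDensity_apply _ (measurableSet_singleton _)]
      simp
    have h2 : expMeasure 1 (Iic (t / c : ℝ)) = ENNReal.ofReal (1 - Real.exp (-(t / c))) := by
      rw [← ofReal_cdf, cdf_expMeasure_eq one_pos, if_pos (by positivity), one_mul]
    have h3 : expMeasure 1 (Ioi (t / c : ℝ)) = ENNReal.ofReal (Real.exp (-(t / c))) := by
      rw [← compl_Iic, prob_compl_eq_one_sub measurableSet_Iic, h2, ← ENNReal.ofReal_one,
        ← ENNReal.ofReal_sub]
      · congr 1
        ring
      · have := Real.exp_le_one_iff.2 (show -((t : ℝ) / c) ≤ 0 by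
          have : 0 ≤ (t : ℝ) / c := by positivity
          linarith)
        linarith
    rw [h1, ← h3]
    -- At t = 0 the event is the whole line, since `ENNReal.ofReal` sends negative values to 0; for
    -- t > 0 it is a half-line.
    rcases eq_or_ne t 0 with rfl | ht
    · simp only [ENNReal.coe_zero, zero_le, ofPred_true, measure_univ]
      rw [h3]
      simp
    · have ht' : 0 < (t : ℝ) := by positivity
      have hset : {x : ℝ | (t : ℝ≥0∞) ≤ ENNReal.ofReal (c * x)} = Ici (t / c : ℝ) := by
        ext x
        rw [mem_ofPred, ← ENNReal.ofReal_coe_nnreal, mem_Ici, div_le_iff₀' hc]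
        constructor
        · intro h
          rcases le_or_gt 0 (c * x) with h0 | h0
          · exact (ENNReal.ofReal_le_ofReal_iff h0).1 h
          · rw [ENNReal.ofReal_of_nonpos h0.le] at h
            simp at h
            exact absurd h ht
        · exact fun h => ENNReal.ofReal_le_ofReal h
      rw [hset, ← Ioi_union_left, measure_union₀ (measurableSet_singleton _).nullMeasurableSet, hatom,
        add_zero]
      exact (Set.disjoint_singleton_right.2 (by simp)).aedisjoint

end Exponential

-- Path-loss integrals in closed form

section PathLossIntegrals

variable {lam eta : ℝ}

/-- Because c - b = 1, the factor in 1 - t disappears from Euler's integral, and Γ(b + 1) = bΓ(b)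
reduces the prefactor to b. -/
lemma hypergeom_one_eq (heta : 2 < eta) (z : ℝ) :
    hypergeom 1 (1 - 2 / eta) (2 - 2 / eta) z =
      (1 - 2 / eta) * ∫ t in Ioo (0 : ℝ) 1, t ^ (-(2 / eta)) * (1 - z * t)⁻¹ := by
  have hb : 0 < 1 - 2 / eta := by
    rw [sub_pos, div_lt_one (by linarith)]
    exact heta
  have hG : Real.Gamma (2 - 2 / eta) = (1 - 2 / eta) * Real.Gamma (1 - 2 / eta) := by
    rw [← Real.Gamma_add_one hb.ne']
    congr 1
    ring
  have hc : 2 - 2 / eta - (1 - 2 / eta) = 1 := by ring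
  rw [hypergeom, hc, hG, Real.Gamma_one, mul_one, mul_div_assoc,
    div_self (Real.Gamma_pos_of_pos hb).ne', mul_one, intervalIntegral.integral_of_le zero_le_one,
    integral_Ioc_eq_integral_Ioo]
  congr 1
  refine setIntegral_congr_fun measurableSet_Ioo fun t _ => ?_
  simp only [sub_self, Real.rpow_zero, mul_one, Real.rpow_neg_one]
  congr 2
  ring

lemma integrableOn_rpow_mul_inv (heta : 2 < eta) {a : ℝ} (ha : 0 ≤ a) :
    IntegrableOn (fun t : ℝ => t ^ (-(2 / eta)) * (1 - -a * t)⁻¹) (Ioo 0 1) := by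
  have h : -1 < -(2 / eta) := by
    rw [neg_lt_neg_iff, div_lt_one (by linarith)]
    exact heta
  have hi : IntegrableOn (fun t : ℝ => t ^ (-(2 / eta))) (Ioo 0 1) :=
    ((intervalIntegrable_iff_integrableOn_Ioc_of_le zero_le_one).1
      (intervalIntegral.intervalIntegrable_rpow' h)).mono_set Ioo_subset_Ioc_self
  refine Integrable.mono' hi (by fun_prop) ?_
  refine (ae_restrict_iff' measurableSet_Ioo).2 (Eventually.of_forall fun t ht => ?_)
  have h0 := Real.rpow_nonneg ht.1.le (-(2 / eta))
  have h1 : 1 ≤ 1 - -a * t := by nlinarith [mul_nonneg ha ht.1.le]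
  rw [Real.norm_of_nonneg (mul_nonneg h0 (by positivity))]
  exact mul_le_of_le_one_right h0 (inv_le_one_of_one_le₀ h1)

lemma hypergeom_neg_nonneg (heta : 2 < eta) {a : ℝ} (ha : 0 ≤ a) :
    0 ≤ hypergeom 1 (1 - 2 / eta) (2 - 2 / eta) (-a) := by
  have hb : 0 < 1 - 2 / eta := by
    rw [sub_pos, div_lt_one (by linarith)]
    exact heta
  rw [hypergeom_one_eq heta]
  refine mul_nonneg hb.le (setIntegral_nonneg measurableSet_Ioo fun t ht => ?_)
  have h1 : 1 ≤ 1 - -a * t := by nlinarith [mul_nonneg ha ht.1.le]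
  exact mul_nonneg (Real.rpow_nonneg ht.1.le _) (inv_nonneg.2 (by linarith))

/-- The substitution u = R t^{-1/η} maps (0, 1) onto (R, ∞) and turns K u^{-η}, with K = aR^η, into
at. Apart from this R enters only as R². The identity serves the stations (R the serving distance)
and the users (R their link distance). -/
lemma lintegral_Ioi_one_sub_bsLaplace (hlam : 0 < lam) (heta : 2 < eta) {a R : ℝ} (ha : 0 ≤ a)
    (hR : 0 < R) :
    ∫⁻ u in Ioi R, ENNReal.ofReal (2 * Real.pi * lam * u) *
        (1 - ENNReal.ofReal (bsLaplace eta (a * R ^ eta) u)) =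
      ENNReal.ofReal (2 * Real.pi * lam / (eta - 2) * R ^ 2 * a *
        hypergeom 1 (1 - 2 / eta) (2 - 2 / eta) (-a)) := by
  have he : 0 < eta := by linarith
  have himg : (fun t : ℝ => R * t ^ (-(1 / eta))) '' Ioo 0 1 = Ioi R := by
    ext u
    simp only [mem_image, mem_Ioo, mem_Ioi]
    constructor
    · rintro ⟨t, ⟨h0, h1⟩, rfl⟩
      have : 1 < t ^ (-(1 / eta)) :=
        Real.one_lt_rpow_of_pos_of_lt_one_of_neg h0 h1 (by simpa using he)
      nlinarith
    · intro hu
      have hu1 : 1 < u / R := (one_lt_div hR).2 hu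
      have hu0 : 0 < u / R := by linarith
      refine ⟨(u / R) ^ (-eta), ⟨by positivity,
        Real.rpow_lt_one_of_one_lt_of_neg hu1 (by linarith)⟩, ?_⟩
      rw [← Real.rpow_mul hu0.le]
      have : -eta * -(1 / eta) = 1 := by field_simp
      rw [this, Real.rpow_one]
      field_simp
  have hd : ∀ t ∈ Ioo (0 : ℝ) 1, HasDerivWithinAt (fun t : ℝ => R * t ^ (-(1 / eta)))
      (R * (-(1 / eta) * t ^ (-(1 / eta) - 1))) (Ioo 0 1) t := fun t ht =>
    ((Real.hasDerivAt_rpow_const (Or.inl ht.1.ne')).const_mul R).hasDerivWithinAt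
  have hinj : InjOn (fun t : ℝ => R * t ^ (-(1 / eta))) (Ioo 0 1) := fun s hs t ht h => by
    have h' : s ^ (-(1 / eta)) = t ^ (-(1 / eta)) := mul_left_cancel₀ hR.ne' h
    have hne : -(1 / eta) ≠ 0 := by
      rw [neg_ne_zero]
      positivity
    exact (Real.rpow_left_inj hs.1.le ht.1.le hne).1 h'
  rw [← himg, lintegral_image_eq_lintegral_abs_deriv_mul measurableSet_Ioo hd hinj,
    hypergeom_one_eq heta]
  have hb : 0 < 1 - 2 / eta := by
    rw [sub_pos, div_lt_one (by linarith)]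
    exact heta
  rw [show 2 * Real.pi * lam / (eta - 2) * R ^ 2 * a * ((1 - 2 / eta) *
      ∫ t in Ioo (0 : ℝ) 1, t ^ (-(2 / eta)) * (1 - -a * t)⁻¹) =
      ∫ t in Ioo (0 : ℝ) 1, 2 * Real.pi * lam * R ^ 2 * a / eta *
        (t ^ (-(2 / eta)) * (1 - -a * t)⁻¹) by
    rw [integral_const_mul]
    have : eta - 2 ≠ 0 := by linarith
    field_simp,
    ofReal_integral_eq_lintegral_ofReal ((integrableOn_rpow_mul_inv heta ha).const_mul _)]
  · refine setLIntegral_congr_fun measurableSet_Ioo fun t ht => ?_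
    have ht0 : 0 < t := ht.1
    have hK : 0 ≤ a * R ^ eta := by positivity
    have hu : 0 < R * t ^ (-(1 / eta)) := by positivity
    rw [← ENNReal.ofReal_one, ← ENNReal.ofReal_sub _ (bsLaplace_pos hK hu.le).le,
      one_sub_bsLaplace hK hu.le, ← ENNReal.ofReal_mul (by positivity),
      ← ENNReal.ofReal_mul (abs_nonneg _)]
    congr 1
    have h1 : a * R ^ eta * (R * t ^ (-(1 / eta))) ^ (-eta) = a * t := by
      rw [Real.mul_rpow hR.le (by positivity), ← Real.rpow_mul ht0.le, Real.rpow_neg hR.le]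
      have : -(1 / eta) * -eta = 1 := by field_simp
      rw [this, Real.rpow_one]
      have : R ^ eta ≠ 0 := by positivity
      field_simp
    have h2 : |R * (-(1 / eta) * t ^ (-(1 / eta) - 1))| = R / eta * t ^ (-(1 / eta) - 1) := by
      rw [abs_mul, abs_mul, abs_neg, abs_of_pos hR, abs_of_pos (by positivity),
        abs_of_pos (by positivity)]
      ring
    have h3 : t ^ (-(1 / eta) - 1) * t ^ (-(1 / eta)) * t = t ^ (-(2 / eta)) := by
      nth_rewrite 3 [← Real.rpow_one t]
      rw [← Real.rpow_add ht0, ← Real.rpow_add ht0]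
      congr 1
      ring
    rw [h1, h2, ← h3, neg_mul, sub_neg_eq_add]
    have : 1 + a * t ≠ 0 := by positivity
    field_simp
  · refine (ae_restrict_iff' measurableSet_Ioo).2 (Eventually.of_forall fun t ht => ?_)
    have ht0 : 0 < t := ht.1
    have : 0 ≤ 1 - -a * t := by nlinarith [mul_nonneg ha ht0.le]
    simp only [Pi.zero_apply]
    positivity

lemma lintegral_rpow_mul_exp_neg_mul {a r : ℝ} (ha : 0 < a) (hr : 0 < r) :
    ∫⁻ t in Ioi (0 : ℝ), ENNReal.ofReal (t ^ (a - 1) * Real.exp (-(r * t))) =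
      ENNReal.ofReal ((1 / r) ^ a * Real.Gamma a) := by
  have h := Real.integral_rpow_mul_exp_neg_mul_Ioi ha hr
  have hpos : 0 < (1 / r) ^ a * Real.Gamma a :=
    mul_pos (by positivity) (Real.Gamma_pos_of_pos ha)
  rw [← h, ofReal_integral_eq_lintegral_ofReal]
  -- A non-integrable function would have integral 0, against the positive value found above.
  · by_contra hn
    rw [integral_undef hn] at h
    exact hpos.ne h
  · refine (ae_restrict_iff' measurableSet_Ioi).2 (Eventually.of_forall fun t ht => ?_)
    have ht : 0 < t := ht
    simp only [Pi.zero_apply]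
    positivity

/-- Writing 1/(1 + v) as the integral of e^{-x(1+v)} over x > 0 and exchanging the integrals leaves
two gamma integrals; the reflection formula evaluates Γ(b)Γ(1 - b). -/
lemma lintegral_rpow_div_one_add {b : ℝ} (hb0 : 0 < b) (hb1 : b < 1) :
    ∫⁻ v in Ioi (0 : ℝ), ENNReal.ofReal (v ^ (b - 1) / (1 + v)) =
      ENNReal.ofReal (Real.pi / Real.sin (Real.pi * b)) := by
  have h1 : ∀ v ∈ Ioi (0 : ℝ), ENNReal.ofReal (v ^ (b - 1) / (1 + v)) =
      ∫⁻ x in Ioi (0 : ℝ), ENNReal.ofReal (Real.exp (-x) * (v ^ (b - 1) * Real.exp (-(x * v)))) :=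
    fun v hv => by
    have hv : 0 < v := hv
    have h := lintegral_rpow_mul_exp_neg_mul one_pos (show 0 < 1 + v by positivity)
    simp only [sub_self, Real.rpow_zero, one_mul, Real.rpow_one, Real.Gamma_one, mul_one] at h
    rw [div_eq_mul_one_div, ENNReal.ofReal_mul (by positivity), ← h,
      ← lintegral_const_mul' _ _ ENNReal.ofReal_ne_top]
    refine lintegral_congr fun x => ?_
    rw [← ENNReal.ofReal_mul (by positivity), mul_left_comm, ← Real.exp_add]
    congr 3
    ring
  have h2 : ∀ x ∈ Ioi (0 : ℝ), ∫⁻ v in Ioi (0 : ℝ),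
      ENNReal.ofReal (Real.exp (-x) * (v ^ (b - 1) * Real.exp (-(x * v)))) =
      ENNReal.ofReal (Real.Gamma b) * ENNReal.ofReal (x ^ ((1 - b) - 1) * Real.exp (-(1 * x))) :=
    fun x hx => by
    have hx : 0 < x := hx
    simp_rw [ENNReal.ofReal_mul (Real.exp_nonneg (-x))]
    rw [lintegral_const_mul' _ _ ENNReal.ofReal_ne_top, lintegral_rpow_mul_exp_neg_mul hb0 hx,
      ← ENNReal.ofReal_mul (Real.exp_nonneg _),
      ← ENNReal.ofReal_mul (Real.Gamma_pos_of_pos hb0).le]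
    congr 1
    rw [one_div, Real.inv_rpow hx.le, ← Real.rpow_neg hx.le]
    ring_nf
  rw [setLIntegral_congr_fun measurableSet_Ioi h1, lintegral_lintegral_swap (by fun_prop),
    setLIntegral_congr_fun measurableSet_Ioi h2, lintegral_const_mul' _ _ ENNReal.ofReal_ne_top,
    lintegral_rpow_mul_exp_neg_mul (by linarith) one_pos,
    ← ENNReal.ofReal_mul (Real.Gamma_pos_of_pos hb0).le, ← Real.Gamma_mul_Gamma_one_sub]
  simp

/-- The substitution u = (Kv)^{1/η} reduces to the previous integral with b = 2/η < 1. It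
degenerates at K = 0, where both sides vanish. -/
lemma lintegral_one_sub_bsLaplace (hlam : 0 < lam) (heta : 2 < eta) {K : ℝ} (hK : 0 ≤ K) :
    ∫⁻ u in Ioi (0 : ℝ), ENNReal.ofReal (2 * Real.pi * lam * u) *
        (1 - ENNReal.ofReal (bsLaplace eta K u)) =
      ENNReal.ofReal (2 * Real.pi ^ 2 * lam / eta * K ^ (2 / eta) *
        (1 / Real.sin (2 * Real.pi / eta))) := by
  have he : 0 < eta := by linarith
  rcases hK.eq_or_lt with rfl | hK
  · have h0 : (0 : ℝ) ^ (2 / eta) = 0 := Real.zero_rpow (by positivity)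
    simp [bsLaplace, h0]
  have himg : (fun v : ℝ => (K * v) ^ (1 / eta)) '' Ioi 0 = Ioi 0 := by
    ext u
    simp only [mem_image, mem_Ioi]
    constructor
    · rintro ⟨v, hv, rfl⟩
      positivity
    · intro hu
      refine ⟨u ^ eta / K, by positivity, ?_⟩
      rw [mul_div_cancel₀ _ hK.ne', ← Real.rpow_mul hu.le, mul_one_div_cancel he.ne', Real.rpow_one]
  have hd : ∀ v ∈ Ioi (0 : ℝ), HasDerivWithinAt (fun v : ℝ => (K * v) ^ (1 / eta))
      (K * 1 * (1 / eta) * (K * v) ^ (1 / eta - 1)) (Ioi 0) v := fun v hv =>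
    (((hasDerivAt_id v).const_mul K).rpow_const
      (Or.inl (mul_pos hK hv).ne')).hasDerivWithinAt
  have hinj : InjOn (fun v : ℝ => (K * v) ^ (1 / eta)) (Ioi 0) := fun s hs t ht h => by
    have h' := (Real.rpow_left_inj (mul_pos hK hs).le (mul_pos hK ht).le
      (show 1 / eta ≠ 0 by positivity)).1 h
    exact mul_left_cancel₀ hK.ne' h'
  have hb1 : 2 / eta < 1 := by rwa [div_lt_one he]
  rw [← himg, lintegral_image_eq_lintegral_abs_deriv_mul measurableSet_Ioi hd hinj]
  have hsin : Real.pi * (2 / eta) = 2 * Real.pi / eta := by ring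
  rw [show 2 * Real.pi ^ 2 * lam / eta * K ^ (2 / eta) * (1 / Real.sin (2 * Real.pi / eta)) =
      2 * Real.pi * lam / eta * K ^ (2 / eta) * (Real.pi / Real.sin (Real.pi * (2 / eta))) by
    rw [hsin]
    ring,
    ENNReal.ofReal_mul (p := 2 * Real.pi * lam / eta * K ^ (2 / eta)) (by positivity),
    ← lintegral_rpow_div_one_add (by positivity) hb1,
    ← lintegral_const_mul' _ _ ENNReal.ofReal_ne_top]
  refine setLIntegral_congr_fun measurableSet_Ioi fun v hv => ?_
  have hv : 0 < v := hv
  have hu : 0 < (K * v) ^ (1 / eta) := by positivity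
  rw [← ENNReal.ofReal_one, ← ENNReal.ofReal_sub _ (bsLaplace_pos hK.le hu.le).le,
    one_sub_bsLaplace hK.le hu.le, ← ENNReal.ofReal_mul (by positivity),
    ← ENNReal.ofReal_mul (abs_nonneg _), ← ENNReal.ofReal_mul (by positivity)]
  congr 1
  have h1 : K * ((K * v) ^ (1 / eta)) ^ (-eta) = 1 / v := by
    rw [← Real.rpow_mul (by positivity)]
    have : 1 / eta * -eta = -1 := by field_simp
    rw [this, Real.rpow_neg_one]
    field_simp
  have h2 : K ^ (2 / eta) * v ^ (2 / eta - 1) =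
      K * ((K * v) ^ (1 / eta - 1) * (K * v) ^ (1 / eta)) := by
    rw [← Real.rpow_add (by positivity), Real.mul_rpow hK.le hv.le]
    have : K ^ (2 / eta) = K * K ^ (1 / eta - 1 + 1 / eta) := by
      nth_rewrite 2 [← Real.rpow_one K]
      rw [← Real.rpow_add hK]
      congr 1
      ring
    rw [this, mul_assoc]
    congr 3
    ring
  rw [h1, abs_of_pos (by positivity)]
  have h3 : 1 / v / (1 + 1 / v) = 1 / (1 + v) := by
    field_simp
    ring
  rw [h3, show 2 * Real.pi * lam / eta * K ^ (2 / eta) * (v ^ (2 / eta - 1) / (1 + v)) =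
    2 * Real.pi * lam / eta * (K ^ (2 / eta) * v ^ (2 / eta - 1)) / (1 + v) by ring, h2]
  ring

end PathLossIntegrals

-- Positivity of the intra-mode factor

section Pulses

lemma continuous_nsinc : Continuous nsinc := Real.continuous_sinc.comp (continuous_const.mul continuous_id)

lemma nsinc_zero : nsinc 0 = 1 := by simp [nsinc]

/-- Dominated by 2/(1 + x²), since sinc² x and x² sinc² x are both at most 1. -/
lemma integrable_sinc_sq : Integrable fun x : ℝ => Real.sinc x ^ 2 := by
  refine (integrable_inv_one_add_sq.const_mul 2).mono'
    (Real.continuous_sinc.pow 2).aestronglyMeasurable (Eventually.of_forall fun x => ?_)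
  rw [Real.norm_of_nonneg (sq_nonneg _), ← div_eq_mul_inv, le_div_iff₀ (by positivity)]
  have h1 : Real.sinc x ^ 2 ≤ 1 := (sq_le_one_iff_abs_le_one _).2 (Real.abs_sinc_le_one x)
  have h2 : Real.sinc x ^ 2 * x ^ 2 ≤ 1 := by
    rw [← mul_pow]
    rcases eq_or_ne x 0 with rfl | hx
    · simp
    · rw [Real.sinc_of_ne_zero hx, div_mul_cancel₀ _ hx]
      exact Real.sin_sq_le_one x
  linarith

lemma integrable_nsinc_sq {W : ℝ} (hW : 0 < W) : Integrable fun x : ℝ => nsinc (2 * x / W) ^ 2 := by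
  have h := integrable_sinc_sq.comp_mul_left' (R := Real.pi * (2 / W)) (by positivity)
  refine h.congr (Eventually.of_forall fun x => ?_)
  simp only [nsinc]
  congr 2
  ring

lemma integrable_nsinc_pow_four {W : ℝ} (hW : 0 < W) :
    Integrable fun x : ℝ => nsinc (2 * x / W) ^ 4 := by
  refine (integrable_nsinc_sq hW).mono'
    ((continuous_nsinc.comp (by fun_prop)).pow 4).aestronglyMeasurable
    (Eventually.of_forall fun x => ?_)
  rw [Real.norm_of_nonneg (by positivity)]
  have h1 : nsinc (2 * x / W) ^ 2 ≤ 1 := (sq_le_one_iff_abs_le_one _).2 (Real.abs_sinc_le_one _)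
  nlinarith [sq_nonneg (nsinc (2 * x / W))]

/-- Integrability matters here: without it the normalising integral of the pulse would have the
default value 0. -/
lemma integral_nsinc_pos {W : ℝ} {n : ℕ}
    (hi : Integrable fun x : ℝ => nsinc (2 * x / W) ^ n) (hn : Even n) :
    0 < ∫ x : ℝ, nsinc (2 * x / W) ^ n :=
  integral_pos_of_integrable_nonneg_nonzero (x := 0)
    ((continuous_nsinc.comp (by fun_prop)).pow n) hi (fun x => hn.pow_nonneg _)
    (by simp [nsinc_zero])

lemma continuous_pulseSpectrum (W : ℝ) (b : Pulse) : Continuous fun f => pulseSpectrum f W b := by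
  have h : Continuous fun f : ℝ => nsinc (2 * f / W) := continuous_nsinc.comp (by fun_prop)
  cases b
  · exact h.div_const _
  · exact (h.pow 2).div_const _

lemma pulseSpectrum_zero_pos {W : ℝ} (hW : 0 < W) (b : Pulse) : 0 < pulseSpectrum 0 W b := by
  cases b
  · have := integral_nsinc_pos (integrable_nsinc_sq hW) even_two
    simp only [pulseSpectrum, mul_zero, zero_div, nsinc_zero]
    positivity
  · have := integral_nsinc_pos (integrable_nsinc_pow_four hW) (by decide)
    simp only [pulseSpectrum, mul_zero, zero_div, nsinc_zero]
    positivity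

namespace Params

variable (p : Params)

lemma band_pos (v : Link) : 0 < p.band v := by
  have h1 : 0 < p.bandMin := lt_min (p.bandHD_pos _) (p.bandHD_pos _)
  have h2 := p.bandHD_pos v
  have h3 := mul_nonneg (mul_nonneg p.alpha_nonneg (by linarith [p.eps_nonneg] : 0 ≤ p.eps + 1)) h1.le
  unfold band
  linarith

/-- The integrand is continuous, nonnegative and positive at f = 0. This is the only property of the
pulse shapes used in the argument; it allows division by the mean received power. -/
lemma intra_pos (v : Link) : 0 < p.intra v := by
  have hW := p.band_pos v
  have hc := continuous_pulseSpectrum (p.band v) (p.pulse v)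
  refine intervalIntegral.integral_pos (by linarith) (hc.mul hc).continuousOn
    (fun x _ => mul_self_nonneg _) ⟨0, ⟨by linarith, by linarith⟩, ?_⟩
  exact mul_pos (pulseSpectrum_zero_pos hW _) (pulseSpectrum_zero_pos hW _)

end Params

end Pulses

-- The truncated link distance and its moments

namespace Params

variable (p : Params)

lemma eta_pos : 0 < p.eta := by linarith [p.two_lt_eta]

lemma RM_pos : 0 < p.RM := Real.rpow_pos_of_pos (div_pos p.PuMax_pos p.rho_pos) _

lemma rho_mul_rpow_le_iff {r : ℝ} (hr : 0 ≤ r) : p.rho * r ^ p.eta ≤ p.PuMax ↔ r ≤ p.RM := by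
  rw [← le_div_iff₀' p.rho_pos, RM, one_div,
    Real.le_rpow_inv_iff_of_pos hr (div_pos p.PuMax_pos p.rho_pos).le p.eta_pos]

lemma txPower_of_mem {r : ℝ} (hr : r ∈ Ioc 0 p.RM) : p.txPower r = p.rho * r ^ p.eta :=
  if_pos ((p.rho_mul_rpow_le_iff hr.1.le).2 hr.2)

@[fun_prop] lemma measurable_txPower : Measurable p.txPower := by
  unfold txPower
  exact Measurable.ite (measurableSet_le (by fun_prop) measurable_const) (by fun_prop)
    measurable_const

/-- Probability that a user is not in truncation outage. -/
noncomputable def activeProb : ℝ := 1 - Real.exp (-(Real.pi * p.lam * p.RM ^ 2))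

lemma activeProb_pos : 0 < p.activeProb := by
  have h := p.RM_pos
  have h' := p.lam_pos
  rw [activeProb, sub_pos, Real.exp_lt_one_iff]
  have : 0 < Real.pi * p.lam * p.RM ^ 2 := by positivity
  linarith

lemma fR_eq (r : ℝ) :
    p.fR r = 2 * Real.pi * p.lam * r * Real.exp (-(Real.pi * p.lam * r ^ 2)) / p.activeProb := rfl

lemma fR_nonneg {r : ℝ} (hr : 0 ≤ r) : 0 ≤ p.fR r := by
  have := p.activeProb_pos
  have := p.lam_pos
  rw [fR_eq]
  positivity

lemma continuous_fR : Continuous p.fR := by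
  unfold fR
  exact Continuous.div_const (by fun_prop) _

@[fun_prop] lemma measurable_fR : Measurable p.fR := p.continuous_fR.measurable

lemma integral_rayleigh :
    ∫ r in (0 : ℝ)..p.RM, 2 * Real.pi * p.lam * r * Real.exp (-(Real.pi * p.lam * r ^ 2)) =
      p.activeProb := by
  have hd : ∀ r ∈ uIcc 0 p.RM, HasDerivAt (fun r : ℝ => -Real.exp (-(Real.pi * p.lam * r ^ 2)))
      (2 * Real.pi * p.lam * r * Real.exp (-(Real.pi * p.lam * r ^ 2))) r := fun r _ => by
    have h := ((((hasDerivAt_pow 2 r).const_mul (Real.pi * p.lam)).neg).exp).neg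
    refine h.congr_deriv ?_
    simp only [Pi.neg_apply]
    push_cast
    ring
  rw [intervalIntegral.integral_eq_sub_of_hasDerivAt hd
    (Continuous.intervalIntegrable (by fun_prop) _ _)]
  simp [activeProb]
  ring

/-- The second moment of the distance between an active user and its station. -/
lemma lintegral_fR_mul_sq :
    ∫⁻ r in Ioc 0 p.RM, ENNReal.ofReal (p.fR r) * ENNReal.ofReal (r ^ 2) =
      ENNReal.ofReal (lowerGamma 2 (Real.pi * p.lam * p.RM ^ 2) /
        (Real.pi * p.lam * p.activeProb)) := by
  have hA := p.activeProb_pos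
  have hl := p.lam_pos
  have hg : lowerGamma 2 (Real.pi * p.lam * p.RM ^ 2) =
      ∫ t in (Real.pi * p.lam * (0 : ℝ) ^ 2)..(Real.pi * p.lam * p.RM ^ 2), t * Real.exp (-t) := by
    rw [lowerGamma, zero_pow two_ne_zero, mul_zero]
    refine intervalIntegral.integral_congr fun t _ => ?_
    norm_num
  -- The change of variable t = πλr² produces the integrand of γ(2, ·).
  have hsub := intervalIntegral.integral_comp_mul_deriv (a := 0) (b := p.RM)
    (f := fun r => Real.pi * p.lam * r ^ 2) (f' := fun r => Real.pi * p.lam * (2 * r))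
    (g := fun t => t * Real.exp (-t))
    (fun r _ => by
      have := (hasDerivAt_pow 2 r).const_mul (Real.pi * p.lam)
      simpa using this) (by fun_prop) (by fun_prop)
  rw [hg, ← hsub, ← intervalIntegral.integral_div, intervalIntegral.integral_of_le p.RM_pos.le,
    ofReal_integral_eq_lintegral_ofReal]
  · refine setLIntegral_congr_fun measurableSet_Ioc fun r hr => ?_
    rw [← ENNReal.ofReal_mul (p.fR_nonneg hr.1.le), fR_eq]
    congr 1
    simp only [Function.comp_apply]
    field_simp
  · exact (Continuous.integrableOn_Ioc (by unfold Function.comp; fun_prop))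
  · refine (ae_restrict_iff' measurableSet_Ioc).2 (Eventually.of_forall fun r hr => ?_)
    have := hr.1
    simp only [Pi.zero_apply, Function.comp_apply]
    positivity

lemma powerMoment_eq :
    p.powerMoment = p.rho ^ (2 / p.eta) * (lowerGamma 2 (Real.pi * p.lam * p.RM ^ 2) /
        (Real.pi * p.lam * p.activeProb)) := by
  rw [powerMoment, mul_div_assoc]
  rfl

end Params

section LinkDistance

variable {Ω : Type*} {N : Network Ω} [MeasurableSpace Ω] {μ : Measure Ω} {p : Params}

omit [MeasurableSpace Ω] in
lemma mem_active_iff (ω : Ω) : ω ∈ N.active p ↔ N.servingDist ω ≤ p.RM := by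
  rw [Network.active, mem_ofPred]
  exact p.rho_mul_rpow_le_iff (norm_nonneg _)

lemma measurableSet_active (hbs : ∀ j, Measurable (N.bs j)) : MeasurableSet (N.active p) := by
  have : N.active p = N.servingDist ⁻¹' Iic p.RM := by
    ext ω
    exact mem_active_iff ω
  rw [this]
  exact N.measurable_servingDist hbs measurableSet_Iic

lemma setLIntegral_active [IsFiniteMeasure μ]
    (hX : IsPoissonProcess N.bs (ENNReal.ofReal p.lam • volume) μ) {H : ℝ → ℝ≥0∞}
    (hH : Measurable H) :
    ∫⁻ ω in N.active p, H (N.servingDist ω) ∂μ = ∫⁻ r in Ioc 0 p.RM, H r *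
      ENNReal.ofReal (2 * Real.pi * p.lam * r * Real.exp (-(Real.pi * p.lam * r ^ 2))) := by
  have h := lintegral_servingDist p.lam_pos hX (hH.indicator (measurableSet_Iic (a := p.RM)))
  rw [← lintegral_indicator (measurableSet_active hX.measurable)]
  refine Eq.trans (lintegral_congr fun ω => ?_) (h.trans ?_)
  · by_cases hω : N.servingDist ω ≤ p.RM
    · rw [indicator_of_mem ((mem_active_iff ω).2 hω), indicator_of_mem (mem_Iic.2 hω)]
    · rw [indicator_of_notMem (mt (mem_active_iff ω).1 hω), indicator_of_notMem (mt mem_Iic.1 hω)]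
  · rw [show Ioc 0 p.RM = Iic p.RM ∩ Ioi 0 by ext; simp [and_comm],
      ← Measure.restrict_restrict measurableSet_Iic, ← lintegral_indicator measurableSet_Iic]
    refine lintegral_congr fun r => ?_
    by_cases hr : r ∈ Iic p.RM <;> simp [hr]

lemma measure_active [IsFiniteMeasure μ]
    (hX : IsPoissonProcess N.bs (ENNReal.ofReal p.lam • volume) μ) :
    μ (N.active p) = ENNReal.ofReal p.activeProb := by
  have h := setLIntegral_active hX (measurable_const (a := (1 : ℝ≥0∞)))
  rw [setLIntegral_one] at h
  rw [h, ← p.integral_rayleigh, intervalIntegral.integral_of_le p.RM_pos.le,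
    ofReal_integral_eq_lintegral_ofReal]
  · simp
  · exact Continuous.integrableOn_Ioc (by fun_prop)
  · refine (ae_restrict_iff' measurableSet_Ioc).2 (Eventually.of_forall fun r hr => ?_)
    have := hr.1
    have := p.lam_pos
    simp only [Pi.zero_apply]
    positivity

lemma measure_active_inv_mul (r : ℝ) :
    (ENNReal.ofReal p.activeProb)⁻¹ *
      ENNReal.ofReal (2 * Real.pi * p.lam * r * Real.exp (-(Real.pi * p.lam * r ^ 2))) =
      ENNReal.ofReal (p.fR r) := by
  rw [p.fR_eq, ENNReal.ofReal_div_of_pos p.activeProb_pos, ENNReal.div_eq_inv_mul]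

/-- Conditioning on activity truncates the Rayleigh law of the nearest distance at R_M and
renormalises it by `activeProb`. -/
lemma lintegral_linkDistLaw [IsFiniteMeasure μ]
    (hX : IsPoissonProcess N.bs (ENNReal.ofReal p.lam • volume) μ) {H : ℝ → ℝ≥0∞}
    (hH : Measurable H) :
    ∫⁻ r, H r ∂N.linkDistLaw p μ = ∫⁻ r in Ioc 0 p.RM, ENNReal.ofReal (p.fR r) * H r := by
  rw [Network.linkDistLaw, lintegral_map hH (N.measurable_servingDist hX.measurable),
    ProbabilityTheory.cond, lintegral_smul_measure, setLIntegral_active hX hH, measure_active hX,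
    smul_eq_mul, ← lintegral_const_mul _ (by fun_prop)]
  refine lintegral_congr fun r => ?_
  rw [mul_left_comm, measure_active_inv_mul, mul_comm]

/-- Ensures that almost surely `txPower` takes its value ρ r^η and that powers of r can be
cancelled. -/
lemma ae_linkDistLaw [IsFiniteMeasure μ]
    (hX : IsPoissonProcess N.bs (ENNReal.ofReal p.lam • volume) μ) :
    ∀ᵐ r ∂N.linkDistLaw p μ, r ∈ Ioc 0 p.RM := by
  rw [ae_iff]
  have h := lintegral_linkDistLaw (p := p) hX
    (measurable_one.indicator (measurableSet_Ioc (a := 0) (b := p.RM)).compl)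
  rw [lintegral_indicator_one measurableSet_Ioc.compl] at h
  refine h.trans ?_
  rw [setLIntegral_congr_fun (g := fun _ => 0) measurableSet_Ioc fun r hr => by simp [hr],
    lintegral_zero]

end LinkDistance

-- Interference of the users of other cells

section UserInterference

variable {Ω : Type*} {N : Network Ω} [MeasurableSpace Ω] {μ : Measure Ω} {p : Params}

lemma isProbabilityMeasure_linkDistLaw [IsFiniteMeasure μ]
    (hX : IsPoissonProcess N.bs (ENNReal.ofReal p.lam • volume) μ) :
    IsProbabilityMeasure (N.linkDistLaw p μ) := by
  have : IsProbabilityMeasure (μ[|N.active p]) := by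
    refine cond_isProbabilityMeasure ?_
    rw [measure_active hX]
    simpa using p.activeProb_pos
  exact Measure.isProbabilityMeasure_map (N.measurable_servingDist hX.measurable).aemeasurable

/-- Laplace transform of the interference of a user of another cell at distance `u`, whose
link distance has law `D`. -/
noncomputable def ueLaplace (p : Params) (D : Measure ℝ) (s u : ℝ) : ℝ≥0∞ :=
  open Classical in
  ∫⁻ d, if p.txPower d * u ^ (-p.eta) < p.rho then
    ENNReal.ofReal (bsLaplace p.eta (s * p.txPower d) u) else 1 ∂D

lemma measurable_ueLaplace_integrand (p : Params) (s : ℝ) :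
    Measurable fun q : ℝ × ℝ => open Classical in
      if p.txPower q.2 * q.1 ^ (-p.eta) < p.rho then
        ENNReal.ofReal (bsLaplace p.eta (s * p.txPower q.2) q.1) else 1 := by
  classical
  refine Measurable.ite (measurableSet_lt (by fun_prop) measurable_const) ?_ measurable_const
  exact ENNReal.measurable_ofReal.comp ((measurable_uncurry_bsLaplace p.eta).comp
    (f := fun q : ℝ × ℝ => (s * p.txPower q.2, q.1)) (by fun_prop))

/-- Laplace transform of the aggregate interference of the users of other cells. -/
theorem lintegral_expNeg_ueLaplace [IsFiniteMeasure μ] {D : Measure ℝ} {X : ℕ → Ω → Plane}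
    (hbs : IsPoissonProcess N.bs (ENNReal.ofReal p.lam • volume) μ)
    (hD : D = N.linkDistLaw p μ)
    (hX : IsPoissonProcess X (ENNReal.ofReal p.lam • volume) μ) {s : ℝ} (hs : 0 ≤ s) :
    ∫⁻ ω, expNeg (∑' j, negLog (ueLaplace p D s ‖X j ω‖)) ∂μ =
      ENNReal.ofReal (Real.exp (-2 * Real.pi * p.lam * p.rho ^ (1 - 2 / p.eta) / (p.eta - 2) *
        p.powerMoment * s *
        hypergeom 1 (1 - 2 / p.eta) (2 - 2 / p.eta) (-(p.rho * s)))) := by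
  classical
  have hfin : IsFiniteMeasureOnCompacts (ENNReal.ofReal p.lam • (volume : Measure Plane)) :=
    IsFiniteMeasureOnCompacts.smul _ ENNReal.ofReal_ne_top
  have hDp : IsProbabilityMeasure D := hD ▸ isProbabilityMeasure_linkDistLaw hbs
  have hDae : ∀ᵐ d ∂D, d ∈ Ioc 0 p.RM := hD ▸ ae_linkDistLaw hbs
  set F := hypergeom 1 (1 - 2 / p.eta) (2 - 2 / p.eta) (-(p.rho * s)) with hF
  have hρ := p.rho_pos
  have hF0 : 0 ≤ F := hypergeom_neg_nonneg p.two_lt_eta (by positivity)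
  have he2 : 0 < p.eta - 2 := by linarith [p.two_lt_eta]
  have hl := p.lam_pos
  let G : ℝ → ℝ → ℝ≥0∞ := fun u d => if p.txPower d * u ^ (-p.eta) < p.rho then
    ENNReal.ofReal (bsLaplace p.eta (s * p.txPower d) u) else 1
  have hGm : Measurable fun q : ℝ × ℝ => G q.1 q.2 := measurable_ueLaplace_integrand p s
  have hUm : Measurable fun u => ueLaplace p D s u := hGm.lintegral_prod_right'
  have hG1 : ∀ u, 0 ≤ u → ∀ᵐ d ∂D, G u d ≤ 1 := fun u hu => by
    filter_upwards [hDae] with d hd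
    simp only [G]
    split_ifs
    · rw [ENNReal.ofReal_le_one]
      refine bsLaplace_le_one (mul_nonneg hs ?_) hu
      rw [p.txPower_of_mem hd]
      have := hd.1
      positivity
    · exact le_rfl
  have hU1 : ∀ u, 0 ≤ u → ueLaplace p D s u ≤ 1 := fun u hu =>
    (lintegral_mono_ae (hG1 u hu)).trans (by simp)
  -- Writing 1 minus the average as an average lets the integral over the plane be done first, at a
  -- fixed link distance.
  have hsub : ∀ u, 0 ≤ u → 1 - ueLaplace p D s u = ∫⁻ d, (1 - G u d) ∂D := fun u hu => by
    rw [lintegral_sub' (show AEMeasurable (G u) D from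
        (hGm.comp measurable_prodMk_left).aemeasurable)
      (ne_top_of_le_ne_top ENNReal.one_ne_top (hU1 u hu)) (hG1 u hu)]
    simp [ueLaplace, G]
  -- At link distance d the power is ρd^η and the interference condition reads d < u. The path-loss
  -- integral with R = d and a = ρs then leaves a constant times d².
  have hinner : ∀ d ∈ Ioc 0 p.RM, ∫⁻ u in Ioi (0 : ℝ),
      ENNReal.ofReal (2 * Real.pi * p.lam * u) * (1 - G u d) =
      ENNReal.ofReal (2 * Real.pi * p.lam / (p.eta - 2) * (p.rho * s) * F) *
        ENNReal.ofReal (d ^ 2) := fun d hd => by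
    have hd0 : 0 < d := hd.1
    have h1 := lintegral_Ioi_one_sub_bsLaplace hl p.two_lt_eta
      (a := p.rho * s) (by positivity) hd0
    rw [← ENNReal.ofReal_mul (by positivity)]
    refine Eq.trans ?_ (h1.trans (by congr 1; ring))
    rw [show Ioi d = Ioi d ∩ Ioi 0 by
        rw [Ioi_inter_Ioi, max_eq_left hd0.le],
      ← Measure.restrict_restrict measurableSet_Ioi, ← lintegral_indicator (measurableSet_Ioi (a := d))]
    refine setLIntegral_congr_fun measurableSet_Ioi fun u hu => ?_
    have hu : 0 < u := hu
    have hiff : p.txPower d * u ^ (-p.eta) < p.rho ↔ d < u := by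
      rw [p.txPower_of_mem hd, Real.rpow_neg hu.le, ← div_eq_mul_inv, div_lt_iff₀ (by positivity),
        mul_lt_mul_iff_right₀ hρ, Real.rpow_lt_rpow_iff hd0.le hu.le p.eta_pos]
    by_cases h : d < u
    · rw [indicator_of_mem (mem_Ioi.2 h)]
      simp only [G, hiff, h, if_true]
      rw [p.txPower_of_mem hd]
      congr 4
      ring
    · rw [indicator_of_notMem (mt mem_Ioi.1 h)]
      simp [G, hiff, h]
  have hmom : ∫⁻ d, ENNReal.ofReal (d ^ 2) ∂D =
      ENNReal.ofReal (lowerGamma 2 (Real.pi * p.lam * p.RM ^ 2) /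
        (Real.pi * p.lam * p.activeProb)) := by
    rw [hD, lintegral_linkDistLaw hbs (by fun_prop), p.lintegral_fR_mul_sq]
  have hE0 : 0 ≤ lowerGamma 2 (Real.pi * p.lam * p.RM ^ 2) /
        (Real.pi * p.lam * p.activeProb) := by
    have := p.activeProb_pos
    refine div_nonneg ?_ (by positivity)
    refine intervalIntegral.integral_nonneg (by positivity) fun t ht => ?_
    have := ht.1
    positivity
  rw [hX.lintegral_expNeg_tsum (g := fun x => negLog (ueLaplace p D s ‖x‖))
      (measurable_negLog.comp (hUm.comp measurable_norm)), lintegral_smul_measure,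
    lintegral_comp_norm_plane (f := fun u => 1 - expNeg (negLog (ueLaplace p D s u)))
      (by fun_prop), smul_eq_mul, ← lintegral_const_mul _ (by fun_prop)]
  have step : ∫⁻ u in Ioi (0 : ℝ), ENNReal.ofReal p.lam * (ENNReal.ofReal (2 * Real.pi * u) *
      (1 - expNeg (negLog (ueLaplace p D s u)))) =
      ∫⁻ u in Ioi (0 : ℝ), ∫⁻ d, ENNReal.ofReal (2 * Real.pi * p.lam * u) * (1 - G u d) ∂D := by
    refine setLIntegral_congr_fun measurableSet_Ioi fun u hu => ?_
    have hu : 0 < u := hu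
    rw [lintegral_const_mul' _ _ ENNReal.ofReal_ne_top, expNeg_negLog (hU1 u hu.le),
      hsub u hu.le, ← mul_assoc, ← ENNReal.ofReal_mul hl.le]
    congr 2
    ring
  rw [step, lintegral_lintegral_swap (by fun_prop)]
  rw [lintegral_congr_ae (hDae.mono hinner), lintegral_const_mul' _ _ ENNReal.ofReal_ne_top, hmom,
    ← ENNReal.ofReal_mul (by positivity), expNeg_ofReal (by positivity)]
  congr 2
  rw [p.powerMoment_eq]
  -- `powerMoment` carries ρ^{2/η}, so the single factor ρ has to be split.
  have hρ1 : p.rho = p.rho ^ (1 - 2 / p.eta) * p.rho ^ (2 / p.eta) := by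
    rw [← Real.rpow_add hρ]
    simp
  generalize lowerGamma 2 (Real.pi * p.lam * p.RM ^ 2) / (Real.pi * p.lam * p.activeProb) = E
  clear_value F
  calc -(2 * Real.pi * p.lam / (p.eta - 2) * (p.rho * s) * F * E)
      = -(2 * Real.pi * p.lam / (p.eta - 2) *
          ((p.rho ^ (1 - 2 / p.eta) * p.rho ^ (2 / p.eta)) * s) * F * E) := by rw [← hρ1]
    _ = _ := by ring

end UserInterference

-- The intra-cell user: averaging over direction and distance

section Angle

lemma intervalIntegrable_of_mem_Icc {f : ℝ → ℝ} (hf : Measurable f) (h0 : ∀ x, 0 ≤ f x)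
    (h1 : ∀ x, f x ≤ 1) (a b : ℝ) : IntervalIntegrable f volume a b := by
  refine (intervalIntegrable_const (c := (1 : ℝ))).mono_fun' hf.aestronglyMeasurable
    (Eventually.of_forall fun x => ?_)
  dsimp only
  rw [Real.norm_of_nonneg (h0 x)]
  exact h1 x

/-- Periodicity removes the shift ψ, evenness folds the period onto (0, π), and θ ↦ π - θ reverses
the sign of the cosine, as the form of U₁ requires. -/
lemma lintegral_uniform_cos_sub {h : ℝ → ℝ} (hm : Measurable h) (h0 : ∀ x, 0 ≤ h x)
    (h1 : ∀ x, h x ≤ 1) (ψ : ℝ) :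
    ∫⁻ θ, ENNReal.ofReal (h (Real.cos (θ - ψ))) ∂(volume[|Ioc (-Real.pi) Real.pi]) =
      ENNReal.ofReal (Real.pi⁻¹ * ∫ θ in (0 : ℝ)..Real.pi, h (-Real.cos θ)) := by
  have hpi := Real.pi_pos
  have hi : ∀ a b, IntervalIntegrable (fun θ => h (Real.cos θ)) volume a b := fun a b =>
    intervalIntegrable_of_mem_Icc (hm.comp Real.measurable_cos) (fun _ => h0 _) (fun _ => h1 _) a b
  have hper : Function.Periodic (fun θ => h (Real.cos θ)) (2 * Real.pi) := fun θ => by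
    simp only [Real.cos_add_two_pi]
  have e1 : ∫ θ in (-Real.pi)..Real.pi, h (Real.cos (θ - ψ)) =
      2 * ∫ θ in (0 : ℝ)..Real.pi, h (-Real.cos θ) := by
    rw [intervalIntegral.integral_comp_sub_right (fun θ => h (Real.cos θ)) ψ]
    have hp := hper.intervalIntegral_add_eq (-Real.pi - ψ) (-Real.pi)
    rw [show -Real.pi - ψ + 2 * Real.pi = Real.pi - ψ by ring,
      show -Real.pi + 2 * Real.pi = Real.pi by ring] at hp
    rw [hp, ← intervalIntegral.integral_add_adjacent_intervals (hi (-Real.pi) 0) (hi 0 Real.pi)]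
    have h2 := intervalIntegral.integral_comp_neg (a := 0) (b := Real.pi)
      (fun θ => h (Real.cos θ))
    have h3 := intervalIntegral.integral_comp_sub_left (a := 0) (b := Real.pi)
      (fun θ => h (Real.cos θ)) Real.pi
    simp only [Real.cos_neg, neg_zero] at h2
    simp only [Real.cos_pi_sub, sub_self, sub_zero] at h3
    rw [← h2, h3]
    ring
  have hI : IntervalIntegrable (fun θ => h (Real.cos (θ - ψ))) volume (-Real.pi) Real.pi :=
    intervalIntegrable_of_mem_Icc (by fun_prop) (fun _ => h0 _) (fun _ => h1 _) _ _
  rw [ProbabilityTheory.cond, lintegral_smul_measure, Real.volume_Ioc,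
    ← ofReal_integral_eq_lintegral_ofReal
      ((intervalIntegrable_iff_integrableOn_Ioc_of_le (by linarith)).1 hI)
      (Eventually.of_forall fun _ => h0 _),
    ← intervalIntegral.integral_of_le (by linarith), e1, smul_eq_mul,
    ← ENNReal.ofReal_inv_of_pos (by linarith), ← ENNReal.ofReal_mul (by
      rw [inv_nonneg]
      linarith)]
  congr 1
  field_simp
  ring

lemma exists_polar (x : Plane) : ∃ ψ, x = ‖x‖ • !₂[Real.cos ψ, Real.sin ψ] := by
  let z : ℂ := ⟨x 0, x 1⟩
  have hz : ‖z‖ = ‖x‖ := by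
    rw [Complex.norm_def, Complex.normSq_mk, EuclideanSpace.norm_eq]
    simp [Fin.sum_univ_two, sq]
  refine ⟨z.arg, ?_⟩
  ext i
  rw [← hz]
  fin_cases i
  · simp [z]
  · simp [z]

lemma norm_polar_add_sq (r d ψ θ : ℝ) :
    ‖r • (!₂[Real.cos ψ, Real.sin ψ] : Plane) + d • !₂[Real.cos θ, Real.sin θ]‖ ^ 2 =
      r ^ 2 + d ^ 2 + 2 * r * d * Real.cos (θ - ψ) := by
  rw [EuclideanSpace.real_norm_sq_eq]
  simp only [Fin.sum_univ_two, PiLp.add_apply, PiLp.smul_apply, smul_eq_mul, Real.cos_sub,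
    Matrix.cons_val_zero, Matrix.cons_val_one, Matrix.cons_val_fin_one]
  linear_combination r ^ 2 * Real.sin_sq_add_cos_sq ψ + d ^ 2 * Real.sin_sq_add_cos_sq θ

/-- Laplace transform of the interference of the intra-cell user, averaged over its direction. -/
lemma lintegral_cellAngle {eta s rho : ℝ} (hs : 0 ≤ s) (hrho : 0 < rho) (x : Plane)
    {d : ℝ} (hd : 0 < d) :
    ∫⁻ θ, ENNReal.ofReal
        (1 / (1 + s * (rho * d ^ eta * ‖x + d • (!₂[Real.cos θ, Real.sin θ] : Plane)‖ ^ (-eta))))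
        ∂(volume[|Ioc (-Real.pi) Real.pi]) =
      ENNReal.ofReal (∫ θ in (0 : ℝ)..Real.pi, 1 / (Real.pi + Real.pi * s * rho *
          (1 + (‖x‖ / d) ^ 2 - 2 * (‖x‖ / d) * Real.cos θ) ^ (-eta / 2))) := by
  obtain ⟨ψ, hψ⟩ := exists_polar x
  set r := ‖x‖
  let q : ℝ := r / d
  -- the maximum with zero only matters off the range of the cosine
  let h : ℝ → ℝ := fun c => 1 / (1 + s * (rho * max 0 (1 + q ^ 2 + 2 * q * c) ^ (-eta / 2)))
  have hden : ∀ c, 0 ≤ s * (rho * max 0 (1 + q ^ 2 + 2 * q * c) ^ (-eta / 2)) := fun c =>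
    mul_nonneg hs (mul_nonneg hrho.le (Real.rpow_nonneg (le_max_left _ _) _))
  have hm : Measurable h := by fun_prop
  have hbase : ∀ c, -1 ≤ c → c ≤ 1 → 0 ≤ 1 + q ^ 2 + 2 * q * c := fun c hc hc' => by
    nlinarith [sq_nonneg (q + c), sq_nonneg c]
  -- By the law of cosines, d^η ‖x + d e_θ‖^{-η} = (1 + q² + 2q cos(θ - ψ))^{-η/2}, with e_θ the
  -- unit vector at angle θ.
  have key : ∀ θ, 1 / (1 + s * (rho * d ^ eta *
      ‖x + d • (!₂[Real.cos θ, Real.sin θ] : Plane)‖ ^ (-eta))) = h (Real.cos (θ - ψ)) := fun θ => by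
    have hb := hbase _ (Real.neg_one_le_cos (θ - ψ)) (Real.cos_le_one (θ - ψ))
    simp only [h]
    rw [max_eq_right hb, mul_assoc rho]
    congr 4
    set n := ‖x + d • (!₂[Real.cos θ, Real.sin θ] : Plane)‖ with hn
    have hn2 : n ^ 2 = d ^ 2 * (1 + q ^ 2 + 2 * q * Real.cos (θ - ψ)) := by
      rw [hn, hψ, norm_polar_add_sq]
      simp only [q]
      field_simp
      ring
    have hn3 : n ^ (-eta) = (n ^ 2) ^ (-eta / 2) := by
      rw [← Real.rpow_natCast, ← Real.rpow_mul (norm_nonneg _)]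
      congr 1
      push_cast
      ring
    have hd3 : (d ^ 2) ^ (-eta / 2) = d ^ (-eta) := by
      rw [← Real.rpow_natCast, ← Real.rpow_mul hd.le]
      congr 1
      push_cast
      ring
    rw [hn3, hn2, Real.mul_rpow (by positivity) hb, hd3, ← mul_assoc, ← Real.rpow_add hd]
    simp
  simp_rw [key]
  rw [lintegral_uniform_cos_sub hm (fun c => by have := hden c; positivity)
    (fun c => div_le_one_of_le₀ (by linarith [hden c]) (by linarith [hden c])),
    ← intervalIntegral.integral_const_mul]
  congr 1
  refine intervalIntegral.integral_congr fun θ _ => ?_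
  have hb := hbase (-Real.cos θ) (by linarith [Real.cos_le_one θ]) (by linarith [Real.neg_one_le_cos θ])
  have he : 1 + q ^ 2 + 2 * q * -Real.cos θ = 1 + (r / d) ^ 2 - 2 * (r / d) * Real.cos θ := by
    simp only [q]
    ring
  simp only [h]
  rw [max_eq_right hb, he, inv_eq_one_div, div_mul_div_comm, one_mul]
  congr 1
  ring

end Angle

section U1

variable {Ω : Type*} {N : Network Ω} [MeasurableSpace Ω] {μ : Measure Ω} {p : Params}

/-- The angular average at a fixed link distance depends on the station only through ‖x‖; the
density f_R then integrates the link distance. -/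
lemma lintegral_cellUser [IsFiniteMeasure μ]
    (hbs : IsPoissonProcess N.bs (ENNReal.ofReal p.lam • volume) μ) {s : ℝ} (hs : 0 ≤ s)
    (x : Plane) :
    ∫⁻ d, ∫⁻ θ, ENNReal.ofReal (1 / (1 + s * |p.cross .dl| ^ 2 *
        (p.txPower d * ‖x + d • (!₂[Real.cos θ, Real.sin θ] : Plane)‖ ^ (-p.eta))))
        ∂(volume[|Ioc (-Real.pi) Real.pi]) ∂N.linkDistLaw p μ =
      ENNReal.ofReal (p.U1 ‖x‖ s .threeNode) := by
  have hρ := p.rho_pos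
  set s' := s * |p.cross .dl| ^ 2 with hs'
  have hs0 : 0 ≤ s' := by positivity
  let A : ℝ → ℝ → ℝ := fun d θ => 1 / (Real.pi + Real.pi * s' * p.rho *
          (1 + (‖x‖ / d) ^ 2 - 2 * (‖x‖ / d) * Real.cos θ) ^ (-p.eta / 2))
  let B : ℝ → ℝ := fun d => ∫ θ in (0 : ℝ)..Real.pi, A d θ
  have hbase : ∀ d θ, 0 ≤ 1 + (‖x‖ / d) ^ 2 - 2 * (‖x‖ / d) * Real.cos θ := fun d θ => by
    nlinarith [sq_nonneg (‖x‖ / d - Real.cos θ), Real.cos_sq_le_one θ]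
  have hA0 : ∀ d θ, 0 ≤ A d θ := fun d θ => by
    have := Real.rpow_nonneg (hbase d θ) (-p.eta / 2)
    positivity
  have hA1 : ∀ d θ, A d θ ≤ Real.pi⁻¹ := fun d θ => by
    have := Real.rpow_nonneg (hbase d θ) (-p.eta / 2)
    have hp := Real.pi_pos
    simp only [A]
    rw [← one_div]
    refine one_div_le_one_div_of_le hp ?_
    have : 0 ≤ Real.pi * s' * p.rho *
        (1 + (‖x‖ / d) ^ 2 - 2 * (‖x‖ / d) * Real.cos θ) ^ (-p.eta / 2) := by positivity
    linarith
  have hAm : Measurable fun w : ℝ × ℝ => A w.1 w.2 := by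
    simp only [A]
    fun_prop
  have hBm : StronglyMeasurable B := by
    have : B = fun d => ∫ θ in Ioc 0 Real.pi, A d θ := by
      funext d
      exact intervalIntegral.integral_of_le Real.pi_pos.le
    rw [this]
    exact hAm.stronglyMeasurable.integral_prod_right'
  have hB0 : ∀ d, 0 ≤ B d := fun d =>
    intervalIntegral.integral_nonneg Real.pi_pos.le fun θ _ => hA0 d θ
  -- This bound makes f_R · B integrable, so that the interval integral in U₁ agrees with the lower
  -- Lebesgue integral.
  have hB1 : ∀ d, B d ≤ 1 := fun d => by
    have h1 : IntervalIntegrable (A d) volume 0 Real.pi := by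
      refine (intervalIntegrable_const (c := Real.pi⁻¹)).mono_fun'
        (hAm.comp measurable_prodMk_left).aestronglyMeasurable (Eventually.of_forall fun θ => ?_)
      dsimp only
      rw [Real.norm_of_nonneg (hA0 d θ)]
      exact hA1 d θ
    have := intervalIntegral.integral_mono Real.pi_pos.le h1
      (intervalIntegrable_const (c := Real.pi⁻¹)) fun θ => hA1 d θ
    simpa using this
  have hU : p.U1 ‖x‖ s .threeNode = ∫ d in (0 : ℝ)..p.RM, p.fR d * B d := by
    simp only [Params.U1, B, A]
    refine intervalIntegral.integral_congr fun d _ => ?_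
    rw [← intervalIntegral.integral_const_mul]
    refine intervalIntegral.integral_congr fun θ _ => ?_
    rw [mul_one_div, hs', mul_assoc Real.pi s]
  have hK : Measurable fun d => ∫⁻ θ, ENNReal.ofReal (1 / (1 + s' *
        (p.txPower d * ‖x + d • (!₂[Real.cos θ, Real.sin θ] : Plane)‖ ^ (-p.eta))))
        ∂(volume[|Ioc (-Real.pi) Real.pi]) := by
    have : SFinite (volume[|Ioc (-Real.pi) Real.pi] : Measure ℝ) := by
      unfold ProbabilityTheory.cond
      infer_instance
    refine Measurable.lintegral_prod_right' (f := fun w : ℝ × ℝ => ENNReal.ofReal (1 / (1 + s' *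
        (p.txPower w.1 * ‖x + w.1 • (!₂[Real.cos w.2, Real.sin w.2] : Plane)‖ ^ (-p.eta))))) ?_
    have hv : Measurable fun w : ℝ × ℝ => (!₂[Real.cos w.2, Real.sin w.2] : Plane) := by
      refine (PiLp.continuous_toLp 2 _).measurable.comp (measurable_pi_lambda _ fun i => ?_)
      fin_cases i
      · exact Real.measurable_cos.comp measurable_snd
      · exact Real.measurable_sin.comp measurable_snd
    fun_prop
  rw [lintegral_linkDistLaw hbs hK, hU, intervalIntegral.integral_of_le p.RM_pos.le,
    ofReal_integral_eq_lintegral_ofReal]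
  · refine setLIntegral_congr_fun measurableSet_Ioc fun d hd => ?_
    rw [ENNReal.ofReal_mul (p.fR_nonneg hd.1.le), p.txPower_of_mem hd]
    congr 1
    exact lintegral_cellAngle hs0 hρ x hd.1
  · refine Integrable.mono' (p.continuous_fR.integrableOn_Ioc)
      (p.measurable_fR.aestronglyMeasurable.mul hBm.aestronglyMeasurable) ?_
    refine (ae_restrict_iff' measurableSet_Ioc).2 (Eventually.of_forall fun d hd => ?_)
    rw [Real.norm_of_nonneg (mul_nonneg (p.fR_nonneg hd.1.le) (hB0 d))]
    exact mul_le_of_le_one_right (p.fR_nonneg hd.1.le) (hB1 d)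
  · refine (ae_restrict_iff' measurableSet_Ioc).2 (Eventually.of_forall fun d hd => ?_)
    exact mul_nonneg (p.fR_nonneg hd.1.le) (hB0 d)

end U1

-- Averaging over the marks at fixed positions

section Marks

variable {Ω : Type*} {N : Network Ω} [mΩ : MeasurableSpace Ω] {μ : Measure Ω}
  {p : Params} {ν : Measure ℝ}

lemma lintegral_expNeg_gain {X : Ω → ℝ} (hX : HasLaw X (expMeasure 1) μ) {a : ℝ} (ha : 0 ≤ a) :
    ∫⁻ ω, expNeg (ENNReal.ofReal (a * X ω)) ∂μ = ENNReal.ofReal (1 / (1 + a)) := by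
  rw [hX.lintegral_comp (f := fun x => expNeg (ENNReal.ofReal (a * x)))
    (by fun_prop : Measurable _).aemeasurable]
  exact lintegral_expNeg_mul_expMeasure ha

/-- The threshold R uses only marks outside i, so it is independent of the gain; integrating the
gain first replaces the event by the exponential tail at R. -/
lemma measure_le_ofReal_gain [IsProbabilityMeasure μ] {ι : Type*} {X : ι → Ω → ℝ}
    (hXm : ∀ i, Measurable (X i)) (hX : iIndepFun X μ) {i : ι} {S : Set ι} (hi : i ∉ S)
    (hlaw : HasLaw (X i) (expMeasure 1) μ) {R : Ω → ℝ≥0∞} (hR : Measurable[markSigma X S] R)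
    {c : ℝ} (hc : 0 < c) :
    μ {ω | R ω ≤ ENNReal.ofReal (c * X i ω)} = ∫⁻ ω, expNeg (R ω / ENNReal.ofReal c) ∂μ := by
  have hRm : Measurable R := hR.mono (markSigma_le hXm S) le_rfl
  have hind : IndepFun R (X i) μ := by
    rw [IndepFun_iff_Indep]
    exact indep_of_indep_of_le (indep_markSigma hXm hX (T := {i}) (by simpa using hi))
      hR.comap_le (measurable_markSigma (mem_singleton i)).comap_le
  have hset : MeasurableSet {q : ℝ≥0∞ × ℝ | q.1 ≤ ENNReal.ofReal (c * q.2)} :=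
    measurableSet_le measurable_fst (by fun_prop)
  have hset1 : MeasurableSet {ω | R ω ≤ ENNReal.ofReal (c * X i ω)} :=
    (hRm.prodMk (hXm i)) hset
  have h := lintegral_of_indepFun hRm (hXm i) hind
    (F := fun r x => {q : ℝ≥0∞ × ℝ | q.1 ≤ ENNReal.ofReal (c * q.2)}.indicator 1 (r, x))
    (measurable_one.indicator hset)
  rw [← lintegral_indicator_one hset1]
  refine Eq.trans (lintegral_congr fun ω => ?_) (h.trans (lintegral_congr fun ω => ?_))
  · simp [indicator]
  · have hs : MeasurableSet {x : ℝ | R ω ≤ ENNReal.ofReal (c * x)} :=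
      measurableSet_le measurable_const (by fun_prop)
    rw [← expMeasure_le_ofReal hc, ← lintegral_indicator_one hs,
      hlaw.lintegral_comp (f := fun x => {q : ℝ≥0∞ × ℝ | q.1 ≤ ENNReal.ofReal (c * q.2)}.indicator 1
        (R ω, x)) ((measurable_one.indicator hset).comp measurable_prodMk_left).aemeasurable]
    refine lintegral_congr fun x => ?_
    simp [indicator]

lemma ofReal_mul_div_ofReal (T : ℝ) {c : ℝ} (hc : 0 < c) (R : ℝ≥0∞) :
    ENNReal.ofReal T * R / ENNReal.ofReal c = ENNReal.ofReal (T / c) * R := by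
  rw [ENNReal.ofReal_div_of_pos hc, ENNReal.div_eq_inv_mul, ENNReal.div_eq_inv_mul, mul_assoc]

/-- Success probability of a link with exponential gain under interference from three
independent sources. -/
lemma measure_success [IsProbabilityMeasure μ] {ι : Type*} {X : ι → Ω → ℝ}
    (hXm : ∀ i, Measurable (X i)) (hX : iIndepFun X μ) {i : ι} {S₁ S₂ S₃ : Set ι}
    (hi₁ : i ∉ S₁) (hi₂ : i ∉ S₂) (hi₃ : i ∉ S₃) (h₁₂ : Disjoint S₁ S₂) (h₁₃ : Disjoint S₁ S₃)
    (h₂₃ : Disjoint S₂ S₃) (hlaw : HasLaw (X i) (expMeasure 1) μ) {Z₁ Z₂ Z₃ : Ω → ℝ≥0∞}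
    (hZ₁ : Measurable[markSigma X S₁] Z₁) (hZ₂ : Measurable[markSigma X S₂] Z₂)
    (hZ₃ : Measurable[markSigma X S₃] Z₃) {T c n : ℝ} (hc : 0 < c) :
    μ {ω | ENNReal.ofReal T * (Z₁ ω + Z₂ ω + Z₃ ω + ENNReal.ofReal n) ≤
        ENNReal.ofReal (c * X i ω)} =
      expNeg (ENNReal.ofReal (T / c) * ENNReal.ofReal n) *
      (∫⁻ ω, expNeg (ENNReal.ofReal (T / c) * Z₁ ω) ∂μ) *
      (∫⁻ ω, expNeg (ENNReal.ofReal (T / c) * Z₂ ω) ∂μ) *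
      ∫⁻ ω, expNeg (ENNReal.ofReal (T / c) * Z₃ ω) ∂μ := by
  have m₁ := markSigma_mono X (subset_union_left (s := S₁) (t := S₂))
  have m₂ := markSigma_mono X (subset_union_right (s := S₁) (t := S₂))
  have m₁₂ := markSigma_mono X (subset_union_left (s := S₁ ∪ S₂) (t := S₃))
  have m₃ := markSigma_mono X (subset_union_right (s := S₁ ∪ S₂) (t := S₃))
  have hZ : Measurable[markSigma X (S₁ ∪ S₂ ∪ S₃)]
      fun ω => ENNReal.ofReal T * (Z₁ ω + Z₂ ω + Z₃ ω + ENNReal.ofReal n) :=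
    ((((hZ₁.mono (m₁.trans m₁₂) le_rfl).add (hZ₂.mono (m₂.trans m₁₂) le_rfl)).add
      (hZ₃.mono m₃ le_rfl)).add_const _).const_mul _
  rw [measure_le_ofReal_gain hXm hX (S := S₁ ∪ S₂ ∪ S₃) (by simp [hi₁, hi₂, hi₃]) hlaw hZ hc]
  simp_rw [ofReal_mul_div_ofReal T hc, mul_add, expNeg_add]
  have e : ∀ {S : Set ι} {Z : Ω → ℝ≥0∞}, Measurable[markSigma X S] Z →
      Measurable[markSigma X S] fun ω => expNeg (ENNReal.ofReal (T / c) * Z ω) := fun h =>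
    measurable_expNeg.comp (h.const_mul _)
  rw [lintegral_mul_const' _ _ (expNeg_ne_top _),
    lintegral_mul_markSigma hXm hX (S := S₁ ∪ S₂) (T := S₃)
      (f := fun ω => expNeg (ENNReal.ofReal (T / c) * Z₁ ω) * expNeg (ENNReal.ofReal (T / c) * Z₂ ω))
      (Set.disjoint_union_left.2 ⟨h₁₃, h₂₃⟩)
      (((e hZ₁).mono m₁ le_rfl).mul ((e hZ₂).mono m₂ le_rfl)) (e hZ₃),
    lintegral_mul_markSigma hXm hX h₁₂ (e hZ₁) (e hZ₂)]
  ring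

lemma lintegral_expNeg_bs [IsProbabilityMeasure μ] (hN : N.IsModel p ν μ) {a : ℕ → ℝ}
    (ha : ∀ j, 0 ≤ a j) :
    ∫⁻ ω, expNeg (∑' j, ENNReal.ofReal (a j * N.mark (.bsGain j) ω)) ∂μ =
      expNeg (∑' j, negLog (ENNReal.ofReal (1 / (1 + a j)))) := by
  rw [lintegral_expNeg_tsum_markSigma hN.mark_measurable hN.mark_indep
    (S := fun j => {Mark.bsGain j})
    (Z := fun j ω => ENNReal.ofReal (a j * N.mark (.bsGain j) ω))
    (fun i j hij => by simpa [Function.onFun] using hij)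
    (fun j => ENNReal.measurable_ofReal.comp
      ((measurable_markSigma (mem_singleton _)).const_mul _))]
  congr 2
  funext j
  rw [lintegral_expNeg_gain (hN.mark_law (.bsGain j)) (ha j)]

/-- The gain and the link distance of a user form a block, and distinct users have disjoint blocks.
Within a block the gain is averaged first, at fixed distance. -/
lemma lintegral_expNeg_ue [IsProbabilityMeasure μ] (hN : N.IsModel p ν μ) {s : ℝ} (hs : 0 ≤ s)
    {u : ℕ → ℝ} (hu : ∀ j, 0 ≤ u j) :
    ∫⁻ ω, expNeg (∑' j, open Classical in
      if N.uePower p j ω * u j ^ (-p.eta) < p.rho then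
        ENNReal.ofReal (s * (N.uePower p j ω * N.mark (.ueGain j) ω * u j ^ (-p.eta))) else 0) ∂μ =
      expNeg (∑' j, negLog (ueLaplace p (N.linkDistLaw p μ) s (u j))) := by
  classical
  have hm := hN.mark_measurable
  rw [lintegral_expNeg_tsum_markSigma hm hN.mark_indep
    (S := fun j => {Mark.ueGain j, Mark.ueDist j})
    (Z := fun j ω => if N.uePower p j ω * u j ^ (-p.eta) < p.rho then
        ENNReal.ofReal (s * (N.uePower p j ω * N.mark (.ueGain j) ω * u j ^ (-p.eta))) else 0)
    (fun i j hij => by simp [Function.onFun, hij.symm]) (fun j => ?_)]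
  · congr 2
    funext j
    congr 1
    let F : ℝ → ℝ → ℝ≥0∞ := fun d g => expNeg (if p.txPower d * u j ^ (-p.eta) < p.rho then
        ENNReal.ofReal (s * (p.txPower d * g * u j ^ (-p.eta))) else 0)
    have hF : Measurable fun q : ℝ × ℝ => F q.1 q.2 :=
      measurable_expNeg.comp (Measurable.ite (measurableSet_lt (by fun_prop) measurable_const)
        (by fun_prop) measurable_const)
    have h := lintegral_of_indepFun (hm (.ueDist j)) (hm (.ueGain j))
      (hN.mark_indep.indepFun (by simp)) hF
    refine h.trans ?_
    have hlaw := (hN.mark_law (.ueDist j))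
    rw [hlaw.lintegral_comp (f := fun d => ∫⁻ ω', F d (N.mark (.ueGain j) ω') ∂μ)]
    · refine lintegral_congr_ae ((ae_linkDistLaw hN.bs_poisson).mono fun d hd => ?_)
      have hd0 : 0 < d := hd.1
      have hρ := p.rho_pos
      have hP : 0 ≤ p.txPower d := by
        rw [p.txPower_of_mem hd]
        positivity
      have hR := Real.rpow_nonneg (hu j) (-p.eta)
      simp only [F]
      split_ifs
      · rw [bsLaplace, ← lintegral_expNeg_gain (hN.mark_law (.ueGain j)) (by positivity)]
        refine lintegral_congr fun ω => ?_
        congr 2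
        ring
      · simp
    · have hg : Measurable fun q : ℝ × Ω => (q.1, N.mark (.ueGain j) q.2) :=
        measurable_fst.prodMk ((hm (.ueGain j)).comp measurable_snd)
      exact (hF.comp hg).lintegral_prod_right'.aemeasurable
  · have h1 : Measurable[markSigma N.mark {Mark.ueGain j, Mark.ueDist j}] (N.uePower p j) :=
      p.measurable_txPower.comp (measurable_markSigma (by simp))
    have h2 : Measurable[markSigma N.mark {Mark.ueGain j, Mark.ueDist j}]
      (N.mark (.ueGain j)) := measurable_markSigma (by simp)
    exact Measurable.ite (measurableSet_lt (h1.mul_const _) measurable_const)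
      (ENNReal.measurable_ofReal.comp (((h1.mul h2).mul_const _).const_mul _)) measurable_const

lemma lintegral_expNeg_self [IsProbabilityMeasure ν] (hν : ∀ᵐ h ∂ν, 0 ≤ h) {X : Ω → ℝ}
    (hX : HasLaw X ν μ) {a : ℝ} (ha : 0 ≤ a) :
    ∫⁻ ω, expNeg (ENNReal.ofReal (a * X ω)) ∂μ = ENNReal.ofReal (∫ h, Real.exp (-(a * h)) ∂ν) := by
  rw [hX.lintegral_comp (f := fun x => expNeg (ENNReal.ofReal (a * x)))
    (by fun_prop : Measurable _).aemeasurable, ofReal_integral_eq_lintegral_ofReal]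
  · refine lintegral_congr_ae (hν.mono fun h hh => ?_)
    exact expNeg_ofReal (mul_nonneg ha hh)
  · refine Integrable.mono' (g := fun _ => (1 : ℝ)) (integrable_const _)
      (by fun_prop : Measurable _).aestronglyMeasurable (hν.mono fun h hh => ?_)
    rw [Real.norm_of_nonneg (Real.exp_nonneg _)]
    exact Real.exp_le_one_iff.2 (by linarith [mul_nonneg ha hh])
  · exact Eventually.of_forall fun _ => Real.exp_nonneg _

/-- Averaging the gain gives 1/(1 + A); the angle and then the link distance are integrated after
it. -/
lemma lintegral_expNeg_cell [IsProbabilityMeasure μ] (hN : N.IsModel p ν μ) {s : ℝ} (hs : 0 ≤ s)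
    (x : Plane) :
    ∫⁻ ω, expNeg (ENNReal.ofReal (s * (p.txPower (N.mark .cellDist ω) * N.mark .cellGain ω *
      ‖x + N.mark .cellDist ω •
        (!₂[Real.cos (N.mark .cellAngle ω), Real.sin (N.mark .cellAngle ω)] : Plane)‖ ^ (-p.eta) *
      |p.cross .dl| ^ 2))) ∂μ = ENNReal.ofReal (p.U1 ‖x‖ s .threeNode) := by
  have hm := hN.mark_measurable
  have hv : Measurable fun w : ℝ × ℝ => (!₂[Real.cos w.2, Real.sin w.2] : Plane) := by
    refine (PiLp.continuous_toLp 2 _).measurable.comp (measurable_pi_lambda _ fun i => ?_)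
    fin_cases i
    · exact Real.measurable_cos.comp measurable_snd
    · exact Real.measurable_sin.comp measurable_snd
  let A : ℝ × ℝ → ℝ := fun w => s * |p.cross .dl| ^ 2 *
    (p.txPower w.1 * ‖x + w.1 • (!₂[Real.cos w.2, Real.sin w.2] : Plane)‖ ^ (-p.eta))
  have hA : Measurable A := by fun_prop
  have h1 := lintegral_of_indepFun ((hm .cellDist).prodMk (hm .cellAngle)) (hm .cellGain)
    (hN.mark_indep.indepFun_prodMk hm .cellDist .cellAngle .cellGain (by simp) (by simp))
    (F := fun w g => expNeg (ENNReal.ofReal (A w * g))) (by fun_prop)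
  have h2 := lintegral_of_indepFun (hm .cellDist) (hm .cellAngle)
    (hN.mark_indep.indepFun (by simp))
    (F := fun d θ => ENNReal.ofReal (1 / (1 + A (d, θ)))) (by fun_prop)
  have hlaw := hN.mark_law .cellDist
  have hae : ∀ᵐ ω ∂μ, N.mark .cellDist ω ∈ Ioc 0 p.RM :=
    (ae_map_iff (hm .cellDist).aemeasurable measurableSet_Ioc).1
      (by rw [hlaw.map_eq]; exact ae_linkDistLaw hN.bs_poisson)
  rw [← lintegral_cellUser hN.bs_poisson hs x]
  calc _ = ∫⁻ ω, expNeg (ENNReal.ofReal (A (N.mark .cellDist ω, N.mark .cellAngle ω) *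
        N.mark .cellGain ω)) ∂μ := by
        refine lintegral_congr fun ω => ?_
        congr 2
        simp only [A]
        ring
    _ = ∫⁻ ω, ENNReal.ofReal (1 / (1 + A (N.mark .cellDist ω, N.mark .cellAngle ω))) ∂μ := by
        refine h1.trans (lintegral_congr_ae (hae.mono fun ω hω => ?_))
        refine lintegral_expNeg_gain (hN.mark_law .cellGain) ?_
        have h0 : 0 < N.mark .cellDist ω := hω.1
        have hρ := p.rho_pos
        simp only [A]
        rw [p.txPower_of_mem hω]
        positivity
    _ = _ := by
        have hsf : SFinite (volume[|Ioc (-Real.pi) Real.pi] : Measure ℝ) := by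
          unfold ProbabilityTheory.cond
          infer_instance
        have hang : ∀ d, ∫⁻ ω', ENNReal.ofReal (1 / (1 + A (d, N.mark .cellAngle ω'))) ∂μ =
            ∫⁻ θ, ENNReal.ofReal (1 / (1 + A (d, θ))) ∂(volume[|Ioc (-Real.pi) Real.pi]) :=
          fun d => (hN.mark_law .cellAngle).lintegral_comp
            (f := fun θ => ENNReal.ofReal (1 / (1 + A (d, θ))))
            (by fun_prop : Measurable _).aemeasurable
        refine h2.trans ?_
        simp_rw [hang]
        exact hlaw.lintegral_comp (f := fun d => ∫⁻ θ, ENNReal.ofReal (1 / (1 + A (d, θ)))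
          ∂(volume[|Ioc (-Real.pi) Real.pi])) (Measurable.lintegral_prod_right'
          (f := fun w : ℝ × ℝ => ENNReal.ofReal (1 / (1 + A w))) (by fun_prop)).aemeasurable

end Marks

-- Success probabilities given the positions

section Frozen

lemma measurable_ennreal_tsum {α : Type*} {m : MeasurableSpace α} {f : ℕ → α → ℝ≥0∞}
    (h : ∀ j, Measurable (f j)) : Measurable fun a => ∑' j, f j a :=
  Measurable.tsum h

/-- Interference of the intra-cell user with distance, gain and angle `w`, seen from a base
station at `x`. -/
noncomputable def cellInterference (p : Params) (x : Plane) (w : ℝ × ℝ × ℝ) : ℝ≥0∞ :=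
  ENNReal.ofReal (p.txPower w.1 * w.2.1 *
    ‖x + w.1 • (!₂[Real.cos w.2.2, Real.sin w.2.2] : Plane)‖ ^ (-p.eta) * |p.cross .dl| ^ 2)

lemma measurable_cellInterference (p : Params) (x : Plane) : Measurable (cellInterference p x) := by
  have hv : Measurable fun w : ℝ × ℝ × ℝ => (!₂[Real.cos w.2.2, Real.sin w.2.2] : Plane) := by
    refine (PiLp.continuous_toLp 2 _).measurable.comp (measurable_pi_lambda _ fun i => ?_)
    fin_cases i
    · exact Real.measurable_cos.comp (measurable_snd.comp measurable_snd)
    · exact Real.measurable_sin.comp (measurable_snd.comp measurable_snd)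
  unfold cellInterference
  fun_prop

variable {Ω : Type*} {N : Network Ω} [mΩ : MeasurableSpace Ω] {μ : Measure Ω}
  {p : Params} {ν : Measure ℝ}

/-- The SINR threshold of a rate `Rd`. -/
noncomputable def sinrThreshold (p : Params) (v : Link) (Rd : ℝ) : ℝ := 2 ^ (Rd / p.band v) - 1

lemma sinrThreshold_nonneg (p : Params) (v : Link) {Rd : ℝ} (hRd : 0 ≤ Rd) :
    0 ≤ sinrThreshold p v Rd :=
  sub_nonneg.2 (Real.one_le_rpow one_le_two (div_nonneg hRd (p.band_pos v).le))

lemma Params.noise_pos (p : Params) (v : Link) : 0 < p.noise v := by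
  have h1 := p.No_pos
  have h2 := p.intra_pos v
  unfold Params.noise
  positivity

/-- Positive noise keeps the denominator nonzero and hence the ratio finite, so `toReal` loses
nothing. The equivalence includes I = ∞, where the ratio is 0. -/
lemma not_rate_lt_iff (p : Params) (v : Link) (Rd : ℝ) {A I : ℝ≥0∞} (hA : A ≠ ⊤) :
    ¬ p.band v * Real.logb 2 (1 + (A / (I + ENNReal.ofReal (p.noise v))).toReal) < Rd ↔
      ENNReal.ofReal (sinrThreshold p v Rd) * (I + ENNReal.ofReal (p.noise v)) ≤ A := by
  have hn : I + ENNReal.ofReal (p.noise v) ≠ 0 := by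
    simp [p.noise_pos v]
  have hq : A / (I + ENNReal.ofReal (p.noise v)) ≠ ⊤ := (ENNReal.div_lt_top hA hn).ne
  rw [← ENNReal.le_div_iff_mul_le (Or.inl hn) (Or.inr hA), ENNReal.ofReal_le_iff_le_toReal hq,
    not_lt, ← div_le_iff₀' (p.band_pos v), sinrThreshold, Real.le_logb_iff_rpow_le one_lt_two
      (by positivity), sub_le_iff_le_add']

/-- The network with the positions replaced by deterministic ones. -/
def Network.freeze (N : Network Ω) (x y : ℕ → Plane) : Network Ω :=
  ⟨fun j _ => x j, fun j _ => y j, N.mark⟩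

/-- Index of the point of the family `x` nearest to the origin. -/
noncomputable def nearest (x : ℕ → Plane) : ℕ := sInf {j : ℕ | ∀ k, ‖x j‖ ≤ ‖x k‖}

variable [IsProbabilityMeasure μ] [IsProbabilityMeasure ν]

omit [IsProbabilityMeasure ν] in
lemma lintegral_expNeg_freeze_ueInterference (hN : N.IsModel p ν μ) (x y : ℕ → Plane) {s : ℝ}
    (hs : 0 ≤ s) (c : ℝ) :
    ∫⁻ ω, expNeg (ENNReal.ofReal s * (N.freeze x y).ueInterference p c ω) ∂μ =
      expNeg (∑' j, negLog (ueLaplace p (N.linkDistLaw p μ) (s * |c| ^ 2) ‖y j‖)) := by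
  rw [← lintegral_expNeg_ue hN (by positivity) (fun j => norm_nonneg (y j))]
  refine lintegral_congr fun ω => ?_
  rw [Network.ueInterference, ← ENNReal.tsum_mul_left]
  congr 2
  funext j
  rw [mul_ite, mul_zero, ← ENNReal.ofReal_mul hs]
  refine if_congr Iff.rfl ?_ rfl
  congr 1
  simp only [Network.freeze, Network.uePower]
  ring

omit mΩ in
lemma measurable_freeze_ueInterference (N : Network Ω) (p : Params) (x y : ℕ → Plane) (c : ℝ)
    {S : Set Mark} (hS : ∀ j, Mark.ueGain j ∈ S ∧ Mark.ueDist j ∈ S) :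
    Measurable[markSigma N.mark S] ((N.freeze x y).ueInterference p c) := by
  refine measurable_ennreal_tsum fun j => ?_
  have h1 : Measurable[markSigma N.mark S] ((N.freeze x y).uePower p j) :=
    p.measurable_txPower.comp (measurable_markSigma (hS j).2)
  have h2 : Measurable[markSigma N.mark S] (N.mark (.ueGain j)) := measurable_markSigma (hS j).1
  have h3 : Measurable[markSigma N.mark S] fun ω => ENNReal.ofReal ((N.freeze x y).uePower p j ω *
      N.mark (.ueGain j) ω * ‖y j‖ ^ (-p.eta) * |c| ^ 2) :=
    ENNReal.measurable_ofReal.comp (((h1.mul h2).mul_const _).mul_const _)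
  exact Measurable.ite (measurableSet_lt (h1.mul_const (‖y j‖ ^ (-p.eta))) measurable_const) h3 measurable_const

/-- Success probability of the uplink given the positions. -/
lemma measure_ul_success_freeze (hN : N.IsModel p ν μ) (hν : ∀ᵐ h ∂ν, 0 ≤ h) (x y : ℕ → Plane)
    {T s : ℝ} (hT : 0 ≤ T) (hs : s = T / (p.rho * |p.intra .ul| ^ 2)) :
    μ {ω | ENNReal.ofReal T * ((N.freeze x y).ulInterference p ω + ENNReal.ofReal (p.noise .ul)) ≤
        ENNReal.ofReal (p.txPower (N.mark .ulDist ω) * N.mark .ulDist ω ^ (-p.eta) *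
          N.mark .ulGain ω * |p.intra .ul| ^ 2)} =
      expNeg (ENNReal.ofReal s * ENNReal.ofReal (p.noise .ul)) *
        expNeg (∑' j, negLog (ueLaplace p (N.linkDistLaw p μ) (s * |p.intra .ul| ^ 2) ‖y j‖)) *
        expNeg (∑' j, negLog (ENNReal.ofReal
          (bsLaplace p.eta (s * |p.cross .ul| ^ 2 * p.Pd) ‖x j‖))) *
        ENNReal.ofReal (p.U3 ν s) := by
  have hm := hN.mark_measurable
  have hρ := p.rho_pos
  have hI := p.intra_pos .ul
  have hPd := p.Pd_pos
  have hβ := p.beta_nonneg .ul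
  have hs0 : 0 ≤ s := by rw [hs]; positivity
  have hae : ∀ᵐ ω ∂μ, N.mark .ulDist ω ∈ Ioc 0 p.RM :=
    (ae_map_iff (hm .ulDist).aemeasurable measurableSet_Ioc).1
      (by rw [(hN.mark_law .ulDist).map_eq]; exact ae_linkDistLaw hN.bs_poisson)
  -- The three interference sources use disjoint groups of marks, none of which contains the desired
  -- gain.
  let S₁ : Set Mark := {i | ∃ j, i = .ueGain j ∨ i = .ueDist j}
  let S₂ : Set Mark := {i | ∃ j, i = .bsGain j}
  let S₃ : Set Mark := {.selfGain}
  let Z₂ : Ω → ℝ≥0∞ := fun ω => ∑' j, ENNReal.ofReal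
      (p.Pd * N.mark (.bsGain j) ω * ‖x j‖ ^ (-p.eta) * |p.cross .ul| ^ 2)
  let Z₃ : Ω → ℝ≥0∞ := fun ω =>
    ENNReal.ofReal (p.beta .ul * N.mark .selfGain ω * p.Pd * |p.cross .ul| ^ 2)
  have hZ₁ : Measurable[markSigma N.mark S₁] ((N.freeze x y).ueInterference p (p.intra .ul)) :=
    measurable_freeze_ueInterference N p x y _ fun j => ⟨⟨j, Or.inl rfl⟩, ⟨j, Or.inr rfl⟩⟩
  have hZ₂ : Measurable[markSigma N.mark S₂] Z₂ := by
    refine measurable_ennreal_tsum fun j => ?_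
    have h2 : Measurable[markSigma N.mark S₂] (N.mark (.bsGain j)) :=
      measurable_markSigma ⟨j, rfl⟩
    exact ENNReal.measurable_ofReal.comp (((h2.const_mul _).mul_const _).mul_const _)
  have hZ₃ : Measurable[markSigma N.mark S₃] Z₃ := by
    have h2 : Measurable[markSigma N.mark S₃] (N.mark .selfGain) :=
      measurable_markSigma (mem_singleton _)
    exact ENNReal.measurable_ofReal.comp (((h2.const_mul _).mul_const _).mul_const _)
  have key := measure_success hm hN.mark_indep (i := .ulGain) (S₁ := S₁) (S₂ := S₂) (S₃ := S₃)
    (by rintro ⟨j, h | h⟩ <;> cases h) (by rintro ⟨j, h⟩; cases h) (by intro h; cases h)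
    (Set.disjoint_left.2 (by rintro i ⟨j, rfl | rfl⟩ ⟨k, h⟩ <;> cases h))
    (Set.disjoint_left.2 (by rintro i ⟨j, rfl | rfl⟩ h <;> cases h))
    (Set.disjoint_left.2 (by rintro i ⟨j, rfl⟩ h; cases h))
    (hN.mark_law .ulGain) hZ₁ hZ₂ hZ₃ (T := T) (c := p.rho * |p.intra .ul| ^ 2) (n := p.noise .ul)
    (by positivity)
  rw [← hs, lintegral_expNeg_freeze_ueInterference hN x y hs0] at key
  have e₂ : ∫⁻ ω, expNeg (ENNReal.ofReal s * Z₂ ω) ∂μ = expNeg (∑' j, negLog (ENNReal.ofReal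
      (bsLaplace p.eta (s * |p.cross .ul| ^ 2 * p.Pd) ‖x j‖))) := by
    refine Eq.trans (lintegral_congr fun ω => ?_) (lintegral_expNeg_bs hN
      (a := fun j => s * |p.cross .ul| ^ 2 * p.Pd * ‖x j‖ ^ (-p.eta)) fun j => by positivity)
    simp only [Z₂]
    rw [← ENNReal.tsum_mul_left]
    congr 2
    funext j
    rw [← ENNReal.ofReal_mul hs0]
    congr 1
    ring
  have e₃ : ∫⁻ ω, expNeg (ENNReal.ofReal s * Z₃ ω) ∂μ = ENNReal.ofReal (p.U3 ν s) := by
    have h := lintegral_expNeg_self hν (hN.mark_law .selfGain)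
      (a := p.beta .ul * s * p.Pd * |p.cross .ul| ^ 2) (by positivity)
    refine Eq.trans (lintegral_congr fun ω => ?_) (h.trans ?_)
    · simp only [Z₃]
      rw [← ENNReal.ofReal_mul hs0]
      congr 2
      ring
    · unfold Params.U3
      congr 2
      funext h
      congr 2
      ring
  rw [e₂, e₃] at key
  rw [← key]
  refine measure_congr (eventuallyEq_set.2 (hae.mono fun ω hω => ?_))
  have hd : 0 < N.mark .ulDist ω := hω.1
  -- Power control cancels the path loss of the desired link, whose mean received power is ρ at any
  -- distance.
  have h1 : p.txPower (N.mark .ulDist ω) * N.mark .ulDist ω ^ (-p.eta) * N.mark .ulGain ω *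
      |p.intra .ul| ^ 2 = p.rho * |p.intra .ul| ^ 2 * N.mark .ulGain ω := by
    rw [p.txPower_of_mem hω, Real.rpow_neg hd.le]
    have : N.mark .ulDist ω ^ p.eta ≠ 0 := (Real.rpow_pos_of_pos hd _).ne'
    field_simp
  rw [mem_ofPred, mem_ofPred, h1]
  rfl

/-- Success probability of the downlink given the positions. -/
lemma measure_dl_success_freeze (hN : N.IsModel p ν μ) (hν : ∀ᵐ h ∂ν, 0 ≤ h) (m : Mode)
    (x y : ℕ → Plane) {T r s : ℝ} (hT : 0 ≤ T) (hr : r = ‖x (nearest x)‖) (hrm : r ∈ Ioc 0 p.RM)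
    (hs : s = T / (p.Pd * r ^ (-p.eta) * |p.intra .dl| ^ 2)) :
    μ {ω | ENNReal.ofReal T *
          ((N.freeze x y).dlInterference p m ω + ENNReal.ofReal (p.noise .dl)) ≤
        ENNReal.ofReal (p.Pd * r ^ (-p.eta) * N.mark (.bsGain (nearest x)) ω *
          |p.intra .dl| ^ 2)} =
      expNeg (ENNReal.ofReal s * ENNReal.ofReal (p.noise .dl)) *
        expNeg (∑' j, if j = nearest x then 0 else negLog (ENNReal.ofReal
          (bsLaplace p.eta (T * r ^ p.eta) ‖x j‖))) *
        expNeg (∑' j, negLog (ueLaplace p (N.linkDistLaw p μ) (s * |p.cross .dl| ^ 2) ‖y j‖)) *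
        ENNReal.ofReal (p.U1 r s m * p.U2 ν r s m) := by
  have hm := hN.mark_measurable
  have hρ := p.rho_pos
  have hI := p.intra_pos .dl
  have hPd := p.Pd_pos
  have hβ := p.beta_nonneg .dl
  have hr0 : 0 < r := hrm.1
  have hs0 : 0 ≤ s := by rw [hs]; positivity
  -- The argument s absorbs the station power and the filtering factor, so the station terms depend
  -- on T and r alone.
  have hsT : s * p.Pd * |p.intra .dl| ^ 2 = T * r ^ p.eta := by
    rw [hs, Real.rpow_neg hr0.le]
    field_simp
  set k := nearest x with hk
  -- The gain of the serving station is the desired one and must stay out of the interfering groups.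
  let S₁ : Set Mark := {i | ∃ j, j ≠ k ∧ i = .bsGain j}
  let S₂ : Set Mark := {i | ∃ j, i = .ueGain j ∨ i = .ueDist j}
  let S₃ : Set Mark := {.selfGain, .cellDist, .cellAngle, .cellGain}
  let Z₁ : Ω → ℝ≥0∞ := fun ω => ∑' j, if j = k then 0 else ENNReal.ofReal
      (p.Pd * N.mark (.bsGain j) ω * ‖x j‖ ^ (-p.eta) * |p.intra .dl| ^ 2)
  let Z₃ : Ω → ℝ≥0∞ := fun ω => match m with
    | .twoNode => ENNReal.ofReal
        (p.beta .dl * N.mark .selfGain ω * p.txPower r * |p.cross .dl| ^ 2)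
    | .threeNode => cellInterference p (x k)
        (N.mark .cellDist ω, N.mark .cellGain ω, N.mark .cellAngle ω)
  have hZ₁ : Measurable[markSigma N.mark S₁] Z₁ := by
    refine measurable_ennreal_tsum fun j => ?_
    by_cases hj : j = k
    · simp only [hj, if_true]
      exact measurable_const
    · simp only [hj, if_false]
      have h2 : Measurable[markSigma N.mark S₁] (N.mark (.bsGain j)) :=
        measurable_markSigma ⟨j, hj, rfl⟩
      exact ENNReal.measurable_ofReal.comp (((h2.const_mul _).mul_const _).mul_const _)
  have hZ₂ : Measurable[markSigma N.mark S₂] ((N.freeze x y).ueInterference p (p.cross .dl)) :=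
    measurable_freeze_ueInterference N p x y _ fun j => ⟨⟨j, Or.inl rfl⟩, ⟨j, Or.inr rfl⟩⟩
  have hZ₃ : Measurable[markSigma N.mark S₃] Z₃ := by
    cases m with
    | twoNode =>
      have h2 : Measurable[markSigma N.mark S₃] (N.mark .selfGain) :=
        measurable_markSigma (by simp [S₃])
      exact ENNReal.measurable_ofReal.comp (((h2.const_mul _).mul_const _).mul_const _)
    | threeNode =>
      have h2 : Measurable[markSigma N.mark S₃] (N.mark .cellDist) :=
        measurable_markSigma (by simp [S₃])
      have h3 : Measurable[markSigma N.mark S₃] (N.mark .cellGain) :=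
        measurable_markSigma (by simp [S₃])
      have h4 : Measurable[markSigma N.mark S₃] (N.mark .cellAngle) :=
        measurable_markSigma (by simp [S₃])
      exact (measurable_cellInterference p (x k)).comp (h2.prodMk (h3.prodMk h4))
  have key := measure_success hm hN.mark_indep (i := .bsGain k) (S₁ := S₁) (S₂ := S₂) (S₃ := S₃)
    (by rintro ⟨j, h1, h⟩; cases h; exact h1 rfl) (by rintro ⟨j, h | h⟩ <;> cases h)
    (by simp [S₃])
    (Set.disjoint_left.2 (by rintro i ⟨j, _, rfl⟩ ⟨l, h | h⟩ <;> cases h))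
    (Set.disjoint_left.2 (by rintro i ⟨j, _, rfl⟩ h; simp [S₃] at h))
    (Set.disjoint_left.2 (by rintro i ⟨j, rfl | rfl⟩ h <;> simp [S₃] at h))
    (hN.mark_law (.bsGain k)) hZ₁ hZ₂ hZ₃ (T := T)
    (c := p.Pd * r ^ (-p.eta) * |p.intra .dl| ^ 2) (n := p.noise .dl) (by positivity)
  rw [← hs, lintegral_expNeg_freeze_ueInterference hN x y hs0] at key
  have e₁ : ∫⁻ ω, expNeg (ENNReal.ofReal s * Z₁ ω) ∂μ =
      expNeg (∑' j, if j = k then 0 else negLog (ENNReal.ofReal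
        (bsLaplace p.eta (T * r ^ p.eta) ‖x j‖))) := by
    -- A zero coefficient at the serving index gives the factor 1, that is, no cost.
    have h := lintegral_expNeg_bs hN
      (a := fun j => if j = k then 0 else T * r ^ p.eta * ‖x j‖ ^ (-p.eta)) fun j => by positivity
    refine Eq.trans (lintegral_congr fun ω => ?_) (h.trans ?_)
    · simp only [Z₁]
      rw [← ENNReal.tsum_mul_left]
      congr 2
      funext j
      split_ifs
      · simp
      · rw [← ENNReal.ofReal_mul hs0, ← hsT]
        congr 1
        ring
    · congr 2
      funext j
      split_ifs
      · simp [negLog]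
      · rfl
  have e₃ : ∫⁻ ω, expNeg (ENNReal.ofReal s * Z₃ ω) ∂μ =
      ENNReal.ofReal (p.U1 r s m * p.U2 ν r s m) := by
    cases m with
    | twoNode =>
      have h := lintegral_expNeg_self hν (hN.mark_law .selfGain)
        (a := p.beta .dl * s * p.rho * r ^ p.eta * |p.cross .dl| ^ 2) (by positivity)
      refine Eq.trans (lintegral_congr fun ω => ?_) (h.trans ?_)
      · simp only [Z₃]
        rw [← ENNReal.ofReal_mul hs0, p.txPower_of_mem hrm]
        congr 2
        ring
      · simp only [Params.U1, Params.U2, one_mul]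
        congr 2
        funext h
        congr 2
        ring
    | threeNode =>
      simp only [Params.U2, mul_one]
      rw [hr, ← lintegral_expNeg_cell hN hs0]
      refine lintegral_congr fun ω => ?_
      simp only [Z₃, cellInterference]
      rw [← ENNReal.ofReal_mul hs0]
  rw [e₁, e₃] at key
  rw [← key]
  congr 1
  ext ω
  have h1 : p.Pd * r ^ (-p.eta) * N.mark (.bsGain k) ω * |p.intra .dl| ^ 2 =
      p.Pd * r ^ (-p.eta) * |p.intra .dl| ^ 2 * N.mark (.bsGain k) ω := by ring
  have h2 : (N.freeze x y).dlInterference p m ω =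
      Z₁ ω + (N.freeze x y).ueInterference p (p.cross .dl) ω + Z₃ ω := by
    cases m
    · have h3 : (N.freeze x y).servingDist ω = r := hr.symm
      simp only [Z₃]
      rw [← h3]
      rfl
    · rfl
  rw [mem_ofPred, mem_ofPred, h1, h2]

end Frozen

-- Measurability of the SINR and conditioning on the positions

section Measurability

variable {Ω : Type*} {N : Network Ω} [MeasurableSpace Ω]

namespace Network

lemma measurable_ueInterference (p : Params) (c : ℝ) (hue : ∀ j, Measurable (N.ue j))
    (hm : ∀ i, Measurable (N.mark i)) : Measurable (N.ueInterference p c) := by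
  refine measurable_ennreal_tsum fun j => ?_
  have h1 : Measurable (N.uePower p j) := p.measurable_txPower.comp (hm _)
  have h2 : Measurable fun ω => ‖N.ue j ω‖ ^ (-p.eta) := (hue j).norm.pow_const _
  exact Measurable.ite (measurableSet_lt (h1.mul h2) measurable_const)
    (ENNReal.measurable_ofReal.comp (((h1.mul (hm _)).mul h2).mul_const _)) measurable_const

lemma measurable_cellUser (hbs : ∀ j, Measurable (N.bs j)) (hm : ∀ i, Measurable (N.mark i)) :
    Measurable N.cellUser := by
  have hv : Measurable fun θ : ℝ => (!₂[Real.cos θ, Real.sin θ] : Plane) := by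
    refine (PiLp.continuous_toLp 2 _).measurable.comp (measurable_pi_lambda _ fun i => ?_)
    fin_cases i
    · exact Real.measurable_cos
    · exact Real.measurable_sin
  exact (measurable_comp_serving hbs hbs).add ((hm .cellDist).smul (hv.comp (hm .cellAngle)))

lemma measurable_dlInterference (p : Params) (m : Mode) (hbs : ∀ j, Measurable (N.bs j))
    (hue : ∀ j, Measurable (N.ue j)) (hm : ∀ i, Measurable (N.mark i)) :
    Measurable (N.dlInterference p m) := by
  refine ((measurable_tsum_ite_serving hbs fun j => ENNReal.measurable_ofReal.comp
    ((((hm _).const_mul _).mul ((hbs j).norm.pow_const _)).mul_const _)).add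
    (measurable_ueInterference p _ hue hm)).add ?_
  cases m with
  | twoNode =>
    exact ENNReal.measurable_ofReal.comp ((((hm _).const_mul _).mul
      (p.measurable_txPower.comp (measurable_servingDist hbs))).mul_const _)
  | threeNode =>
    exact ENNReal.measurable_ofReal.comp ((((p.measurable_txPower.comp (hm _)).mul (hm _)).mul
      ((measurable_cellUser hbs hm).norm.pow_const _)).mul_const _)

lemma measurable_ulInterference (p : Params) (hbs : ∀ j, Measurable (N.bs j))
    (hue : ∀ j, Measurable (N.ue j)) (hm : ∀ i, Measurable (N.mark i)) :
    Measurable (N.ulInterference p) := by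
  refine ((measurable_ueInterference p _ hue hm).add (measurable_ennreal_tsum fun j =>
    ENNReal.measurable_ofReal.comp
      ((((hm _).const_mul _).mul ((hbs j).norm.pow_const _)).mul_const _))).add ?_
  exact ENNReal.measurable_ofReal.comp ((((hm _).const_mul _).mul_const _).mul_const _)

lemma measurable_dlSINR (p : Params) (m : Mode) (hbs : ∀ j, Measurable (N.bs j))
    (hue : ∀ j, Measurable (N.ue j)) (hm : ∀ i, Measurable (N.mark i)) :
    Measurable (N.dlSINR p m) := by
  have h1 : Measurable fun ω => N.mark (.bsGain (N.serving ω)) ω :=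
    measurable_comp_serving (f := fun j => N.mark (.bsGain j)) hbs fun j => hm _
  exact ((ENNReal.measurable_ofReal.comp (((((measurable_servingDist hbs).pow_const _).const_mul
    _).mul h1).mul_const _)).div ((measurable_dlInterference p m hbs hue hm).add_const _)).ennreal_toReal

lemma measurable_ulSINR (p : Params) (hbs : ∀ j, Measurable (N.bs j))
    (hue : ∀ j, Measurable (N.ue j)) (hm : ∀ i, Measurable (N.mark i)) :
    Measurable (N.ulSINR p) :=
  ((ENNReal.measurable_ofReal.comp ((((p.measurable_txPower.comp (hm _)).mul
    ((hm _).pow_const _)).mul (hm _)).mul_const _)).div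
      ((measurable_ulInterference p hbs hue hm).add_const _)).ennreal_toReal

/-- The network as a function of its positions and marks. -/
def canonical : Network (((ℕ → Plane) × (ℕ → Plane)) × (Mark → ℝ)) :=
  ⟨fun j q => q.1.1 j, fun j q => q.1.2 j, fun i q => q.2 i⟩

lemma measurable_canonical_bs (j : ℕ) : Measurable (canonical.bs j) := by
  unfold canonical
  fun_prop

lemma measurable_canonical_ue (j : ℕ) : Measurable (canonical.ue j) := by
  unfold canonical
  fun_prop

lemma measurable_canonical_mark (i : Mark) : Measurable (canonical.mark i) := by
  unfold canonical
  fun_prop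

end Network

lemma measurable_rate (B : ℝ) {f : Ω → ℝ} (hf : Measurable f) :
    Measurable fun ω => B * Real.logb 2 (1 + f ω) :=
  ((Real.measurable_log.comp (hf.const_add 1)).div_const (Real.log 2)).const_mul B

lemma measurable_uncurry_ueLaplace (p : Params) (D : Measure ℝ) [SFinite D] :
    Measurable fun q : ℝ × ℝ => ueLaplace p D q.1 q.2 := by
  classical
  have h : Measurable fun w : (ℝ × ℝ) × ℝ => if p.txPower w.2 * w.1.2 ^ (-p.eta) < p.rho then
      ENNReal.ofReal (bsLaplace p.eta (w.1.1 * p.txPower w.2) w.1.2) else 1 := by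
    refine Measurable.ite (measurableSet_lt (by fun_prop) measurable_const) ?_ measurable_const
    exact ENNReal.measurable_ofReal.comp ((measurable_uncurry_bsLaplace p.eta).comp
      (f := fun w : (ℝ × ℝ) × ℝ => (w.1.1 * p.txPower w.2, w.1.2)) (by fun_prop))
  exact h.lintegral_prod_right'

/-- Conditioning on the positions. -/
lemma measure_eq_lintegral_freeze {μ : Measure Ω} [IsProbabilityMeasure μ] {p : Params}
    {ν : Measure ℝ} (hN : N.IsModel p ν μ)
    {B : Set (((ℕ → Plane) × (ℕ → Plane)) × (Mark → ℝ))} (hB : MeasurableSet B) :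
    μ {ω | ((fun j => N.bs j ω, fun j => N.ue j ω), fun i => N.mark i ω) ∈ B} =
      ∫⁻ ω, μ {ω' | ((fun j => N.bs j ω, fun j => N.ue j ω), fun i => N.mark i ω') ∈ B} ∂μ := by
  have hP : Measurable fun ω => (fun j => N.bs j ω, fun j => N.ue j ω) :=
    (measurable_pi_lambda _ hN.bs_poisson.measurable).prodMk
      (measurable_pi_lambda _ hN.ue_poisson.measurable)
  have hM : Measurable fun ω i => N.mark i ω := measurable_pi_lambda _ hN.mark_measurable
  have h := lintegral_of_indepFun hP hM hN.pos_indep_mark (F := fun q z => B.indicator 1 (q, z))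
    (measurable_one.indicator hB)
  have h1 : MeasurableSet
      {ω | ((fun j => N.bs j ω, fun j => N.ue j ω), fun i => N.mark i ω) ∈ B} := (hP.prodMk hM) hB
  have h2 : ∀ ω, MeasurableSet
      {ω' | ((fun j => N.bs j ω, fun j => N.ue j ω), fun i => N.mark i ω') ∈ B} := fun ω =>
    (measurable_const.prodMk hM) hB
  exact (lintegral_indicator_one h1).symm.trans
    (h.trans (lintegral_congr fun ω => lintegral_indicator_one (h2 ω)))

end Measurability

-- The uplink success probability

section Uplink

variable {Ω : Type*} {N : Network Ω} [MeasurableSpace Ω] {μ : Measure Ω} [IsProbabilityMeasure μ]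
  {p : Params} {ν : Measure ℝ} [IsProbabilityMeasure ν]

/-- No station is excluded in the uplink, so the Poisson functional runs over the whole plane and
yields the cosecant. -/
lemma lintegral_expNeg_tsum_bsLaplace (hX : IsPoissonProcess N.bs (ENNReal.ofReal p.lam • volume) μ)
    {K : ℝ} (hK : 0 ≤ K) :
    ∫⁻ ω, expNeg (∑' j, negLog (ENNReal.ofReal (bsLaplace p.eta K ‖N.bs j ω‖))) ∂μ =
      ENNReal.ofReal (Real.exp (-(2 * Real.pi ^ 2 * p.lam / p.eta) * K ^ (2 / p.eta) *
        (1 / Real.sin (2 * Real.pi / p.eta)))) := by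
  have hl := p.lam_pos
  have he := p.eta_pos
  have h2 := p.two_lt_eta
  have hfin : IsFiniteMeasureOnCompacts (ENNReal.ofReal p.lam • (volume : Measure Plane)) :=
    IsFiniteMeasureOnCompacts.smul _ ENNReal.ofReal_ne_top
  have hsin : 0 ≤ Real.sin (2 * Real.pi / p.eta) := by
    refine Real.sin_nonneg_of_nonneg_of_le_pi (by positivity) ?_
    rw [div_le_iff₀ he]
    nlinarith [Real.pi_pos]
  have hg : Measurable fun x : Plane => negLog (ENNReal.ofReal (bsLaplace p.eta K ‖x‖)) :=
    measurable_negLog.comp (ENNReal.measurable_ofReal.comp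
      ((measurable_bsLaplace p.eta K).comp measurable_norm))
  rw [hX.lintegral_expNeg_tsum hg, lintegral_smul_measure]
  have h1 : ∀ x : Plane, 1 - expNeg (negLog (ENNReal.ofReal (bsLaplace p.eta K ‖x‖))) =
      1 - ENNReal.ofReal (bsLaplace p.eta K ‖x‖) := fun x => by
    rw [expNeg_negLog (ENNReal.ofReal_le_one.2 (bsLaplace_le_one hK (norm_nonneg x)))]
  simp_rw [h1]
  rw [lintegral_comp_norm_plane (f := fun u => 1 - ENNReal.ofReal (bsLaplace p.eta K u))
      (by fun_prop), smul_eq_mul, ← lintegral_const_mul _ (by fun_prop)]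
  have h3 : ∀ u, ENNReal.ofReal p.lam * (ENNReal.ofReal (2 * Real.pi * u) *
      (1 - ENNReal.ofReal (bsLaplace p.eta K u))) = ENNReal.ofReal (2 * Real.pi * p.lam * u) *
      (1 - ENNReal.ofReal (bsLaplace p.eta K u)) := fun u => by
    rw [← mul_assoc, ← ENNReal.ofReal_mul hl.le]
    congr 2
    ring
  simp_rw [h3]
  rw [lintegral_one_sub_bsLaplace hl p.two_lt_eta hK, expNeg_ofReal (by positivity)]
  congr 2
  ring

/-- Uplink success probability. -/
theorem measure_ul_success (hN : N.IsModel p ν μ) (hν : ∀ᵐ h ∂ν, 0 ≤ h) {Rd T s : ℝ}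
    (hRd : 0 ≤ Rd) (hT : T = sinrThreshold p .ul Rd) (hs : s = T / (p.rho * |p.intra .ul| ^ 2)) :
    μ {ω | ¬ p.band .ul * Real.logb 2 (1 + N.ulSINR p ω) < Rd} =
      ENNReal.ofReal (Real.exp (-(T * p.No / p.rho)) * p.LIu ν s) := by
  have hρ := p.rho_pos
  have hI := p.intra_pos .ul
  have hPd := p.Pd_pos
  have hn := p.noise_pos .ul
  have hT0 : 0 ≤ T := hT ▸ sinrThreshold_nonneg p .ul hRd
  have hs0 : 0 ≤ s := by rw [hs]; positivity
  -- The success event as a set of positions and marks; its section at given positions unfolds to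
  -- the event of the frozen network.
  let B : Set (((ℕ → Plane) × (ℕ → Plane)) × (Mark → ℝ)) :=
    {q | ¬ p.band .ul * Real.logb 2 (1 + Network.canonical.ulSINR p q) < Rd}
  have hB : MeasurableSet B := (measurableSet_lt (measurable_rate _
    (Network.measurable_ulSINR p Network.measurable_canonical_bs Network.measurable_canonical_ue
      Network.measurable_canonical_mark)) measurable_const).compl
  have hD : IsProbabilityMeasure (N.linkDistLaw p μ) :=
    isProbabilityMeasure_linkDistLaw hN.bs_poisson
  let F : (ℕ → Plane) → (ℕ → Plane) → ℝ≥0∞ := fun x y =>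
    expNeg (∑' j, negLog (ENNReal.ofReal
        (bsLaplace p.eta (s * |p.cross .ul| ^ 2 * p.Pd) ‖x j‖))) *
      expNeg (∑' j, negLog (ueLaplace p (N.linkDistLaw p μ) (s * |p.intra .ul| ^ 2) ‖y j‖))
  have hF : Measurable fun q : (ℕ → Plane) × (ℕ → Plane) => F q.1 q.2 := by
    refine (measurable_expNeg.comp (measurable_ennreal_tsum fun j => ?_)).mul
      (measurable_expNeg.comp (measurable_ennreal_tsum fun j => ?_))
    · exact measurable_negLog.comp (ENNReal.measurable_ofReal.comp
        ((measurable_bsLaplace _ _).comp (by fun_prop)))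
    · exact measurable_negLog.comp ((measurable_uncurry_ueLaplace p (N.linkDistLaw p μ)).comp
        (measurable_const.prodMk (by fun_prop)))
  have h1 : ∀ ω, μ {ω' | ((fun j => N.bs j ω, fun j => N.ue j ω), fun i => N.mark i ω') ∈ B} =
      expNeg (ENNReal.ofReal s * ENNReal.ofReal (p.noise .ul)) * ENNReal.ofReal (p.U3 ν s) *
        F (fun j => N.bs j ω) (fun j => N.ue j ω) := fun ω => by
    have h := measure_ul_success_freeze hN hν (fun j => N.bs j ω) (fun j => N.ue j ω) hT0 hs
    have hset : {ω' | ((fun j => N.bs j ω, fun j => N.ue j ω), fun i => N.mark i ω') ∈ B} =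
        {ω' | ENNReal.ofReal T * ((N.freeze (fun j => N.bs j ω) (fun j => N.ue j ω)).ulInterference
            p ω' + ENNReal.ofReal (p.noise .ul)) ≤
          ENNReal.ofReal (p.txPower (N.mark .ulDist ω') * N.mark .ulDist ω' ^ (-p.eta) *
          N.mark .ulGain ω' * |p.intra .ul| ^ 2)} := by
      ext ω'
      rw [mem_ofPred, mem_ofPred, hT]
      exact not_rate_lt_iff p .ul Rd ENNReal.ofReal_ne_top
    rw [hset, h]
    simp only [F]
    ring
  have h0 := measure_eq_lintegral_freeze hN hB
  simp_rw [h1] at h0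
  have hX : Measurable fun ω j => N.bs j ω := measurable_pi_lambda _ hN.bs_poisson.measurable
  have hY : Measurable fun ω j => N.ue j ω := measurable_pi_lambda _ hN.ue_poisson.measurable
  -- Stations and users are independent, so the two Poisson functionals can be averaged separately.
  have hxy : ∫⁻ ω, F (fun j => N.bs j ω) (fun j => N.ue j ω) ∂μ =
      ∫⁻ ω, ∫⁻ ω', F (fun j => N.bs j ω) (fun j => N.ue j ω') ∂μ ∂μ :=
    lintegral_of_indepFun hX hY hN.bs_indep_ue hF
  rw [lintegral_const_mul' _ _ (ENNReal.mul_ne_top (expNeg_ne_top _) ENNReal.ofReal_ne_top),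
    hxy] at h0
  have h2 : ∀ ω, ∫⁻ ω', F (fun j => N.bs j ω) (fun j => N.ue j ω') ∂μ =
      expNeg (∑' j, negLog (ENNReal.ofReal
        (bsLaplace p.eta (s * |p.cross .ul| ^ 2 * p.Pd) ‖N.bs j ω‖))) *
      ENNReal.ofReal (Real.exp (-2 * Real.pi * p.lam * p.rho ^ (1 - 2 / p.eta) / (p.eta - 2) *
        p.powerMoment * (s * |p.intra .ul| ^ 2) *
        hypergeom 1 (1 - 2 / p.eta) (2 - 2 / p.eta) (-(p.rho * (s * |p.intra .ul| ^ 2))))) :=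
    fun ω => by
      rw [← lintegral_expNeg_ueLaplace hN.bs_poisson rfl hN.ue_poisson
        (by positivity : 0 ≤ s * |p.intra .ul| ^ 2)]
      exact lintegral_const_mul' _ _ (expNeg_ne_top _)
  simp_rw [h2] at h0
  rw [lintegral_mul_const' _ _ ENNReal.ofReal_ne_top, lintegral_expNeg_tsum_bsLaplace hN.bs_poisson
    (by positivity), ← ENNReal.ofReal_mul hs0, expNeg_ofReal (by positivity)] at h0
  refine h0.trans ?_
  have e0 : s * p.noise .ul = T * p.No / p.rho := by
    rw [hs, Params.noise]
    field_simp
  have e1 : p.rho * (s * |p.intra .ul| ^ 2) = p.rho * |p.intra .ul| ^ 2 * s := by ring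
  have e2 : ∀ a b : ℝ, a * (s * |p.intra .ul| ^ 2) * b = a * |p.intra .ul| ^ 2 * s * b :=
    fun a b => by ring
  rw [Params.LIu, e0, e1, e2, ENNReal.ofReal_mul (Real.exp_nonneg _),
    ENNReal.ofReal_mul (mul_nonneg (Real.exp_nonneg _) (Real.exp_nonneg _)),
    ENNReal.ofReal_mul (Real.exp_nonneg _)]
  ring

end Uplink

-- Measurability and sign of the closed-form factors

section Parametric

lemma measurable_intervalIntegral {α : Type*} [MeasurableSpace α] {f : α → ℝ → ℝ}
    (hf : Measurable fun q : α × ℝ => f q.1 q.2) {a b : ℝ} (hab : a ≤ b) :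
    Measurable fun x => ∫ t in a..b, f x t := by
  simp_rw [intervalIntegral.integral_of_le hab]
  exact (hf.stronglyMeasurable.integral_prod_right (ν := volume.restrict (Ioc a b))).measurable

lemma measurable_hypergeom (a b c : ℝ) : Measurable (hypergeom a b c) := by
  unfold hypergeom
  exact (measurable_intervalIntegral (f := fun z t =>
    t ^ (b - 1) * (1 - t) ^ (c - b - 1) * (1 - z * t) ^ (-a)) (by fun_prop)
    zero_le_one).const_mul _

namespace Params

variable {p : Params}

lemma measurable_U1 (m : Mode) : Measurable fun q : ℝ × ℝ => p.U1 q.1 q.2 m := by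
  cases m with
  | twoNode => exact measurable_const
  | threeNode =>
    have hR := p.measurable_fR
    refine measurable_intervalIntegral (α := ℝ × ℝ) (measurable_intervalIntegral
      (α := (ℝ × ℝ) × ℝ) ?_ Real.pi_pos.le) p.RM_pos.le
    exact Measurable.div (hR.comp (by fun_prop)) (by fun_prop)

lemma measurable_U2 (ν : Measure ℝ) [SFinite ν] (m : Mode) :
    Measurable fun q : ℝ × ℝ => p.U2 ν q.1 q.2 m := by
  cases m with
  | threeNode => exact measurable_const
  | twoNode =>
    have h : Measurable fun w : (ℝ × ℝ) × ℝ =>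
      Real.exp (-(p.beta .dl * w.1.2 * w.2 * p.rho * w.1.1 ^ p.eta * |p.cross .dl| ^ 2)) := by
      fun_prop
    exact (h.stronglyMeasurable.integral_prod_right (ν := ν)).measurable

lemma measurable_LId (m : Mode) (ν : Measure ℝ) [SFinite ν] :
    Measurable fun q : ℝ × ℝ => p.LId m ν q.1 q.2 := by
  unfold LId
  have h1 := measurable_hypergeom 1 (1 - 2 / p.eta) (2 - 2 / p.eta)
  refine ((Measurable.mul ?_ ?_).mul (measurable_U1 m)).mul (measurable_U2 ν m)
  · exact Real.measurable_exp.comp (Measurable.mul (by fun_prop) (h1.comp (by fun_prop)))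
  · exact Real.measurable_exp.comp (Measurable.mul (by fun_prop) (h1.comp (by fun_prop)))

lemma U1_nonneg (r : ℝ) {s : ℝ} (hs : 0 ≤ s) (m : Mode) : 0 ≤ p.U1 r s m := by
  have hρ := p.rho_pos
  cases m with
  | twoNode => exact zero_le_one
  | threeNode =>
    refine intervalIntegral.integral_nonneg p.RM_pos.le fun d hd => ?_
    refine intervalIntegral.integral_nonneg Real.pi_pos.le fun θ _ => ?_
    have h1 : 0 ≤ 1 + (r / d) ^ 2 - 2 * (r / d) * Real.cos θ := by
      nlinarith [sq_nonneg (r / d - Real.cos θ), Real.cos_sq_le_one θ]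
    have h2 := Real.rpow_nonneg h1 (-p.eta / 2)
    have h3 := p.fR_nonneg hd.1
    have h4 := Real.pi_pos
    positivity

lemma U2_nonneg (ν : Measure ℝ) (r s : ℝ) (m : Mode) : 0 ≤ p.U2 ν r s m := by
  cases m with
  | threeNode => exact zero_le_one
  | twoNode => exact integral_nonneg fun h => Real.exp_nonneg _

end Params

end Parametric

-- The downlink success probability

section Downlink

variable {Ω : Type*} {N : Network Ω} [MeasurableSpace Ω] {μ : Measure Ω} [IsProbabilityMeasure μ]
  {p : Params} {ν : Measure ℝ} [IsProbabilityMeasure ν]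

/-- The product is the Laplace transform of a nonnegative cost. The bound supplies the domination
required by `lintegral_servingDist_mul_expNeg_rpow`. -/
lemma ofReal_U1_mul_U2_le_one (hN : N.IsModel p ν μ) (hν : ∀ᵐ h ∂ν, 0 ≤ h) {r s : ℝ}
    (hr : 0 ≤ r) (hs : 0 ≤ s) (m : Mode) : ENNReal.ofReal (p.U1 r s m * p.U2 ν r s m) ≤ 1 := by
  have hρ := p.rho_pos
  have hβ := p.beta_nonneg .dl
  have hle : ∀ f : Ω → ℝ≥0∞, ∫⁻ ω, expNeg (f ω) ∂μ ≤ 1 := fun f =>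
    (lintegral_mono fun ω => expNeg_le_one _).trans (by simp)
  cases m with
  | twoNode =>
    have h := lintegral_expNeg_self hν (hN.mark_law .selfGain)
      (a := p.beta .dl * s * p.rho * r ^ p.eta * |p.cross .dl| ^ 2) (by positivity)
    have e : p.U1 r s .twoNode * p.U2 ν r s .twoNode =
        ∫ h, Real.exp (-(p.beta .dl * s * p.rho * r ^ p.eta * |p.cross .dl| ^ 2 * h)) ∂ν := by
      simp only [Params.U1, Params.U2, one_mul]
      congr 1
      funext h
      congr 2
      ring
    rw [e, ← h]
    exact hle _
  | threeNode =>
    -- Any point at distance r will do, since U₁ depends on the norm only.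
    have h := lintegral_expNeg_cell hN hs (EuclideanSpace.single 0 r)
    have hn : ‖(EuclideanSpace.single 0 r : Plane)‖ = r := by simp [abs_of_nonneg hr]
    rw [hn] at h
    simp only [Params.U2, mul_one]
    rw [← h]
    exact hle _

/-- Laplace transform of the interference of the users of other cells in the downlink. -/
noncomputable def ueFactor (p : Params) (s : ℝ) : ℝ :=
  Real.exp (-2 * Real.pi * p.lam * p.rho ^ (1 - 2 / p.eta) / (p.eta - 2) *
    p.powerMoment * (s * |p.cross .dl| ^ 2) *
    hypergeom 1 (1 - 2 / p.eta) (2 - 2 / p.eta) (-(p.rho * (s * |p.cross .dl| ^ 2))))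

lemma measurable_ueFactor (p : Params) : Measurable (ueFactor p) := by
  unfold ueFactor
  exact Real.measurable_exp.comp (Measurable.mul (by fun_prop)
    ((measurable_hypergeom _ _ _).comp (by fun_prop)))

/-- Laplace argument of the downlink at serving distance `r` for the SINR threshold `T`. -/
noncomputable def dlArg (p : Params) (T r : ℝ) : ℝ := T / (p.Pd * r ^ (-p.eta) * |p.intra .dl| ^ 2)

lemma measurable_dlArg (p : Params) (T : ℝ) : Measurable (dlArg p T) := by
  unfold dlArg
  fun_prop

lemma dlArg_nonneg {T r : ℝ} (hT : 0 ≤ T) (hr : 0 ≤ r) : 0 ≤ dlArg p T r := by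
  have hPd := p.Pd_pos
  have := Real.rpow_nonneg hr (-p.eta)
  unfold dlArg
  positivity

/-- Contribution of the noise and of the own cell to the downlink success probability. -/
noncomputable def dlOwnFactor (p : Params) (ν : Measure ℝ) (m : Mode) (T : ℝ) : ℝ → ℝ≥0∞ :=
  (Ioc 0 p.RM).indicator fun r =>
    expNeg (ENNReal.ofReal (dlArg p T r) * ENNReal.ofReal (p.noise .dl)) *
      ENNReal.ofReal (p.U1 r (dlArg p T r) m * p.U2 ν r (dlArg p T r) m)

lemma measurable_dlOwnFactor (p : Params) (ν : Measure ℝ) [SFinite ν] (m : Mode) (T : ℝ) :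
    Measurable (dlOwnFactor p ν m T) := by
  have h1 := measurable_dlArg p T
  have h2 : Measurable fun r => (r, dlArg p T r) := measurable_id.prodMk h1
  have h3 : Measurable fun r => expNeg (ENNReal.ofReal (dlArg p T r) *
      ENNReal.ofReal (p.noise .dl)) :=
    measurable_expNeg.comp ((ENNReal.measurable_ofReal.comp h1).mul_const _)
  have h4 : Measurable fun r =>
      ENNReal.ofReal (p.U1 r (dlArg p T r) m * p.U2 ν r (dlArg p T r) m) :=
    ENNReal.measurable_ofReal.comp
      (((Params.measurable_U1 m).comp h2).mul ((Params.measurable_U2 ν m).comp h2))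
  exact (h3.mul h4).indicator measurableSet_Ioc

/-- The network of the positions alone. -/
def Network.positions : Network ((ℕ → Plane) × (ℕ → Plane)) :=
  ⟨fun j q => q.1 j, fun j q => q.2 j, fun _ _ => 0⟩

/-- Downlink success probability given the positions. -/
noncomputable def dlSuccess (p : Params) (ν D : Measure ℝ) (m : Mode) (T : ℝ)
    (x y : ℕ → Plane) : ℝ≥0∞ :=
  dlOwnFactor p ν m T ‖x (nearest x)‖ *
    expNeg (∑' j, if j = nearest x then 0 else negLog (ENNReal.ofReal
      (bsLaplace p.eta (T * ‖x (nearest x)‖ ^ p.eta) ‖x j‖))) *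
    expNeg (∑' j, negLog (ueLaplace p D (dlArg p T ‖x (nearest x)‖ * |p.cross .dl| ^ 2) ‖y j‖))

/-- In the network `Network.positions` the serving index unfolds to `nearest`, so the measurability
results for networks apply to bare families of points. -/
lemma measurable_dlSuccess (p : Params) (ν D : Measure ℝ) [SFinite ν] [SFinite D] (m : Mode)
    (T : ℝ) : Measurable fun q : (ℕ → Plane) × (ℕ → Plane) => dlSuccess p ν D m T q.1 q.2 := by
  have hbs : ∀ j, Measurable (Network.positions.bs j) := fun j => by
    unfold Network.positions
    fun_prop
  have hue : ∀ j, Measurable (Network.positions.ue j) := fun j => by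
    unfold Network.positions
    fun_prop
  have hd : Measurable Network.positions.servingDist := Network.measurable_servingDist hbs
  have h1 : Measurable fun q => dlOwnFactor p ν m T (Network.positions.servingDist q) :=
    (measurable_dlOwnFactor p ν m T).comp hd
  have h2 : Measurable fun q => expNeg (∑' j, if j = Network.positions.serving q then 0 else
      negLog (ENNReal.ofReal (bsLaplace p.eta (T * Network.positions.servingDist q ^ p.eta)
        ‖Network.positions.bs j q‖))) := by
    refine measurable_expNeg.comp (measurable_tsum_ite_serving hbs fun j => ?_)
    exact measurable_negLog.comp (ENNReal.measurable_ofReal.comp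
      ((measurable_uncurry_bsLaplace p.eta).comp
        (((hd.pow_const _).const_mul _).prodMk (hbs j).norm)))
  have h3 : Measurable fun q => expNeg (∑' j, negLog (ueLaplace p D
      (dlArg p T (Network.positions.servingDist q) * |p.cross .dl| ^ 2)
        ‖Network.positions.ue j q‖)) := by
    refine measurable_expNeg.comp (measurable_ennreal_tsum fun j => ?_)
    exact measurable_negLog.comp ((measurable_uncurry_ueLaplace p D).comp
      ((((measurable_dlArg p T).comp hd).mul_const _).prodMk (hue j).norm))
  exact (h1.mul h2).mul h3

lemma ae_servingDist_pos (hX : IsPoissonProcess N.bs (ENNReal.ofReal p.lam • volume) μ) :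
    ∀ᵐ ω ∂μ, 0 < N.servingDist ω := by
  have h := lintegral_servingDist p.lam_pos hX (measurable_one.indicator (measurableSet_Iic (a := 0)))
  have h0 : ∫⁻ r in Ioi (0 : ℝ), (Iic (0 : ℝ)).indicator 1 r * ENNReal.ofReal
      (2 * Real.pi * p.lam * r * Real.exp (-(Real.pi * p.lam * r ^ 2))) = 0 := by
    rw [setLIntegral_congr_fun (g := fun _ => 0) measurableSet_Ioi fun r hr => ?_, lintegral_zero]
    simp [not_le.2 (mem_Ioi.1 hr)]
  have hm : Measurable fun ω => (Iic (0 : ℝ)).indicator (1 : ℝ → ℝ≥0∞) (N.servingDist ω) :=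
    (measurable_one.indicator measurableSet_Iic).comp (N.measurable_servingDist hX.measurable)
  rw [h0, lintegral_eq_zero_iff hm] at h
  filter_upwards [h] with ω hω
  by_contra hc
  simp [not_lt.1 hc] at hω

/-- Probability that the test user is active and the downlink transmission succeeds. -/
lemma measure_active_inter_dl_success (hN : N.IsModel p ν μ) (hν : ∀ᵐ h ∂ν, 0 ≤ h) (m : Mode)
    {Rd T : ℝ} (hRd : 0 ≤ Rd) (hT : T = sinrThreshold p .dl Rd) :
    μ (N.active p ∩ {ω | ¬ p.band .dl * Real.logb 2 (1 + N.dlSINR p m ω) < Rd}) =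
      ∫⁻ ω, dlSuccess p ν (N.linkDistLaw p μ) m T (fun j => N.bs j ω) (fun j => N.ue j ω) ∂μ := by
  have hT0 : 0 ≤ T := hT ▸ sinrThreshold_nonneg p .dl hRd
  let B : Set (((ℕ → Plane) × (ℕ → Plane)) × (Mark → ℝ)) := Network.canonical.active p ∩
    {q | ¬ p.band .dl * Real.logb 2 (1 + Network.canonical.dlSINR p m q) < Rd}
  have hB : MeasurableSet B := (measurableSet_active Network.measurable_canonical_bs).inter
    (measurableSet_lt (measurable_rate _ (Network.measurable_dlSINR p m
      Network.measurable_canonical_bs Network.measurable_canonical_ue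
      Network.measurable_canonical_mark)) measurable_const).compl
  refine (measure_eq_lintegral_freeze hN hB).trans (lintegral_congr_ae ?_)
  filter_upwards [ae_servingDist_pos hN.bs_poisson] with ω hω
  have hmem : ∀ ω', ((fun j => N.bs j ω, fun j => N.ue j ω), fun i => N.mark i ω') ∈ B ↔
      N.servingDist ω ≤ p.RM ∧ ENNReal.ofReal T *
          ((N.freeze (fun j => N.bs j ω) (fun j => N.ue j ω)).dlInterference p m ω' +
            ENNReal.ofReal (p.noise .dl)) ≤
        ENNReal.ofReal (p.Pd * N.servingDist ω ^ (-p.eta) *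
          N.mark (.bsGain (nearest fun j => N.bs j ω)) ω' * |p.intra .dl| ^ 2) := fun ω' => by
    rw [hT]
    exact and_congr (mem_active_iff _) (not_rate_lt_iff p .dl Rd ENNReal.ofReal_ne_top)
  have hset : {ω' | ((fun j => N.bs j ω, fun j => N.ue j ω), fun i => N.mark i ω') ∈ B} =
      {ω' | N.servingDist ω ≤ p.RM ∧ ENNReal.ofReal T *
          ((N.freeze (fun j => N.bs j ω) (fun j => N.ue j ω)).dlInterference p m ω' +
            ENNReal.ofReal (p.noise .dl)) ≤
        ENNReal.ofReal (p.Pd * N.servingDist ω ^ (-p.eta) *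
          N.mark (.bsGain (nearest fun j => N.bs j ω)) ω' * |p.intra .dl| ^ 2)} :=
    Set.ext hmem
  rw [hset]
  change _ = dlOwnFactor p ν m T (N.servingDist ω) * _ * _
  by_cases hR : N.servingDist ω ≤ p.RM
  · simp only [hR, true_and]
    have h := measure_dl_success_freeze hN hν m (fun j => N.bs j ω) (fun j => N.ue j ω) hT0
      (r := N.servingDist ω) rfl ⟨hω, hR⟩ (s := dlArg p T (N.servingDist ω)) rfl
    rw [h, dlOwnFactor, indicator_of_mem (mem_Ioc.2 ⟨hω, hR⟩)]
    exact (by intros; ring : ∀ a b c d : ℝ≥0∞, a * b * c * d = a * d * b * c) _ _ _ _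
  -- For an inactive user the event is empty, and the indicator in `dlOwnFactor` vanishes.
  · simp only [hR, false_and]
    rw [dlOwnFactor, indicator_of_notMem (fun h => hR h.2)]
    simp

lemma ueFactor_nonneg (s : ℝ) : 0 ≤ ueFactor p s := Real.exp_nonneg _

lemma dlOwnFactor_mul_ueFactor_le_one (hN : N.IsModel p ν μ) (hν : ∀ᵐ h ∂ν, 0 ≤ h) (m : Mode)
    {T : ℝ} (hT : 0 ≤ T) (r : ℝ) :
    dlOwnFactor p ν m T r * ENNReal.ofReal (ueFactor p (dlArg p T r)) ≤ 1 := by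
  by_cases hr : r ∈ Ioc 0 p.RM
  · have hs := dlArg_nonneg (p := p) hT hr.1.le
    rw [dlOwnFactor, indicator_of_mem hr, ueFactor,
      ← lintegral_expNeg_ueLaplace hN.bs_poisson rfl hN.ue_poisson (by positivity)]
    refine mul_le_one' (mul_le_one' (expNeg_le_one _) (ofReal_U1_mul_U2_le_one hN hν hr.1.le hs m))
      ((lintegral_mono fun ω => expNeg_le_one _).trans (by simp))
  · rw [dlOwnFactor, indicator_of_notMem hr, zero_mul]
    exact zero_le_one

/-- Averaging the downlink success probability over the positions. -/
lemma lintegral_dlSuccess (hN : N.IsModel p ν μ) (hν : ∀ᵐ h ∂ν, 0 ≤ h) (m : Mode) {T : ℝ}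
    (hT : 0 ≤ T) :
    ∫⁻ ω, dlSuccess p ν (N.linkDistLaw p μ) m T (fun j => N.bs j ω) (fun j => N.ue j ω) ∂μ =
      ∫⁻ r in Ioc 0 p.RM, ENNReal.ofReal
          (2 * Real.pi * p.lam * r * Real.exp (-(Real.pi * p.lam * r ^ 2))) *
        ENNReal.ofReal (Real.exp (-(T * p.No / (p.Pd * r ^ (-p.eta)))) *
          p.LId m ν r (dlArg p T r)) := by
  have hI := p.intra_pos .dl
  have hPd := p.Pd_pos
  have hn := p.noise_pos .dl
  have hl := p.lam_pos
  have h2 := p.two_lt_eta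
  have hD : IsProbabilityMeasure (N.linkDistLaw p μ) :=
    isProbabilityMeasure_linkDistLaw hN.bs_poisson
  have hX : Measurable fun ω j => N.bs j ω := measurable_pi_lambda _ hN.bs_poisson.measurable
  have hY : Measurable fun ω j => N.ue j ω := measurable_pi_lambda _ hN.ue_poisson.measurable
  refine (lintegral_of_indepFun hX hY hN.bs_indep_ue (measurable_dlSuccess p ν _ m T)).trans ?_
  -- Once the users are averaged out, everything but the product over the other stations is a
  -- function of the serving distance.
  let H : ℝ → ℝ≥0∞ := fun r =>
    dlOwnFactor p ν m T r * ENNReal.ofReal (ueFactor p (dlArg p T r))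
  have hH : Measurable H := (measurable_dlOwnFactor p ν m T).mul
    (ENNReal.measurable_ofReal.comp ((measurable_ueFactor p).comp (measurable_dlArg p T)))
  have h1 : ∀ ω, ∫⁻ ω', dlSuccess p ν (N.linkDistLaw p μ) m T (fun j => N.bs j ω)
        (fun j => N.ue j ω') ∂μ =
      H (N.servingDist ω) * expNeg (∑' j, if j = N.serving ω then 0 else negLog (ENNReal.ofReal
        (bsLaplace p.eta (T * N.servingDist ω ^ p.eta) ‖N.bs j ω‖))) := fun ω => by
    have hr : 0 ≤ N.servingDist ω := norm_nonneg _
    have hs := dlArg_nonneg (p := p) hT hr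
    have hne : dlOwnFactor p ν m T (N.servingDist ω) ≠ ⊤ := by
      unfold dlOwnFactor
      by_cases h : N.servingDist ω ∈ Ioc 0 p.RM
      · rw [indicator_of_mem h]
        exact ENNReal.mul_ne_top (expNeg_ne_top _) ENNReal.ofReal_ne_top
      · simp [indicator_of_notMem h]
    refine (lintegral_const_mul' _ _ (ENNReal.mul_ne_top hne (expNeg_ne_top _))).trans ?_
    have h := lintegral_expNeg_ueLaplace hN.bs_poisson rfl hN.ue_poisson
      (s := dlArg p T (N.servingDist ω) * |p.cross .dl| ^ 2) (by positivity)
    refine (congrArg _ h).trans ?_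
    exact mul_right_comm _ _ _
  rw [lintegral_congr h1, lintegral_servingDist_mul_expNeg_rpow hl h2 hN.bs_poisson hH
    (dlOwnFactor_mul_ueFactor_le_one hN hν m hT) hT]
  have hsub : Ioc 0 p.RM ⊆ Ioi (0 : ℝ) := fun r hr => hr.1
  rw [← inter_eq_self_of_subset_left hsub, ← setLIntegral_indicator measurableSet_Ioc]
  refine setLIntegral_congr_fun measurableSet_Ioi fun r hr0 => ?_
  by_cases hr : r ∈ Ioc 0 p.RM
  · have hr' : 0 < r := hr0
    have hs := dlArg_nonneg (p := p) hT hr'.le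
    have hU1 := Params.U1_nonneg (p := p) r hs m
    have hU2 := Params.U2_nonneg (p := p) ν r (dlArg p T r) m
    have hrη : 0 < r ^ p.eta := Real.rpow_pos_of_pos hr' _
    have hF := hypergeom_neg_nonneg h2 hT
    rw [indicator_of_mem hr, lintegral_Ioi_one_sub_bsLaplace hl h2 hT hr',
      expNeg_ofReal (by have : 0 < p.eta - 2 := by linarith
                        positivity)]
    simp only [H]
    rw [dlOwnFactor, indicator_of_mem hr, ← ENNReal.ofReal_mul hs, expNeg_ofReal (by positivity)]
    have e0 : dlArg p T r * p.noise .dl = T * p.No / (p.Pd * r ^ (-p.eta)) := by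
      rw [dlArg, Params.noise]
      have := Real.rpow_pos_of_pos hr' (-p.eta)
      field_simp
    -- The argument of the first hypergeometric function collapses to -T, matching the path-loss
    -- integral with R = r and a = T.
    have e1 : r ^ (-p.eta) * p.Pd * |p.intra .dl| ^ 2 * dlArg p T r = T := by
      rw [dlArg]
      have := Real.rpow_pos_of_pos hr' (-p.eta)
      field_simp
    have e2 : -2 * Real.pi * p.lam / (p.eta - 2) * r ^ (2 - p.eta) * |p.intra .dl| ^ 2 *
        dlArg p T r * p.Pd * hypergeom 1 (1 - 2 / p.eta) (2 - 2 / p.eta) (-T) =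
        -(2 * Real.pi * p.lam / (p.eta - 2) * r ^ 2 * T *
          hypergeom 1 (1 - 2 / p.eta) (2 - 2 / p.eta) (-T)) := by
      have h3 : r ^ (2 - p.eta) = r ^ 2 * r ^ (-p.eta) := by
        rw [sub_eq_add_neg, Real.rpow_add hr', Real.rpow_two]
      rw [h3]
      linear_combination (-(2 * Real.pi * p.lam / (p.eta - 2) * r ^ 2 *
        hypergeom 1 (1 - 2 / p.eta) (2 - 2 / p.eta) (-T))) * e1
    have e3 : ueFactor p (dlArg p T r) = Real.exp (-2 * Real.pi * p.lam *
        p.rho ^ (1 - 2 / p.eta) / (p.eta - 2) * p.powerMoment * |p.cross .dl| ^ 2 * dlArg p T r *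
        hypergeom 1 (1 - 2 / p.eta) (2 - 2 / p.eta)
          (-(p.rho * |p.cross .dl| ^ 2 * dlArg p T r))) := by
      rw [ueFactor]
      congr 1
      rw [show p.rho * (dlArg p T r * |p.cross .dl| ^ 2) =
        p.rho * |p.cross .dl| ^ 2 * dlArg p T r by ring]
      ring
    rw [Params.LId, e0, e1, e2, ← e3, mul_assoc (_ * _) (p.U1 _ _ _),
      ENNReal.ofReal_mul (Real.exp_nonneg _),
      ENNReal.ofReal_mul (mul_nonneg (Real.exp_nonneg _) (ueFactor_nonneg _)),
      ENNReal.ofReal_mul (Real.exp_nonneg _)]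
    ring
  · rw [indicator_of_notMem hr]
    simp only [H]
    rw [dlOwnFactor, indicator_of_notMem hr, zero_mul, zero_mul]

/-- Downlink success probability of an active user. -/
theorem cond_dl_success (hN : N.IsModel p ν μ) (hν : ∀ᵐ h ∂ν, 0 ≤ h) (m : Mode)
    {Rd T : ℝ} (hRd : 0 ≤ Rd) (hT : T = sinrThreshold p .dl Rd) :
    (μ[|N.active p]) {ω | ¬ p.band .dl * Real.logb 2 (1 + N.dlSINR p m ω) < Rd} =
      ∫⁻ r in Ioc 0 p.RM, ENNReal.ofReal (p.fR r *
        (Real.exp (-(T * p.No / (p.Pd * r ^ (-p.eta)))) * p.LId m ν r (dlArg p T r))) := by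
  have hT0 : 0 ≤ T := hT ▸ sinrThreshold_nonneg p .dl hRd
  rw [cond_apply (measurableSet_active hN.bs_poisson.measurable),
    measure_active_inter_dl_success hN hν m hRd hT, lintegral_dlSuccess hN hν m hT0,
    measure_active hN.bs_poisson, ← lintegral_const_mul' _ _ (by simpa using p.activeProb_pos)]
  refine setLIntegral_congr_fun measurableSet_Ioc fun r hr => ?_
  rw [ENNReal.ofReal_mul (p.fR_nonneg hr.1.le), ← measure_active_inv_mul]
  exact (mul_assoc _ _ _).symm

end Downlink

-- From success probabilities to outage

section Outage

variable {Ω : Type*} {N : Network Ω} [MeasurableSpace Ω] {μ : Measure Ω} [IsProbabilityMeasure μ]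
  {p : Params} {ν : Measure ℝ}

lemma Params.LId_nonneg (m : Mode) (ν : Measure ℝ) (r : ℝ) {s : ℝ} (hs : 0 ≤ s) :
    0 ≤ p.LId m ν r s :=
  mul_nonneg (mul_nonneg (by positivity) (Params.U1_nonneg r hs m)) (Params.U2_nonneg ν r s m)

lemma Params.LIu_nonneg (ν : Measure ℝ) (s : ℝ) : 0 ≤ p.LIu ν s :=
  mul_nonneg (by positivity) (integral_nonneg fun h => Real.exp_nonneg _)

variable [IsProbabilityMeasure ν]

theorem ulOutage_eq (hN : N.IsModel p ν μ) (hν : ∀ᵐ h ∂ν, 0 ≤ h) {Rd T : ℝ} (hRd : 0 ≤ Rd)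
    (hT : T = sinrThreshold p .ul Rd) :
    N.ulOutage p μ Rd = 1 - Real.exp (-(T * p.No / p.rho)) *
      p.LIu ν (T / (p.rho * |p.intra .ul| ^ 2)) := by
  have hS : MeasurableSet {ω | p.band .ul * Real.logb 2 (1 + N.ulSINR p ω) < Rd} :=
    measurableSet_lt (measurable_rate _ (N.measurable_ulSINR p hN.bs_poisson.measurable
      hN.ue_poisson.measurable hN.mark_measurable)) measurable_const
  have h := measure_ul_success hN hν hRd hT rfl
  have h1 := probReal_compl_eq_one_sub (μ := μ) hS
  rw [measureReal_def, show {ω | p.band .ul * Real.logb 2 (1 + N.ulSINR p ω) < Rd}ᶜ =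
      {ω | ¬ p.band .ul * Real.logb 2 (1 + N.ulSINR p ω) < Rd} from rfl, h,
    ENNReal.toReal_ofReal (mul_nonneg (Real.exp_nonneg _) (Params.LIu_nonneg ν _))] at h1
  rw [Network.ulOutage]
  linarith

theorem dlOutage_eq (hN : N.IsModel p ν μ) (hν : ∀ᵐ h ∂ν, 0 ≤ h) (m : Mode) {Rd T : ℝ}
    (hRd : 0 ≤ Rd) (hT : T = sinrThreshold p .dl Rd) {f : ℝ → ℝ}
    (hf : f = fun r => p.fR r *
      (Real.exp (-(T * p.No / (p.Pd * r ^ (-p.eta)))) * p.LId m ν r (dlArg p T r))) :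
    IntervalIntegrable f volume 0 p.RM ∧ N.dlOutage p m μ Rd = 1 - ∫ r in (0 : ℝ)..p.RM, f r := by
  have hT0 : 0 ≤ T := hT ▸ sinrThreshold_nonneg p .dl hRd
  have hprob : IsProbabilityMeasure (μ[|N.active p]) := by
    refine cond_isProbabilityMeasure ?_
    rw [measure_active hN.bs_poisson]
    simpa using p.activeProb_pos
  have hS : MeasurableSet {ω | p.band .dl * Real.logb 2 (1 + N.dlSINR p m ω) < Rd} :=
    measurableSet_lt (measurable_rate _ (N.measurable_dlSINR p m hN.bs_poisson.measurable
      hN.ue_poisson.measurable hN.mark_measurable)) measurable_const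
  have h := cond_dl_success hN hν m hRd hT
  have h1 := probReal_compl_eq_one_sub (μ := μ[|N.active p]) hS
  have hm : Measurable f := by
    rw [hf]
    have hL : Measurable fun r => p.LId m ν r (dlArg p T r) :=
      Measurable.comp (g := fun q : ℝ × ℝ => p.LId m ν q.1 q.2) (f := fun r => (r, dlArg p T r))
        (Params.measurable_LId m ν) (measurable_id.prodMk (measurable_dlArg p T))
    have hE : Measurable fun r => Real.exp (-(T * p.No / (p.Pd * r ^ (-p.eta)))) := by fun_prop
    exact p.measurable_fR.mul (hE.mul hL)
  have h0 : ∀ r ∈ Ioc 0 p.RM, 0 ≤ f r := fun r hr => by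
    rw [hf]
    exact mul_nonneg (p.fR_nonneg hr.1.le) (mul_nonneg (Real.exp_nonneg _)
      (Params.LId_nonneg m ν r (dlArg_nonneg hT0 hr.1.le)))
  have hae : 0 ≤ᵐ[volume.restrict (Ioc 0 p.RM)] f :=
    (ae_restrict_iff' measurableSet_Ioc).2 (Eventually.of_forall h0)
  have h' : (μ[|N.active p]) {ω | ¬ p.band .dl * Real.logb 2 (1 + N.dlSINR p m ω) < Rd} =
      ∫⁻ r in Ioc 0 p.RM, ENNReal.ofReal (f r) := by
    rw [h, hf]
  rw [measureReal_def, show {ω | p.band .dl * Real.logb 2 (1 + N.dlSINR p m ω) < Rd}ᶜ =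
      {ω | ¬ p.band .dl * Real.logb 2 (1 + N.dlSINR p m ω) < Rd} from rfl, h',
    ← integral_eq_lintegral_of_nonneg_ae hae hm.aestronglyMeasurable] at h1
  constructor
  -- Integrability comes from the probabilistic identity: f is nonnegative on the range and its
  -- integral is a probability.
  · rw [intervalIntegrable_iff_integrableOn_Ioc_of_le p.RM_pos.le]
    refine ⟨hm.aestronglyMeasurable, ?_⟩
    rw [hasFiniteIntegral_iff_ofReal hae, ← h']
    exact measure_lt_top _ _
  · rw [Network.dlOutage, intervalIntegral.integral_of_le p.RM_pos.le]
    linarith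

end Outage

end CellularOutage

theorem theorem1 {Ω : Type*} [MeasurableSpace Ω] (μ : MeasureTheory.Measure Ω)
    [MeasureTheory.IsProbabilityMeasure μ]
    (p : CellularOutage.Params) (m : CellularOutage.Mode)
    (ν : MeasureTheory.Measure ℝ) [MeasureTheory.IsProbabilityMeasure ν]
    (hν_nonneg : ∀ᵐ h ∂ν, 0 ≤ h) (hν_mean : ∫ h, h ∂ν = 1)
    (N : CellularOutage.Network Ω) (hN : N.IsModel p ν μ)
    (Rd : ℝ) (hRd : 0 ≤ Rd) :
    (IntervalIntegrable
        (fun r₀ : ℝ => p.fR r₀ *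
          Real.exp (p.No * (1 - (2 : ℝ) ^ (Rd / p.band .dl)) / (p.Pd * r₀ ^ (-p.eta))) *
          p.LId m ν r₀
            (((2 : ℝ) ^ (Rd / p.band .dl) - 1) / (p.Pd * r₀ ^ (-p.eta) * |p.intra .dl| ^ 2)))
        MeasureTheory.volume 0 p.RM ∧
      N.dlOutage p m μ Rd =
        1 - ∫ r₀ in (0 : ℝ)..p.RM, p.fR r₀ *
          Real.exp (p.No * (1 - (2 : ℝ) ^ (Rd / p.band .dl)) / (p.Pd * r₀ ^ (-p.eta))) *
          p.LId m ν r₀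
            (((2 : ℝ) ^ (Rd / p.band .dl) - 1) / (p.Pd * r₀ ^ (-p.eta) * |p.intra .dl| ^ 2))) ∧
    N.ulOutage p μ Rd =
      1 - Real.exp (p.No * (1 - (2 : ℝ) ^ (Rd / p.band .ul)) / p.rho) *
        p.LIu ν (((2 : ℝ) ^ (Rd / p.band .ul) - 1) / (p.rho * |p.intra .ul| ^ 2)) := by

  refine ⟨CellularOutage.dlOutage_eq hN hν_nonneg m hRd rfl ?_, ?_⟩
  · funext r
    rw [mul_assoc, show p.No * (1 - (2 : ℝ) ^ (Rd / p.band .dl)) / (p.Pd * r ^ (-p.eta)) =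
      -(CellularOutage.sinrThreshold p .dl Rd * p.No / (p.Pd * r ^ (-p.eta))) by
        rw [CellularOutage.sinrThreshold]
        ring]
    rfl
  · rw [CellularOutage.ulOutage_eq hN hν_nonneg hRd rfl,
      show p.No * (1 - (2 : ℝ) ^ (Rd / p.band .ul)) / p.rho =
        -(CellularOutage.sinrThreshold p .ul Rd * p.No / p.rho) by
        rw [CellularOutage.sinrThreshold]
        ring]
    rfl
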